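/- **Setting.** A piecewise-stationary bandit has $K\ge 1$ arms and horizon $T\ge 2$. In round $t$ arm $k$ would yield a reward $X_{k,t}\in[0,1]$ with law $f_{k,t}$; rewards of different rounds are independent. Let $\mu_{k,t}=\mathbb E[X_{k,t}]$. A change point is a $t\in\{1,\dots,T-1\}$ with $f_{k,t}\ne f_{k,t+1}$ for some $k$; let $\nu_1<\dots<\nu_{M-1}$ be the change points, $\nu_0=0$, $\nu_M=T$, so that $M$ is the number of segments, and $s_i=\nu_i-\nu_{i-1}$. The expected dynamic regret of a policy playing $A_t$ is $\mathcal R(T)=\sum_{t=1}^T\max_k\mu_{k,t}-\mathbb E\big[\sum_{t=1}^T X_{A_t,t}\big]$. **Algorithm.** Inputs are $K$, $T$, $\alpha>0$, an even window size $w$ and a threshold $b$. Start with $\tau=0$, $u=\lceil(\alpha-\frac{K}{4\alpha})^2\rceil$ and $n_k=0$ for all $k$. In round $t=1,\dots,T$: * if $u\le t-\tau<u+K$, play arm $A_t=(t-\tau)-u+1$; * otherwise, first replace $u$ by $\lceil u+\frac K\alpha\sqrt u+\frac{K^2}{4\alpha^2}\rceil$ in case $t-\tau=u+K$, and then play an arm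 $A_t$ maximizing $\frac1{n_k}\sum_{n\le n_k}Z_{k,n}+\sqrt{2\log(t-\tau)/n_k}$ (this is $+\infty$ if $n_k=0$; ties are broken arbitrarily); * increase $n_{A_t}$ by $1$ and store the reward as $Z_{A_t,n_{A_t}}$. If $n_{A_t}\ge w$ and, for the last $w$ samples of arm $A_t$, the sums over the first and the second half of this window differ by more than $b$, set $\tau\leftarrow t$, all $n_k\leftarrow0$, and $u\leftarrow1$ (or, alternatively, $u\leftarrow\lceil(\alpha-\frac K{4\alpha})^2\rceil$). **Tuning.** For a known $\delta>0$, $w$ is $\frac4{\delta^2}\big[\sqrt{\log(2KT^2)}+\sqrt{\log(2T)}\big]^2$ rounded up to an even integer, $b$ is either $\sqrt{w\log(2KT^2)/2}$ or $\sqrt{w\log(2KT^2/2)}$, and $c_1\sqrt{K\log(KT)}\le\alpha\le c_2\sqrt{K\log(KT)}$ with constants $0<c_1\le c_2$. Knowledge of $M$ is not used. **Assumptions.** (i) At each change point $t$ some arm $k$ has $|\mu_{k,t+1}-\mu_{k,t}|\ge\delta$. (ii)$_\kappa$ With $L=\log(KT)+\sqrt{K\log(KT)}$, one has $s_i\ge\kappa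 L\sqrt{s_{i-1}}$ for $2\le i\le M$, and $s_1\ge\kappa L^2$ if $M\ge2$. **Claim.** Let $\delta>0$ and $0<c_1\le c_2$. 1. There are constants $\kappa>0$ and $C$, depending only on $\delta,c_1,c_2$, such that for all $K\ge1$, all $T\ge2$, every such tuning and every bandit satisfying (i) and (ii)$_\kappa$, $\;\mathcal R(T)\le C\sqrt{KMT\log T}$. 2. For every $\kappa>0$ and every $K\ge1$ there is a constant $C$, depending only on $\delta,c_1,c_2,\kappa,K$, such that the same bound holds for all $T\ge2$, every such tuning and every bandit with $K$ arms satisfying (i) and (ii)$_\kappa$. -/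

import Mathlib

open MeasureTheory ProbabilityTheory

universe v

noncomputable section

namespace DimExp

/-! ## Piecewise-stationary bandits -/

/-- The reward distributions `f k t` of a bandit with `K` arms: the law of the reward of arm `k`
in round `t` is a probability measure on `[0,1]`. Rounds are numbered `1, 2, …, T`. -/
structure Bandit (K : ℕ) where
  /-- law of the reward of arm `k` in round `t` -/
  f : Fin K → ℕ → Measure ℝ
  prob : ∀ k t, IsProbabilityMeasure (f k t)
  supp : ∀ k t, f k t (Set.Icc 0 1) = 1

/-- Mean reward of arm `k` in round `t`. -/
def Bandit.mean {K : ℕ} (B : Bandit K) (k : Fin K) (t : ℕ) : ℝ := ∫ x, x ∂(B.f k t)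

open Classical in
/-- The change points before the horizon: the rounds `1 ≤ t ≤ T - 1` such that the law of some arm
differs between rounds `t` and `t + 1`. -/
def Bandit.changeTimes {K : ℕ} (B : Bandit K) (T : ℕ) : Finset ℕ :=
  (Finset.Icc 1 (T - 1)).filter (fun t => ∃ k, B.f k t ≠ B.f k (t + 1))

/-- The number `M` of segments. -/
def Bandit.numSegments {K : ℕ} (B : Bandit K) (T : ℕ) : ℕ := 1 + (B.changeTimes T).card

/-- `ν 0 = 0`, `ν i` is the `i`-th change point in increasing order for `1 ≤ i ≤ M - 1`,
and `ν M = T`. -/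
def Bandit.changePoint {K : ℕ} (B : Bandit K) (T : ℕ) (i : ℕ) : ℕ :=
  if i = 0 then 0
  else if h : i - 1 < (B.changeTimes T).card then
    (B.changeTimes T).orderEmbOfFin rfl ⟨i - 1, h⟩
  else T

/-- Length `s i = ν i - ν (i - 1)` of the `i`-th segment, `1 ≤ i ≤ M`. -/
def Bandit.segLength {K : ℕ} (B : Bandit K) (T : ℕ) (i : ℕ) : ℕ :=
  B.changePoint T i - B.changePoint T (i - 1)

/-- At every change point the mean of some arm moves by at least `δ`. -/
def Bandit.GapAtLeast {K : ℕ} (B : Bandit K) (T : ℕ) (δ : ℝ) : Prop :=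
  ∀ t ∈ B.changeTimes T, ∃ k, δ ≤ |B.mean k (t + 1) - B.mean k t|

/-- The scale `log (KT) + √(K log (KT))` of the segment-length assumption. -/
def segScale (K T : ℕ) : ℝ :=
  Real.log (K * T) + Real.sqrt (K * Real.log (K * T))

/-- `s i ≥ κ (log (KT) + √(K log (KT))) √(s (i - 1))` for `2 ≤ i ≤ M`. The first segment has no
predecessor; if a change occurs at all, it is compared with the square of the same scale. -/
def Bandit.LongSegments {K : ℕ} (B : Bandit K) (T : ℕ) (κ : ℝ) : Prop :=
  (2 ≤ B.numSegments T → κ * segScale K T ^ 2 ≤ B.segLength T 1) ∧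
  ∀ i, 2 ≤ i → i ≤ B.numSegments T →
    κ * segScale K T * Real.sqrt (B.segLength T (i - 1)) ≤ B.segLength T i

/-- `X t ω k` is the reward that arm `k` yields in round `t`: it has law `f k t`, and rewards of
different rounds are independent (nothing is assumed about different arms in the same round). -/
structure Bandit.IsRewardSeq {K : ℕ} (B : Bandit K) {Ω : Type*} [MeasurableSpace Ω]
    (P : Measure Ω) (X : ℕ → Ω → Fin K → ℝ) : Prop where
  measurable : ∀ t, Measurable (X t)
  law : ∀ k t, P.map (fun ω => X t ω k) = B.f k t
  indep : iIndepFun X P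

/-! ## The window change detector -/

/-- The detector `CD(w, b, z 1, …, z w)`: it raises an alarm iff the sums over the two halves of
the window differ by more than `b`. -/
def CD (w : ℕ) (b : ℝ) (z : ℕ → ℝ) : Prop :=
  b < |∑ l ∈ Finset.Icc (w / 2 + 1) w, z l - ∑ l ∈ Finset.Icc 1 (w / 2), z l|

/-- The window size: `(4 / δ²) (√log (2KT²) + √log (2T))²`, rounded up to an even integer. -/
def windowSize (K T : ℕ) (δ : ℝ) : ℕ :=
  2 * ⌈(4 / δ ^ 2 *
    (Real.sqrt (Real.log (2 * K * T ^ 2)) + Real.sqrt (Real.log (2 * T))) ^ 2) / 2⌉₊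

/-- The threshold in the form `√(w log (2KT²/2))`. -/
def threshold (K T w : ℕ) : ℝ := Real.sqrt (w * Real.log (2 * K * T ^ 2 / 2))

/-- The threshold in the form `√(w log (2KT²) / 2)`. -/
def threshold' (K T w : ℕ) : ℝ := Real.sqrt (w * Real.log (2 * K * T ^ 2) / 2)

/-! ## UCB with diminishing exploration and change detection -/

/-- The tuning of the algorithm. -/
structure Params (K : ℕ) where
  /-- exploration parameter -/
  α : ℝ
  /-- window size of the detector -/
  w : ℕ
  /-- threshold of the detector -/
  b : ℝ
  /-- value of `u` after a reset -/
  uReset : ℕ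
  /-- tie-breaking rule: picks one arm out of a set of maximizers -/
  sel : Finset (Fin K) → Fin K

/-- Memory of the algorithm between two rounds: the time `τ` of the last alarm, the start `u`
(relative to `τ`) of the current or next exploration session, the numbers `n k` of samples of arm
`k` since `τ`, and these samples `Z k 1, …, Z k (n k)`. -/
structure State (K : ℕ) where
  τ : ℕ
  u : ℕ
  n : Fin K → ℕ
  Z : Fin K → ℕ → ℝ

/-- First exploration start `⌈(α - K/(4α))²⌉`. -/
def firstStart (K : ℕ) (α : ℝ) : ℕ := ⌈(α - K / (4 * α)) ^ 2⌉₊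

/-- Next exploration start `⌈u + (K/α) √u + K²/(4α²)⌉`. -/
def nextStart (K : ℕ) (α : ℝ) (u : ℕ) : ℕ :=
  ⌈(u : ℝ) + K / α * Real.sqrt u + (K : ℝ) ^ 2 / (4 * α ^ 2)⌉₊

/-- State before round `1`. -/
def initState {K : ℕ} (p : Params K) : State K where
  τ := 0
  u := firstStart K p.α
  n := fun _ => 0
  Z := fun _ _ => 0

/-- UCB index of arm `k` in round `t`; an arm without samples has index `+∞`. -/
def ucb {K : ℕ} (s : State K) (t : ℕ) (k : Fin K) : EReal :=
  if s.n k = 0 then ⊤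
  else (((1 / (s.n k : ℝ)) * ∑ l ∈ Finset.Icc 1 (s.n k), s.Z k l +
    Real.sqrt (2 * Real.log ((t : ℝ) - s.τ) / s.n k) : ℝ) : EReal)

open Classical in
/-- The arms of maximal UCB index. -/
def ucbMaximizers {K : ℕ} (s : State K) (t : ℕ) : Finset (Fin K) :=
  Finset.univ.filter (fun k => ∀ j, ucb s t j ≤ ucb s t k)

/-- The arm `A_t` played in round `t` from the state `s` left by the earlier rounds: inside a
session, `u ≤ t - τ < u + K`, the arms are explored one after the other (arms are numbered from
`0` here); otherwise an arm of maximal index is played. -/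
def action {K : ℕ} (p : Params K) (s : State K) (t : ℕ) : Fin K :=
  if h : s.u ≤ t - s.τ ∧ t - s.τ < s.u + K then ⟨t - s.τ - s.u, by omega⟩
  else p.sel (ucbMaximizers s t)

open Classical in
/-- The state after round `t`, in which the arms would yield the rewards `x`; only the reward of
the arm played is used. -/
def step {K : ℕ} (p : Params K) (s : State K) (t : ℕ) (x : Fin K → ℝ) : State K :=
  let a := action p s t
  let u' := if t - s.τ = s.u + K then nextStart K p.α s.u else s.u
  let n' := Function.update s.n a (s.n a + 1)
  let Z' := Function.update s.Z a (Function.update (s.Z a) (n' a) (x a))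
  if p.w ≤ n' a ∧ CD p.w p.b (fun l => Z' a (n' a - p.w + l)) then
    { τ := t, u := p.uReset, n := fun _ => 0, Z := Z' }
  else
    { τ := s.τ, u := u', n := n', Z := Z' }

/-- The state after round `t` on the reward table `x` (`x t k` is the reward of arm `k` in round
`t ≥ 1`). -/
def run {K : ℕ} (p : Params K) (x : ℕ → Fin K → ℝ) : ℕ → State K
  | 0 => initState p
  | t + 1 => step p (run p x t) (t + 1) (x (t + 1))

/-- The arm played in round `t ≥ 1` on the reward table `x`. -/
def armPlayed {K : ℕ} (p : Params K) (x : ℕ → Fin K → ℝ) (t : ℕ) : Fin K :=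
  action p (run p x (t - 1)) t

/-- The expected dynamic regret
`∑_{t ≤ T} max_k E[X_{k,t}] - E[∑_{t ≤ T} X_{A_t,t}]` of the algorithm. -/
def regret {K : ℕ} (B : Bandit K) (p : Params K) {Ω : Type*} [MeasurableSpace Ω]
    (P : Measure Ω) (X : ℕ → Ω → Fin K → ℝ) (T : ℕ) : ℝ :=
  ∑ t ∈ Finset.Icc 1 T, (⨆ k, B.mean k t) -
    ∫ ω, ∑ t ∈ Finset.Icc 1 T, X t ω (armPlayed p (fun r => X r ω) t) ∂P

/-- The tuning is the one of the result, for a known lower bound `δ` on the size of the changes and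
`c₁ √(K log (KT)) ≤ α ≤ c₂ √(K log (KT))`; it does not involve the environment. Either form of the
threshold and either restart value of `u` is allowed, and ties are broken arbitrarily. -/
structure Params.Tuned {K : ℕ} (p : Params K) (T : ℕ) (δ c₁ c₂ : ℝ) : Prop where
  α_lower : c₁ * Real.sqrt (K * Real.log (K * T)) ≤ p.α
  α_upper : p.α ≤ c₂ * Real.sqrt (K * Real.log (K * T))
  w_eq : p.w = windowSize K T δ
  b_eq : p.b = threshold K T p.w ∨ p.b = threshold' K T p.w
  uReset_eq : p.uReset = 1 ∨ p.uReset = firstStart K p.α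
  sel_mem : ∀ S : Finset (Fin K), S.Nonempty → p.sel S ∈ S

/-- With `K` arms, every horizon `T ≥ 2`, every such tuning and every environment that satisfies the
assumptions on the size of the changes (with `δ`) and on the lengths of the segments (with `κ`), the
regret is at most `C √(K M T log T)`. -/
def RegretBound (δ c₁ c₂ κ : ℝ) (K : ℕ) (C : ℝ) : Prop :=
  ∀ (T : ℕ), 2 ≤ T → ∀ (p : Params K), p.Tuned T δ c₁ c₂ →
    ∀ (B : Bandit K), B.GapAtLeast T δ → B.LongSegments T κ →
      ∀ (Ω : Type v) [MeasurableSpace Ω] (P : Measure Ω) [IsProbabilityMeasure P]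
        (X : ℕ → Ω → Fin K → ℝ), B.IsRewardSeq P X →
        regret B p P X T ≤ C * Real.sqrt (K * B.numSegments T * T * Real.log T)

end DimExp

end

/-! On a fixed reward table the run is deterministic. The proof therefore splits into a pathwise
part, valid on tables with small noise, and a probability estimate for the remaining tables.

The link between the two is `weight`: a sum over stored samples equals a sum over rounds whose
coefficients are known before the reward of the round is drawn (`sum_weight_mul`). Given the past,
the arm is fixed and its reward obeys Hoeffding's lemma, so the exponential of the weighted noise,
suitably compensated, has mean at most 1 (`IsPredictable.lintegral_exp_sum_le`). Hoeffding's
inequality follows for window statistics and sample means, although arms, alarm times and sample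
times are random. A window is labelled by its first round, so only `T` of them enter the union
bound.

Detection. If the window noise is small, no alarm occurs while the means are constant since the last
alarm (`QuietWindows.not_alarm`), and a jump of size `δ` triggers one as soon as the arm has half a
window of samples on either side (`QuietWindows.exists_alarm`). The update of `u` increases `√u` by
about `K/(2α)` per session. Hence `s` rounds after an alarm contain at most `2α√s + K` exploration
rounds, while consecutive sessions are about `(K/α)√s` rounds apart. With `w` of order `log(KT)` and
`α` of order `√(K log(KT))`, exploration cost and detection delay are both of order `√(K log(KT))
√s`. The assumption on segment lengths makes the delay a small fraction of the segment before the
change and at most half of the one after it, so an induction over segments shows that every change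
is detected (`DetectionRegime.exists_alarm`).

Regret. Between alarms the usual UCB argument gives order `√(K s log(KT))`. The last alarm time is
random, so underestimation of the best arm is controlled for all `τ < T` simultaneously: the first
`r₀` rounds after each alarm are conceded, and later ones cost at most `T/r₀²` in total. Taking `r₀`
about `√(T/M)` keeps both terms of order `√(MT)`. Cauchy–Schwarz gives `∑ √s_i ≤ √(MT)`. Finally
`log(KT) ≤ 2 log T` if `K ≤ T`, and for `K ≥ T` the trivial bound `T` suffices. For arbitrary `κ`
and fixed `K`, the summand `log(KT)` of the scale eventually exceeds any multiple of `√(K log(KT))`;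
the remaining bounded range of `T` goes into the constant. -/

noncomputable section

namespace DimExp

/-! ## Structure of a run -/

section Structure

variable {K : ℕ}

/-- The samples of arm `k` stored after the reward `y` is appended to those in `s`. -/
def appended (s : State K) (k : Fin K) (y : ℝ) : ℕ → ℝ :=
  Function.update (s.Z k) (s.n k + 1) y

/-- The detector raises an alarm in round `t` from the state `s` on the rewards `x`. -/
def Alarm (p : Params K) (s : State K) (t : ℕ) (x : Fin K → ℝ) : Prop :=
  p.w ≤ s.n (action p s t) + 1 ∧
    CD p.w p.b (fun l => appended s (action p s t) (x (action p s t))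
      (s.n (action p s t) + 1 - p.w + l))

/-- The arm played in round `s + 1`. -/
abbrev arm (p : Params K) (x : ℕ → Fin K → ℝ) (s : ℕ) : Fin K := action p (run p x s) (s + 1)

/-- The detector raises an alarm in round `s + 1`. -/
abbrev AlarmAt (p : Params K) (x : ℕ → Fin K → ℝ) (s : ℕ) : Prop :=
  Alarm p (run p x s) (s + 1) (x (s + 1))

variable {p : Params K} {x : ℕ → Fin K → ℝ} {s t : ℕ}

theorem step_of_alarm {σ : State K} {y : Fin K → ℝ} (h : Alarm p σ t y) :
    (step p σ t y).τ = t ∧ (step p σ t y).u = p.uReset ∧ (step p σ t y).n = fun _ => 0 := by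
  have h' : p.w ≤ Function.update σ.n (action p σ t) (σ.n (action p σ t) + 1) (action p σ t) ∧
      CD p.w p.b (fun l => Function.update σ.Z (action p σ t)
        (Function.update (σ.Z (action p σ t))
          (Function.update σ.n (action p σ t) (σ.n (action p σ t) + 1) (action p σ t))
          (y (action p σ t))) (action p σ t)
        (Function.update σ.n (action p σ t) (σ.n (action p σ t) + 1) (action p σ t) - p.w + l)) := by
    simpa [Alarm, appended] using h
  simp only [step]
  rw [if_pos h']
  exact ⟨rfl, rfl, rfl⟩

theorem step_of_not_alarm {σ : State K} {y : Fin K → ℝ} (h : ¬ Alarm p σ t y) :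
    step p σ t y = { τ := σ.τ
                     u := if t - σ.τ = σ.u + K then nextStart K p.α σ.u else σ.u
                     n := Function.update σ.n (action p σ t) (σ.n (action p σ t) + 1)
                     Z := Function.update σ.Z (action p σ t)
                       (appended σ (action p σ t) (y (action p σ t))) } := by
  have h' : ¬ (p.w ≤ Function.update σ.n (action p σ t) (σ.n (action p σ t) + 1) (action p σ t) ∧
      CD p.w p.b (fun l => Function.update σ.Z (action p σ t)
        (Function.update (σ.Z (action p σ t))
          (Function.update σ.n (action p σ t) (σ.n (action p σ t) + 1) (action p σ t))
          (y (action p σ t))) (action p σ t)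
        (Function.update σ.n (action p σ t) (σ.n (action p σ t) + 1) (action p σ t)
          - p.w + l))) := by
    simpa [Alarm, appended] using h
  simp only [step]
  rw [if_neg h']
  simp [appended]

theorem run_succ_of_alarm (h : AlarmAt p x s) :
    (run p x (s + 1)).τ = s + 1 ∧ (run p x (s + 1)).u = p.uReset ∧
      (run p x (s + 1)).n = fun _ => 0 :=
  step_of_alarm h

theorem run_succ_of_not_alarm (h : ¬ AlarmAt p x s) :
    run p x (s + 1) =
      { τ := (run p x s).τ
        u := if s + 1 - (run p x s).τ = (run p x s).u + K then nextStart K p.α (run p x s).u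
          else (run p x s).u
        n := Function.update (run p x s).n (arm p x s) ((run p x s).n (arm p x s) + 1)
        Z := Function.update (run p x s).Z (arm p x s)
          (appended (run p x s) (arm p x s) (x (s + 1) (arm p x s))) } :=
  step_of_not_alarm h

theorem tau_le (p : Params K) (x : ℕ → Fin K → ℝ) (s : ℕ) : (run p x s).τ ≤ s := by
  induction s with
  | zero => exact le_rfl
  | succ s ih =>
    by_cases h : AlarmAt p x s
    · exact (run_succ_of_alarm h).1.le
    · rw [run_succ_of_not_alarm h]; exact ih.trans (Nat.le_succ s)

theorem tau_mono (p : Params K) (x : ℕ → Fin K → ℝ) : Monotone fun s => (run p x s).τ := by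
  refine monotone_nat_of_le_succ fun s => ?_
  by_cases h : AlarmAt p x s
  · rw [(run_succ_of_alarm h).1]; exact (tau_le p x s).trans (Nat.le_succ s)
  · rw [run_succ_of_not_alarm h]

theorem not_alarm_of_tau_eq (h : (run p x (s + 1)).τ = (run p x s).τ) : ¬ AlarmAt p x s := by
  intro ha
  have := (run_succ_of_alarm ha).1
  have := tau_le p x s
  omega

theorem tau_eq_of_between {r : ℕ} (hst : s ≤ r) (hrt : r ≤ t)
    (h : (run p x t).τ = (run p x s).τ) : (run p x r).τ = (run p x s).τ :=
  le_antisymm (h ▸ tau_mono p x hrt) (tau_mono p x hst)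

theorem n_succ (h : ¬ AlarmAt p x s) (k : Fin K) :
    (run p x (s + 1)).n k = (run p x s).n k + if arm p x s = k then 1 else 0 := by
  rw [run_succ_of_not_alarm h]
  by_cases hk : arm p x s = k
  · subst hk; simp
  · rw [if_neg hk]
    simp [Function.update_of_ne (Ne.symm hk)]

theorem n_mono (hst : s ≤ t) (h : (run p x t).τ = (run p x s).τ) (k : Fin K) :
    (run p x s).n k ≤ (run p x t).n k := by
  induction t, hst using Nat.le_induction with
  | base => exact le_rfl
  | succ t hst ih =>
    have h1 := tau_eq_of_between hst (Nat.le_succ t) h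
    rw [n_succ (not_alarm_of_tau_eq (h.trans h1.symm))]
    exact (ih h1).trans (Nat.le_add_right _ _)

theorem n_lt_of_played (hst : s < t) (h : (run p x t).τ = (run p x s).τ) :
    (run p x s).n (arm p x s) < (run p x t).n (arm p x s) := by
  have h1 := tau_eq_of_between (Nat.le_succ s) hst h
  have := n_mono (p := p) (x := x) (s := s + 1) hst (h.trans h1.symm) (arm p x s)
  rw [n_succ (not_alarm_of_tau_eq h1), if_pos rfl] at this
  omega

/-- The weight `h j` on round `s + 1` if the last alarm before it is at `τ` and the round yields
the `j`-th sample of arm `k` since then, and `0` otherwise. -/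
def weight (p : Params K) (x : ℕ → Fin K → ℝ) (τ : ℕ) (k : Fin K) (h : ℕ → ℝ) (s : ℕ) : ℝ :=
  if (run p x s).τ = τ ∧ arm p x s = k then h ((run p x s).n k + 1) else 0

theorem weight_eq_zero_of_lt {τ : ℕ} {k : Fin K} {h : ℕ → ℝ} (hτ : (run p x s).τ < τ) :
    weight p x τ k h s = 0 := if_neg fun h => hτ.ne h.1

/-- Each round that plays `k` after the last alarm contributes exactly one new sample index. An
alarm empties both sides at once: the samples are discarded, and all earlier rounds carry a smaller
`τ`. -/
theorem sum_weight_aux (h : ℕ → ℝ) (k : Fin K) (t : ℕ) :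
    (∑ s ∈ Finset.range t, weight p x (run p x t).τ k h s * x (s + 1) k
        = ∑ l ∈ Finset.Icc 1 ((run p x t).n k), h l * (run p x t).Z k l) ∧
      ∑ s ∈ Finset.range t, weight p x (run p x t).τ k h s
        = ∑ l ∈ Finset.Icc 1 ((run p x t).n k), h l := by
  induction t with
  | zero => simp [run, initState]
  | succ t ih =>
    by_cases ha : AlarmAt p x t
    · have h0 : ∀ s ∈ Finset.range (t + 1), weight p x (run p x (t + 1)).τ k h s = 0 := by
        intro s hs
        refine weight_eq_zero_of_lt ?_
        rw [(run_succ_of_alarm ha).1]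
        exact (tau_le p x s).trans_lt (Finset.mem_range.1 hs)
      constructor
      · rw [Finset.sum_eq_zero fun s hs => by rw [h0 s hs, zero_mul], (run_succ_of_alarm ha).2.2]
        simp
      · rw [Finset.sum_eq_zero h0, (run_succ_of_alarm ha).2.2]
        simp
    · have hτ : (run p x (t + 1)).τ = (run p x t).τ := by rw [run_succ_of_not_alarm ha]
      rw [Finset.sum_range_succ, Finset.sum_range_succ, hτ, ih.1, ih.2, n_succ ha]
      by_cases hk : arm p x t = k
      · have hw : weight p x (run p x t).τ k h t = h ((run p x t).n k + 1) := if_pos ⟨rfl, hk⟩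
        rw [if_pos hk, Finset.sum_Icc_succ_top (by omega), Finset.sum_Icc_succ_top (by omega), hw]
        have hZ : (run p x (t + 1)).Z k = appended (run p x t) k (x (t + 1) k) := by
          rw [run_succ_of_not_alarm ha]; subst hk; simp
        refine ⟨?_, rfl⟩
        rw [hZ]
        congr 1
        · refine Finset.sum_congr rfl fun l hl => ?_
          rw [appended, Function.update_of_ne]
          have := (Finset.mem_Icc.1 hl).2
          omega
        · simp [appended]
      · have hw : weight p x (run p x t).τ k h t = 0 := if_neg fun h => hk h.2
        have hZ : (run p x (t + 1)).Z k = (run p x t).Z k := by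
          rw [run_succ_of_not_alarm ha]
          simp [Function.update_of_ne (Ne.symm hk)]
        rw [if_neg hk, hw, hZ]
        simp

theorem sum_weight_mul (h : ℕ → ℝ) (k : Fin K) (t : ℕ) :
    ∑ s ∈ Finset.range t, weight p x (run p x t).τ k h s * x (s + 1) k
      = ∑ l ∈ Finset.Icc 1 ((run p x t).n k), h l * (run p x t).Z k l :=
  (sum_weight_aux h k t).1

theorem sum_weight (h : ℕ → ℝ) (k : Fin K) (t : ℕ) :
    ∑ s ∈ Finset.range t, weight p x (run p x t).τ k h s
      = ∑ l ∈ Finset.Icc 1 ((run p x t).n k), h l :=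
  (sum_weight_aux h k t).2

theorem weight_arm (h : ℕ → ℝ) (t : ℕ) :
    weight p x (run p x t).τ (arm p x t) h t = h ((run p x t).n (arm p x t) + 1) :=
  if_pos ⟨rfl, rfl⟩

theorem sum_weight_mul_succ (h : ℕ → ℝ) (t : ℕ) :
    ∑ s ∈ Finset.range (t + 1), weight p x (run p x t).τ (arm p x t) h s * x (s + 1) (arm p x t)
      = ∑ l ∈ Finset.Icc 1 ((run p x t).n (arm p x t) + 1),
          h l * appended (run p x t) (arm p x t) (x (t + 1) (arm p x t)) l := by
  rw [Finset.sum_range_succ, sum_weight_mul, Finset.sum_Icc_succ_top (by omega), weight_arm]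
  congr 1
  · refine Finset.sum_congr rfl fun l hl => ?_
    rw [appended, Function.update_of_ne]
    have := (Finset.mem_Icc.1 hl).2
    omega
  · simp [appended]

theorem sum_weight_succ (h : ℕ → ℝ) (t : ℕ) :
    ∑ s ∈ Finset.range (t + 1), weight p x (run p x t).τ (arm p x t) h s
      = ∑ l ∈ Finset.Icc 1 ((run p x t).n (arm p x t) + 1), h l := by
  rw [Finset.sum_range_succ, sum_weight, Finset.sum_Icc_succ_top (by omega), weight_arm]

/-- After the first `n k` samples are taken, a profile supported on them gives no weight. -/
theorem weight_eq_zero_of_le {τ : ℕ} {k : Fin K} {h : ℕ → ℝ} {N : ℕ} (hτ : (run p x t).τ = τ)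
    (hN : N ≤ (run p x t).n k) (hh : ∀ l, N < l → h l = 0) (hts : t ≤ s) :
    weight p x τ k h s = 0 := by
  unfold weight
  split_ifs with hs
  · have := n_mono hts (hs.1.trans hτ.symm) k
    exact hh _ (by omega)
  · rfl

/-- Distinct rounds with the same `τ` and `k` yield distinct sample indices, so the squared weights
form a subsum of the squared profile. This gives the deterministic variance bound needed for
Hoeffding's inequality. -/
theorem sum_weight_sq_le (τ : ℕ) (k : Fin K) (h : ℕ → ℝ) (T : ℕ) (V : ℝ)
    (hV : ∀ S : Finset ℕ, (∀ l ∈ S, 1 ≤ l) → ∑ l ∈ S, h l ^ 2 ≤ V) :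
    ∑ s ∈ Finset.range T, weight p x τ k h s ^ 2 ≤ V := by
  classical
  have h1 : ∑ s ∈ Finset.range T, weight p x τ k h s ^ 2
      = ∑ s ∈ (Finset.range T).filter (fun s => (run p x s).τ = τ ∧ arm p x s = k),
          h ((run p x s).n k + 1) ^ 2 := by
    rw [Finset.sum_filter]
    refine Finset.sum_congr rfl fun s _ => ?_
    unfold weight
    split_ifs <;> simp
  have hinj : Set.InjOn (fun s => (run p x s).n k + 1)
      ((Finset.range T).filter (fun s => (run p x s).τ = τ ∧ arm p x s = k)) := by
    have key : ∀ a b, a < b → ((run p x a).τ = τ ∧ arm p x a = k) →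
        ((run p x b).τ = τ ∧ arm p x b = k) → (run p x a).n k < (run p x b).n k := by
      intro a b hab ha hb
      have := n_lt_of_played hab (hb.1.trans ha.1.symm)
      rwa [ha.2] at this
    intro a ha b hb hab
    simp only [Finset.coe_filter, Set.mem_ofPred_eq] at ha hb hab
    rcases lt_trichotomy a b with h | h | h
    · have := key a b h ha.2 hb.2; omega
    · exact h
    · have := key b a h hb.2 ha.2; omega
  rw [h1, ← Finset.sum_image (f := fun l => h l ^ 2) hinj]
  exact hV _ fun l hl => by
    obtain ⟨i, -, rfl⟩ := Finset.mem_image.1 hl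
    exact Nat.succ_pos _

end Structure

/-! ## The exploration schedule -/

section Schedule

variable {K : ℕ} {p : Params K} {x : ℕ → Fin K → ℝ} {s t τ : ℕ}

theorem lt_nextStart {α : ℝ} (hK : 1 ≤ K) (hα : 0 < α) (v : ℕ) : v < nextStart K α v := by
  rw [nextStart, Nat.lt_ceil]
  have : (0 : ℝ) < K := by exact_mod_cast hK
  have h1 : 0 < (K : ℝ) ^ 2 / (4 * α ^ 2) := by positivity
  have h2 : 0 ≤ K / α * Real.sqrt v := by positivity
  linarith

theorem nextStart_mono {α : ℝ} (hα : 0 < α) : Monotone (nextStart K α) := by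
  intro v w hvw
  have h : (v : ℝ) ≤ w := by exact_mod_cast hvw
  unfold nextStart
  gcongr

/-- Early sessions may overlap and are then cut short, because `u` is replaced only in round `u +
K`. Once `√v ≥ α`, the term `(K/α)√v` alone is at least `K`. -/
theorem add_lt_nextStart {α : ℝ} (hK : 1 ≤ K) (hα : 0 < α) {v : ℕ} (hv : α ^ 2 ≤ v) :
    v + K < nextStart K α v := by
  rw [nextStart, Nat.lt_ceil]
  have hK' : (0 : ℝ) < K := by exact_mod_cast hK
  have h1 : 0 < (K : ℝ) ^ 2 / (4 * α ^ 2) := by positivity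
  have h2 : α ≤ Real.sqrt v := Real.le_sqrt_of_sq_le hv
  have h3 : (K : ℝ) ≤ K / α * Real.sqrt v :=
    calc (K : ℝ) = K / α * α := by field_simp
      _ ≤ _ := by gcongr
  push_cast
  linarith

theorem nextStart_le {α : ℝ} (hα : 0 < α) (v : ℕ) :
    (nextStart K α v : ℝ) ≤ v + K / α * Real.sqrt v + (K / α) ^ 2 / 4 + 1 := by
  have h : (0 : ℝ) ≤ (v : ℝ) + K / α * Real.sqrt v + (K : ℝ) ^ 2 / (4 * α ^ 2) := by positivity
  refine (Nat.ceil_lt_add_one h).le.trans (le_of_eq ?_)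
  field_simp

theorem sqrt_nextStart_le {α : ℝ} (hα : 0 < α) (v : ℕ) :
    Real.sqrt (nextStart K α v) ≤ Real.sqrt v + K / α / 2 + 1 := by
  have ha : 0 ≤ (K : ℝ) / α := by positivity
  have hv := Real.sqrt_nonneg v
  refine Real.sqrt_le_iff.2 ⟨by positivity, (nextStart_le hα v).trans ?_⟩
  have := Real.sq_sqrt (Nat.cast_nonneg (α := ℝ) v)
  nlinarith

/-- Before rounding, the next start is the perfect square `(√v + K/(2α))²`. Thus the `K` rounds of a
session are paid for by the growth of the potential `2α√u`. -/
theorem le_sqrt_nextStart {α : ℝ} (hα : 0 < α) (v : ℕ) :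
    2 * α * Real.sqrt v + K ≤ 2 * α * Real.sqrt (nextStart K α v) := by
  have ha : 0 ≤ (K : ℝ) / α := by positivity
  have hv := Real.sqrt_nonneg v
  have h1 : Real.sqrt v + K / α / 2 ≤ Real.sqrt (nextStart K α v) := by
    refine Real.le_sqrt_of_sq_le (le_trans (le_of_eq ?_) (Nat.le_ceil _))
    have := Real.sq_sqrt (Nat.cast_nonneg (α := ℝ) v)
    rw [add_sq, this]
    field_simp
    ring
  calc 2 * α * Real.sqrt v + K = 2 * α * (Real.sqrt v + K / α / 2) := by field_simp
    _ ≤ _ := by gcongr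

/-- Two iterations are needed because a block may begin in the middle of a session, so that the
first complete one is the session after the next start. -/
theorem nextStart_nextStart_le {α : ℝ} (hα : 0 < α) (v : ℕ) :
    (nextStart K α (nextStart K α v) : ℝ) ≤
      v + (2 * (K / α) * Real.sqrt v + (K / α) ^ 2 + K / α + 2) := by
  have ha : 0 ≤ (K : ℝ) / α := by positivity
  have h1 := nextStart_le (K := K) hα (nextStart K α v)
  have h2 := nextStart_le (K := K) hα v
  have h3 := mul_le_mul_of_nonneg_left (sqrt_nextStart_le (K := K) hα v) ha
  nlinarith

theorem fresh_of_tau_eq (h : (run p x τ).τ = τ) :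
    ((run p x τ).n = fun _ => 0) ∧
      ((run p x τ).u = p.uReset ∨ (run p x τ).u = firstStart K p.α) := by
  cases τ with
  | zero => exact ⟨rfl, Or.inr rfl⟩
  | succ t =>
    by_cases ha : AlarmAt p x t
    · exact ⟨(run_succ_of_alarm ha).2.2, Or.inl (run_succ_of_alarm ha).2.1⟩
    · rw [run_succ_of_not_alarm ha] at h
      have := tau_le p x t
      simp only at h
      omega

theorem u_succ (h : ¬ AlarmAt p x s) :
    (run p x (s + 1)).u =
      if s + 1 - (run p x s).τ = (run p x s).u + K then nextStart K p.α (run p x s).u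
      else (run p x s).u := by
  rw [run_succ_of_not_alarm h]

/-- Since `u` is replaced in round `u + K` after the alarm, the stored session is never long past,
which bounds `u` from below. Its predecessor `v`, if there is one, has ended, which bounds `u` from
above. -/
theorem u_bounds (hK : 1 ≤ K) (hα : 0 < p.α) (h0 : (run p x τ).τ = τ) (hτs : τ ≤ s)
    (hs : (run p x s).τ = τ) :
    s - τ + 1 ≤ (run p x s).u + K ∧
      ((run p x s).u ≤ (run p x τ).u ∨
        ∃ v, (run p x s).u = nextStart K p.α v ∧ v + K ≤ s - τ) := by
  induction s, hτs using Nat.le_induction with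
  | base => exact ⟨by omega, Or.inl le_rfl⟩
  | succ s hτs ih =>
    have h1 := (tau_eq_of_between hτs (Nat.le_succ s) (hs.trans h0.symm)).trans h0
    obtain ⟨ih1, ih2⟩ := ih h1
    have hu := u_succ (not_alarm_of_tau_eq (hs.trans h1.symm))
    rw [h1] at hu
    split_ifs at hu with hc
    · have := lt_nextStart (K := K) hK hα (run p x s).u
      exact ⟨by omega, Or.inr ⟨_, hu, by omega⟩⟩
    · refine ⟨by omega, ?_⟩
      rcases ih2 with h | ⟨v, hv, hv'⟩
      · exact Or.inl (hu ▸ h)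
      · exact Or.inr ⟨v, hu.trans hv, by omega⟩

theorem u_eq_of_lt (hst : s ≤ t) (ht : (run p x t).τ = (run p x s).τ)
    (h : t - (run p x s).τ + 1 ≤ (run p x s).u + K) : (run p x t).u = (run p x s).u := by
  induction t, hst using Nat.le_induction with
  | base => rfl
  | succ t hst ih =>
    have h1 := tau_eq_of_between hst (Nat.le_succ t) ht
    have h2 := tau_le p x s
    have ih' := ih h1 (by omega)
    rw [u_succ (not_alarm_of_tau_eq (ht.trans h1.symm)), h1, ih', if_neg (by omega)]

/-- A session whose start is more than `K` rounds after the start of the previous one is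
complete. -/
theorem played_in_next_session (hK : 1 ≤ K) (hα : 0 < p.α) (h0 : (run p x τ).τ = τ) (hτs : τ ≤ s)
    (hs : (run p x s).τ = τ) (hu : p.α ^ 2 ≤ (run p x s).u) {e : ℕ}
    (he : τ + nextStart K p.α (run p x s).u + K ≤ e) (hte : (run p x e).τ = τ) (k : Fin K) :
    (run p x s).n k + 1 ≤ (run p x e).n k := by
  obtain ⟨hb, -⟩ := u_bounds hK hα h0 hτs hs
  set v := (run p x s).u with hv
  have hgap := add_lt_nextStart (K := K) hK hα hu
  have hk := k.2
  -- the round of the update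
  obtain ⟨q, hq⟩ : ∃ q, τ + v + K = q + 1 := ⟨τ + v + K - 1, by omega⟩
  have hsq : s ≤ q := by omega
  have htau : ∀ r, s ≤ r → r ≤ e → (run p x r).τ = τ := fun r h1 h2 =>
    (tau_eq_of_between h1 h2 (hte.trans hs.symm)).trans hs
  have hq1 := htau q hsq (by omega)
  have hq2 := htau (q + 1) (by omega) (by omega)
  have huq : (run p x q).u = v := u_eq_of_lt hsq (hq1.trans hs.symm) (by rw [hs]; omega)
  have huq' : (run p x (q + 1)).u = nextStart K p.α v := by
    rw [u_succ (not_alarm_of_tau_eq (hq2.trans hq1.symm)), hq1, huq, if_pos (by omega)]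
  -- the round in which `k` is explored
  obtain ⟨r, hr⟩ : ∃ r, τ + nextStart K p.α v + k = r + 1 :=
    ⟨τ + nextStart K p.α v + k - 1, by omega⟩
  have hr1 := htau r (by omega) (by omega)
  have hr2 := htau (r + 1) (by omega) (by omega)
  have hur : (run p x r).u = nextStart K p.α v := by
    rw [← huq']
    exact u_eq_of_lt (by omega) (hr1.trans hq2.symm) (by rw [hq2, huq']; omega)
  have harm : arm p x r = k := by
    rw [arm, action, dif_pos (by omega)]
    ext
    simp only
    omega
  have h1 := n_mono (p := p) (x := x) (s := s) (t := r) (by omega) (hr1.trans hs.symm) k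
  have h2 := n_lt_of_played (p := p) (x := x) (s := r) (t := e) (by omega) (hte.trans hr1.symm)
  rw [harm] at h2
  omega

/-- The length of a block of rounds that contains a complete session, as long as at most `R` rounds
have passed since the last alarm. -/
def blockLength (K : ℕ) (α R : ℝ) : ℕ :=
  ⌈2 * (K / α) * Real.sqrt R + (K / α) ^ 2 + K / α + 2 + K⌉₊

/-- Every block contains a complete session and hence a sample of each arm. The lower bounds on `s -
τ` exclude the initial phase, in which the first session may still be far away or sessions may
overlap. -/
theorem n_add_le_of_block (hK : 1 ≤ K) (hα : 0 < p.α) (h0 : (run p x τ).τ = τ) (hτs : τ ≤ s)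
    {R : ℝ} (hs1 : (run p x τ).u ≤ s - τ) (hs2 : p.α ^ 2 + K ≤ ((s - τ : ℕ) : ℝ)) (k : Fin K)
    (H : ℕ) (hR : ((s + H * blockLength K p.α R - τ : ℕ) : ℝ) ≤ R)
    (he : (run p x (s + H * blockLength K p.α R)).τ = τ) :
    (run p x s).n k + H ≤ (run p x (s + H * blockLength K p.α R)).n k := by
  induction H with
  | zero => simp
  | succ H ih =>
    set Λ := blockLength K p.α R with hΛ
    have hmul : (H + 1) * Λ = H * Λ + Λ := by ring
    rw [hmul] at he hR ⊢
    have hs' : (run p x (s + H * Λ)).τ = τ :=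
      (tau_eq_of_between (by omega) (by omega) (he.trans h0.symm)).trans h0
    have hR' : ((s + H * Λ - τ : ℕ) : ℝ) ≤ R := le_trans (by exact_mod_cast by omega) hR
    have ih' := ih hR' hs'
    set q := s + H * Λ with hq
    obtain ⟨hb1, hb2⟩ := u_bounds hK hα h0 (by omega : τ ≤ q) hs'
    have hu : p.α ^ 2 ≤ (run p x q).u := by
      have h1 : ((s - τ : ℕ) : ℝ) + 1 ≤ (run p x q).u + K := by
        exact_mod_cast (by omega : s - τ + 1 ≤ (run p x q).u + K)
      linarith
    -- The stored start is either the initial one, which is at most `s - τ`, or the successor of a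
    -- start that is already past.
    have hle : (run p x q).u ≤ nextStart K p.α (q - τ) := by
      rcases hb2 with h | ⟨v, hv, hv'⟩
      · have := lt_nextStart (K := K) hK hα (q - τ)
        omega
      · rw [hv]; exact nextStart_mono hα (by omega)
    have hlen : nextStart K p.α (run p x q).u + K ≤ (q - τ) + Λ := by
      have h1 := nextStart_nextStart_le (K := K) hα (q - τ)
      have h2 : (nextStart K p.α (run p x q).u : ℝ) ≤ nextStart K p.α (nextStart K p.α (q - τ)) := by
        exact_mod_cast nextStart_mono hα hle
      have h3 : 2 * (K / p.α) * Real.sqrt R + (K / p.α) ^ 2 + K / p.α + 2 + K ≤ (Λ : ℝ) :=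
        Nat.le_ceil _
      have h4 : 2 * (K / p.α) * Real.sqrt (q - τ : ℕ) ≤ 2 * (K / p.α) * Real.sqrt R := by
        gcongr
      have : ((nextStart K p.α (run p x q).u + K : ℕ) : ℝ) ≤ ((q - τ + Λ : ℕ) : ℝ) := by
        push_cast
        linarith
      exact_mod_cast this
    have := played_in_next_session hK hα h0 (by omega) hs' hu (e := s + (H * Λ + Λ)) (by omega) he k
    omega

/-- Round `s + 1` belongs to an exploration session. -/
abbrev Explores (p : Params K) (x : ℕ → Fin K → ℝ) (s : ℕ) : Prop :=
  (run p x s).u ≤ s + 1 - (run p x s).τ ∧ s + 1 - (run p x s).τ < (run p x s).u + K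

theorem sum_explores_le (hK : 1 ≤ K) (hα : 0 < p.α) (h0 : (run p x τ).τ = τ) (hτs : τ ≤ s)
    (hs : (run p x s).τ = τ) :
    ∑ i ∈ Finset.Ico τ s, (if Explores p x i then (1 : ℝ) else 0) ≤
      2 * p.α * Real.sqrt ((s - τ : ℕ) : ℝ) + K := by
  -- The induction carries a potential: `2α√u` accounts for all earlier sessions, and the minimum,
  -- with truncated subtraction, counts the rounds of the current session already played.
  suffices h : ∑ i ∈ Finset.Ico τ s, (if Explores p x i then (1 : ℝ) else 0) ≤
      2 * p.α * Real.sqrt (run p x s).u + (min K (s - τ + 1 - (run p x s).u) : ℕ) ∧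
      ∑ i ∈ Finset.Ico τ s, (if Explores p x i then (1 : ℝ) else 0) ≤
      2 * p.α * Real.sqrt ((s - τ : ℕ) : ℝ) + K from h.2
  induction s, hτs using Nat.le_induction with
  | base =>
    simp only [Finset.Ico_self, Finset.sum_empty]
    constructor <;> positivity
  | succ s hτs ih =>
    have h1 := (tau_eq_of_between hτs (Nat.le_succ s) (hs.trans h0.symm)).trans h0
    obtain ⟨ih1, ih2⟩ := ih h1
    have hu := u_succ (not_alarm_of_tau_eq (hs.trans h1.symm))
    rw [h1] at hu
    have hmono : 2 * p.α * Real.sqrt ((s - τ : ℕ) : ℝ) ≤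
        2 * p.α * Real.sqrt ((s + 1 - τ : ℕ) : ℝ) := by
      have : ((s - τ : ℕ) : ℝ) ≤ ((s + 1 - τ : ℕ) : ℝ) := by exact_mod_cast by omega
      gcongr
    rw [Finset.sum_Ico_succ_top hτs]
    by_cases hE : Explores p x s
    · rw [if_pos hE]
      obtain ⟨hE1, hE2⟩ := hE
      rw [h1] at hE1 hE2
      rw [if_neg (by omega)] at hu
      have e1 : min K (s - τ + 1 - (run p x s).u) = s - τ + 1 - (run p x s).u := by omega
      have e2 : min K (s + 1 - τ + 1 - (run p x s).u) = s - τ + 1 - (run p x s).u + 1 := by omega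
      rw [hu, e2]
      rw [e1] at ih1
      refine ⟨by push_cast; linarith, ?_⟩
      have h2 : ((s - τ + 1 - (run p x s).u : ℕ) : ℝ) + 1 ≤ K := by
        exact_mod_cast (by omega : s - τ + 1 - (run p x s).u + 1 ≤ K)
      have h3 : 2 * p.α * Real.sqrt (run p x s).u ≤ 2 * p.α * Real.sqrt ((s + 1 - τ : ℕ) : ℝ) := by
        have : ((run p x s).u : ℝ) ≤ ((s + 1 - τ : ℕ) : ℝ) := by exact_mod_cast by omega
        gcongr
      linarith
    · rw [if_neg hE, add_zero]
      refine ⟨?_, by linarith⟩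
      split_ifs at hu with hc
      · have h2 := le_sqrt_nextStart (K := K) hα (run p x s).u
        have h3 : ((min K (s - τ + 1 - (run p x s).u) : ℕ) : ℝ) ≤ K := by
          exact_mod_cast min_le_left _ _
        rw [hu]
        have h4 : (0 : ℝ) ≤ (min K (s + 1 - τ + 1 - nextStart K p.α (run p x s).u) : ℕ) :=
          Nat.cast_nonneg _
        linarith
      · rw [hu]
        refine ih1.trans ?_
        have : ((min K (s - τ + 1 - (run p x s).u) : ℕ) : ℝ) ≤
            (min K (s + 1 - τ + 1 - (run p x s).u) : ℕ) := by exact_mod_cast by omega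
        linarith

end Schedule

/-! ## The detector on windows with small noise -/

section Window

variable {K : ℕ} {p : Params K} {x : ℕ → Fin K → ℝ} {s t τ T : ℕ} {m : Fin K → ℕ → ℝ} {y : ℝ}

/-- The profile `-1` on `(j, j + H]`, `1` on `(j + H, j + 2H]` and `0` elsewhere. -/
def halves (H j l : ℕ) : ℝ :=
  if l ≤ j then 0 else if l ≤ j + H then -1 else if l ≤ j + 2 * H then 1 else 0

theorem halves_of_lt {H j l : ℕ} (h : j + 2 * H < l) : halves H j l = 0 := by
  unfold halves
  rw [if_neg (by omega), if_neg (by omega), if_neg (by omega)]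

theorem halves_of_le {H j l : ℕ} (h : l ≤ j) : halves H j l = 0 := if_pos h

theorem sum_halves_mul (H j : ℕ) (z : ℕ → ℝ) :
    ∑ l ∈ Finset.Icc 1 (j + 2 * H), halves H j l * z l =
      ∑ i ∈ Finset.Icc (H + 1) (2 * H), z (j + i) - ∑ i ∈ Finset.Icc 1 H, z (j + i) := by
  have h0 : Finset.Icc 1 (j + 2 * H) = Finset.Ioc 0 (j + 2 * H) := by ext; simp; omega
  have h1 : ∑ i ∈ Finset.Icc (H + 1) (2 * H), z (j + i) =
      ∑ l ∈ Finset.Ioc (j + H) (j + 2 * H), z l := by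
    refine Finset.sum_bij (fun i _ => j + i) (fun i hi => ?_) (fun a _ b _ h => by omega)
      (fun b hb => ⟨b - j, ?_, ?_⟩) (fun _ _ => rfl) <;>
      simp only [Finset.mem_Icc, Finset.mem_Ioc] at * <;> omega
  have h2 : ∑ i ∈ Finset.Icc 1 H, z (j + i) = ∑ l ∈ Finset.Ioc j (j + H), z l := by
    refine Finset.sum_bij (fun i _ => j + i) (fun i hi => ?_) (fun a _ b _ h => by omega)
      (fun b hb => ⟨b - j, ?_, ?_⟩) (fun _ _ => rfl) <;>
      simp only [Finset.mem_Icc, Finset.mem_Ioc] at * <;> omega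
  rw [h0, ← Finset.sum_Ioc_consecutive _ (Nat.zero_le j) (by omega : j ≤ j + 2 * H),
    ← Finset.sum_Ioc_consecutive _ (by omega : j ≤ j + H) (by omega : j + H ≤ j + 2 * H), h1, h2]
  have e1 : ∑ l ∈ Finset.Ioc 0 j, halves H j l * z l = 0 :=
    Finset.sum_eq_zero fun l hl => by rw [halves_of_le (Finset.mem_Ioc.1 hl).2, zero_mul]
  have e2 : ∑ l ∈ Finset.Ioc j (j + H), halves H j l * z l =
      - ∑ l ∈ Finset.Ioc j (j + H), z l := by
    rw [← Finset.sum_neg_distrib]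
    refine Finset.sum_congr rfl fun l hl => ?_
    have := Finset.mem_Ioc.1 hl
    rw [halves, if_neg (by omega), if_pos (by omega)]; ring
  have e3 : ∑ l ∈ Finset.Ioc (j + H) (j + 2 * H), halves H j l * z l =
      ∑ l ∈ Finset.Ioc (j + H) (j + 2 * H), z l := by
    refine Finset.sum_congr rfl fun l hl => ?_
    have := Finset.mem_Ioc.1 hl
    rw [halves, if_neg (by omega), if_neg (by omega), if_pos (by omega), one_mul]
  rw [e1, e2, e3]; ring

theorem sum_halves (H j : ℕ) : ∑ l ∈ Finset.Icc 1 (j + 2 * H), halves H j l = 0 := by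
  have := sum_halves_mul H j fun _ => 1
  simp only [mul_one] at this
  rw [this]
  simp
  have : 2 * H - H = H := by omega
  rw [this]; ring

theorem sum_halves_sq_le (H j : ℕ) (S : Finset ℕ) : ∑ l ∈ S, halves H j l ^ 2 ≤ (2 * H : ℕ) := by
  classical
  calc ∑ l ∈ S, halves H j l ^ 2 ≤ ∑ l ∈ S, if l ∈ Finset.Ioc j (j + 2 * H) then (1 : ℝ) else 0 := by
        refine Finset.sum_le_sum fun l _ => ?_
        simp only [Finset.mem_Ioc]
        unfold halves
        split_ifs <;> first | omega | norm_num
    _ = ((S ∩ Finset.Ioc j (j + 2 * H)).card : ℝ) := by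
        rw [Finset.sum_ite_mem]; simp
    _ ≤ (2 * H : ℕ) := by
        have := Finset.card_le_card (Finset.inter_subset_right (s₁ := S) (s₂ := Finset.Ioc j (j + 2 * H)))
        rw [Nat.card_Ioc] at this
        exact_mod_cast (by omega)

/-- The deviation of the reward of round `s + 1` from its mean. -/
def noise (p : Params K) (x : ℕ → Fin K → ℝ) (m : Fin K → ℕ → ℝ) (s : ℕ) : ℝ :=
  x (s + 1) (arm p x s) - m (arm p x s) (s + 1)

theorem weight_mul_reward (τ : ℕ) (k : Fin K) (h : ℕ → ℝ) (s : ℕ) :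
    weight p x τ k h s * x (s + 1) k =
      weight p x τ k h s * noise p x m s + weight p x τ k h s * m k (s + 1) := by
  unfold weight noise
  split_ifs with hs
  · rw [hs.2]; ring
  · simp

/-- The weights of the window of the arm of round `t₀ + 1` that starts with this round. -/
def windowWeight (p : Params K) (x : ℕ → Fin K → ℝ) (t₀ s : ℕ) : ℝ :=
  if t₀ ≤ s then weight p x (run p x t₀).τ (arm p x t₀)
    (halves (p.w / 2) ((run p x t₀).n (arm p x t₀))) s else 0

/-- The noise of all windows is at most `y`. -/
def QuietWindows (p : Params K) (x : ℕ → Fin K → ℝ) (m : Fin K → ℕ → ℝ) (T : ℕ) (y : ℝ) : Prop :=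
  ∀ t₀ < T, |∑ s ∈ Finset.range T, windowWeight p x t₀ s * noise p x m s| ≤ y

/-- The detector sees a window at its last round, whereas predictability requires it to be fixed at
its first. The two descriptions are matched by locating the round of the sample with index `j + 1`.
-/
theorem QuietWindows.abs_sum_le (hq : QuietWindows p x m T y) (ht : t < T) {H : ℕ}
    (hw : p.w = 2 * H) (hH : 0 < H) {j : ℕ} (hj : j + 2 * H = (run p x t).n (arm p x t) + 1) :
    |∑ s ∈ Finset.range (t + 1),
      weight p x (run p x t).τ (arm p x t) (halves H j) s * noise p x m s| ≤ y := by
  set τ := (run p x t).τ with hτ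
  set a := arm p x t with ha
  have hw2 : p.w / 2 = H := by omega
  -- the round of the first sample in the window
  obtain ⟨t₀, ht₀, h0τ, h0a, h0n⟩ : ∃ t₀ ≤ t, (run p x t₀).τ = τ ∧ arm p x t₀ = a ∧
      (run p x t₀).n a = j := by
    -- The profile that singles out index `j + 1` has total weight 1, so some round must carry this
    -- sample.
    have h1 := sum_weight_succ (p := p) (x := x) (fun l => if l = j + 1 then 1 else 0) t
    rw [← ha, ← hj, Finset.sum_ite_eq', if_pos (by simp only [Finset.mem_Icc]; omega)] at h1
    obtain ⟨s, hs, hne⟩ := Finset.exists_ne_zero_of_sum_ne_zero (h1.symm ▸ one_ne_zero)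
    by_cases hc : (run p x s).τ = (run p x t).τ ∧ arm p x s = a
    · rw [weight, if_pos hc] at hne
      have hc' : (run p x s).n a + 1 = j + 1 := by
        by_contra h
        exact hne (if_neg h)
      exact ⟨s, by simpa [Nat.lt_succ_iff] using hs, hc.1, hc.2, by omega⟩
    · exact absurd (if_neg hc) hne
  have h3 := hq t₀ (by omega)
  -- Relevant rounds before `t₀` have sample index at most `j`, those after `t` have index above `j
  -- + 2H`; the profile vanishes in both ranges.
  have h4 : ∑ s ∈ Finset.range T, windowWeight p x t₀ s * noise p x m s =
      ∑ s ∈ Finset.range (t + 1), weight p x τ a (halves H j) s * noise p x m s := by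
    rw [← Finset.sum_subset (Finset.range_mono (by omega : t + 1 ≤ T))]
    · refine Finset.sum_congr rfl fun s _ => ?_
      congr 1
      unfold windowWeight
      rw [h0τ, h0a, h0n, hw2]
      split_ifs with hs
      · rfl
      · unfold weight
        split_ifs with hc
        · have h5 := n_lt_of_played (p := p) (x := x) (s := s) (t := t₀) (by omega)
            (h0τ.trans hc.1.symm)
          rw [hc.2, h0n] at h5
          rw [halves_of_le (by omega)]
        · rfl
    · intro s _ hs
      have hs' : t + 1 ≤ s := by simpa using hs
      have : windowWeight p x t₀ s = 0 := by
        unfold windowWeight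
        rw [h0τ, h0a, h0n, hw2, if_pos (by omega)]
        unfold weight
        split_ifs with hc
        · have h5 := n_lt_of_played (p := p) (x := x) (s := t) (t := s) (by omega)
            (hc.1.trans hτ)
          rw [← ha] at h5
          exact halves_of_lt (by omega)
        · rfl
      rw [this, zero_mul]
  rwa [h4] at h3

/-- This splits the detector statistic into noise, to be bounded by `y`, and a drift given by the
means. -/
theorem alarmAt_iff {H : ℕ} (hw : p.w = 2 * H) {j : ℕ}
    (hj : j + 2 * H = (run p x t).n (arm p x t) + 1) :
    AlarmAt p x t ↔
      p.b < |∑ s ∈ Finset.range (t + 1),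
          weight p x (run p x t).τ (arm p x t) (halves H j) s * noise p x m s +
        ∑ s ∈ Finset.range (t + 1),
          weight p x (run p x t).τ (arm p x t) (halves H j) s * m (arm p x t) (s + 1)| := by
  rw [← Finset.sum_add_distrib, ← Finset.sum_congr rfl fun s _ => weight_mul_reward _ _ _ s,
    sum_weight_mul_succ, ← hj, sum_halves_mul]
  have h1 : (run p x t).n (action p (run p x t) (t + 1)) + 1 - p.w = j := by
    have : (run p x t).n (arm p x t) + 1 - p.w = j := by omega
    exact this
  have h2 : p.w ≤ (run p x t).n (action p (run p x t) (t + 1)) + 1 := by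
    have : p.w ≤ (run p x t).n (arm p x t) + 1 := by omega
    exact this
  have h3 : p.w / 2 = H := by omega
  unfold AlarmAt Alarm
  rw [and_iff_right h2, h1, CD, h3, hw]

/-- With a constant mean the drift cancels between the two halves, and the noise alone does not
exceed the threshold. -/
theorem QuietWindows.not_alarm (hq : QuietWindows p x m T y) (ht : t < T) {H : ℕ}
    (hw : p.w = 2 * H) (hH : 0 < H) (hyb : y ≤ p.b)
    (hm : ∀ s, (run p x t).τ ≤ s → s ≤ t → m (arm p x t) (s + 1) = m (arm p x t) (t + 1)) :
    ¬ AlarmAt p x t := by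
  by_cases hn : p.w ≤ (run p x t).n (arm p x t) + 1
  · obtain ⟨j, hj⟩ : ∃ j, j + 2 * H = (run p x t).n (arm p x t) + 1 :=
      ⟨(run p x t).n (arm p x t) + 1 - 2 * H, by omega⟩
    rw [alarmAt_iff (m := m) hw hj, not_lt]
    have h0 : ∑ s ∈ Finset.range (t + 1), weight p x (run p x t).τ (arm p x t)
        (halves H j) s * m (arm p x t) (s + 1) = 0 := by
      have : ∀ s ∈ Finset.range (t + 1), weight p x (run p x t).τ (arm p x t)
          (halves H j) s * m (arm p x t) (s + 1) =
          weight p x (run p x t).τ (arm p x t)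
          (halves H j) s * m (arm p x t) (t + 1) := by
        intro s hs
        by_cases hc : (run p x s).τ = (run p x t).τ
        · rw [hm s (hc ▸ tau_le p x s) (by simpa [Nat.lt_succ_iff] using hs)]
        · have : weight p x (run p x t).τ (arm p x t)
              (halves H j) s = 0 :=
            if_neg fun h => hc h.1
          rw [this, zero_mul, zero_mul]
      rw [Finset.sum_congr rfl this, ← Finset.sum_mul, sum_weight_succ, ← hj, sum_halves, zero_mul]
    rw [h0, add_zero]
    exact (hq.abs_sum_le ht hw hH hj).trans hyb
  · exact fun h => hn h.1

/-- An alarm is raised at the latest when the second half of the window has been filled after a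
change. -/
theorem QuietWindows.alarm (hq : QuietWindows p x m T y) (ht : t < T) {H : ℕ}
    (hw : p.w = 2 * H) (hH : 0 < H) {ν : ℕ}
    (hτ : (run p x t).τ = (run p x ν).τ) {m₁ m₂ : ℝ}
    (hm₁ : ∀ s, (run p x t).τ ≤ s → s < ν → m (arm p x t) (s + 1) = m₁)
    (hm₂ : ∀ s, ν ≤ s → s ≤ t → m (arm p x t) (s + 1) = m₂)
    (hn₁ : H ≤ (run p x ν).n (arm p x t))
    (hn₂ : (run p x t).n (arm p x t) + 1 = (run p x ν).n (arm p x t) + H)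
    (hgap : p.b + y < H * |m₂ - m₁|) : AlarmAt p x t := by
  have hj : ((run p x ν).n (arm p x t) - H) + 2 * H = (run p x t).n (arm p x t) + 1 := by omega
  rw [alarmAt_iff (m := m) hw hj]
  have h0 : ∑ s ∈ Finset.range (t + 1), weight p x (run p x t).τ (arm p x t)
      (halves H ((run p x ν).n (arm p x t) - H)) s * m (arm p x t) (s + 1) = H * (m₂ - m₁) := by
    -- A mean depending on the round becomes one depending on the sample index: exactly the first `n
    -- k` samples, counted at `ν`, precede the change. The window is placed so that its two halves
    -- meet there.
    set z : ℕ → ℝ := fun l => if l ≤ (run p x ν).n (arm p x t) then m₁ else m₂ with hz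
    have : ∀ s ∈ Finset.range (t + 1), weight p x (run p x t).τ (arm p x t)
        (halves H ((run p x ν).n (arm p x t) - H)) s * m (arm p x t) (s + 1) =
        weight p x (run p x t).τ (arm p x t)
        (fun l => halves H ((run p x ν).n (arm p x t) - H) l * z l) s := by
      intro s hs
      unfold weight
      split_ifs with hc
      · congr 1
        rcases lt_or_ge s ν with h | h
        · rw [hm₁ s (hc.1 ▸ tau_le p x s) h, hz]
          have h5 := n_lt_of_played (p := p) (x := x) h (hτ.symm.trans hc.1.symm)
          rw [hc.2] at h5
          simp only
          rw [if_pos (by omega)]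
        · rw [hm₂ s h (by simpa [Nat.lt_succ_iff] using hs), hz]
          have h5 := n_mono (p := p) (x := x) h (hc.1.trans hτ) (arm p x t)
          simp only
          rw [if_neg (by omega)]
      · rw [zero_mul]
    rw [Finset.sum_congr rfl this, sum_weight_succ, ← hj, sum_halves_mul]
    have e1 : ∑ i ∈ Finset.Icc (H + 1) (2 * H), z ((run p x ν).n (arm p x t) - H + i) =
        ∑ i ∈ Finset.Icc (H + 1) (2 * H), m₂ := by
      refine Finset.sum_congr rfl fun i hi => ?_
      have := Finset.mem_Icc.1 hi
      simp only [hz]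
      rw [if_neg (by omega)]
    have e2 : ∑ i ∈ Finset.Icc 1 H, z ((run p x ν).n (arm p x t) - H + i) =
        ∑ i ∈ Finset.Icc 1 H, m₁ := by
      refine Finset.sum_congr rfl fun i hi => ?_
      have := Finset.mem_Icc.1 hi
      simp only [hz]
      rw [if_pos (by omega)]
    rw [e1, e2, Finset.sum_const, Finset.sum_const, Nat.card_Icc, Nat.card_Icc]
    have : 2 * H + 1 - (H + 1) = H := by omega
    rw [this]
    simp; ring
  rw [h0]
  have h1 := hq.abs_sum_le ht hw hH hj
  set N := ∑ s ∈ Finset.range (t + 1), weight p x (run p x t).τ (arm p x t)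
      (halves H ((run p x ν).n (arm p x t) - H)) s * noise p x m s
  have h2 : |(H : ℝ) * (m₂ - m₁)| = H * |m₂ - m₁| := by rw [abs_mul, Nat.abs_cast]
  have h3 := abs_sub_abs_le_abs_add ((H : ℝ) * (m₂ - m₁)) N
  rw [h2, add_comm] at h3
  linarith

/-- If an arm with a gap at `ν` has half a window of samples before `ν` and would get half a window
of samples in `(ν, e]`, then there is an alarm in `(ν, e]`. -/
theorem QuietWindows.exists_alarm (hq : QuietWindows p x m T y) {ν e : ℕ} (hνe : ν ≤ e) (he : e ≤ T)
    {H : ℕ} (hw : p.w = 2 * H) (hH : 0 < H) {k : Fin K} {m₁ m₂ : ℝ}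
    (hm₁ : ∀ s, (run p x ν).τ ≤ s → s < ν → m k (s + 1) = m₁)
    (hm₂ : ∀ s, ν ≤ s → s < e → m k (s + 1) = m₂)
    (hn₁ : H ≤ (run p x ν).n k)
    (hn₂ : (run p x e).τ = (run p x ν).τ → (run p x ν).n k + H ≤ (run p x e).n k)
    (hgap : p.b + y < H * |m₂ - m₁|) : (run p x e).τ ≠ (run p x ν).τ := by
  intro hτ
  have hn := hn₂ hτ
  classical
  -- At the first time at which `k` has `H` new samples, the preceding round must have played `k`,
  -- and that round fills the second half of the window.
  have hex : ∃ r, ν ≤ r ∧ (run p x ν).n k + H ≤ (run p x r).n k := ⟨e, hνe, hn⟩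
  have hle : Nat.find hex ≤ e := Nat.find_min' hex ⟨hνe, hn⟩
  obtain ⟨h1, h2⟩ := Nat.find_spec hex
  obtain ⟨t, ht⟩ : ∃ t, Nat.find hex = t + 1 := by
    refine Nat.exists_eq_succ_of_ne_zero fun h => ?_
    rw [h] at h1 h2
    have : ν = 0 := by omega
    rw [this] at h2
    omega
  rw [ht] at h1 h2 hle
  have hνt : ν ≤ t := by
    rcases Nat.lt_or_ge t ν with h | h
    · have : ν = t + 1 := by omega
      rw [← this] at h2; omega
    · exact h
  have hlt : (run p x t).n k < (run p x ν).n k + H := by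
    have := Nat.find_min hex (m := t) (by omega)
    push Not at this
    exact this hνt
  have hτ1 := tau_eq_of_between h1 hle hτ
  have hτ0 := tau_eq_of_between hνt (by omega) hτ
  have hna := not_alarm_of_tau_eq (hτ1.trans hτ0.symm)
  have hs := n_succ hna k
  have harm : arm p x t = k := by
    by_contra h
    rw [if_neg h] at hs; omega
  rw [if_pos harm] at hs
  subst harm
  exact hna (hq.alarm (by omega) hw hH hτ0 (fun s h => hm₁ s (hτ0 ▸ h))
    (fun s h h' => hm₂ s h (by omega)) hn₁ (by omega) hgap)

end Window

/-! ## Regret between two alarms in a stationary environment -/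

section Segment

variable {K : ℕ} {p : Params K} {x : ℕ → Fin K → ℝ} {s t τ T : ℕ} {m : Fin K → ℕ → ℝ}

/-- The profile `1` on `[1, n]`. -/
def upto (n l : ℕ) : ℝ := if l ≤ n then 1 else 0

/-- The noise of the first `n` samples of arm `k` after an alarm in round `τ`. -/
def sampleNoise (p : Params K) (x : ℕ → Fin K → ℝ) (m : Fin K → ℕ → ℝ) (T τ : ℕ) (k : Fin K)
    (n : ℕ) : ℝ :=
  ∑ s ∈ Finset.range T, weight p x τ k (upto n) s * noise p x m s

/-- The noise of all sample means is at the scale given by `c`. -/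
def QuietSamples (p : Params K) (x : ℕ → Fin K → ℝ) (m : Fin K → ℕ → ℝ) (T : ℕ) (c : ℝ) : Prop :=
  ∀ τ < T, ∀ k, ∀ n ≤ T, |sampleNoise p x m T τ k n| ≤ Real.sqrt (2 * n * c)

/-- The index of the arm `k` may underestimate its mean `r` rounds after an alarm in round `τ`. -/
def Underestimates (p : Params K) (x : ℕ → Fin K → ℝ) (m : Fin K → ℕ → ℝ) (T τ : ℕ) (k : Fin K)
    (r : ℕ) : Prop :=
  ∃ n ∈ Finset.Icc 1 r, sampleNoise p x m T τ k n ≤ -Real.sqrt (2 * n * Real.log r)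

theorem sum_upto (n : ℕ) : ∑ l ∈ Finset.Icc 1 n, upto n l = n := by
  have : ∀ l ∈ Finset.Icc 1 n, upto n l = 1 := fun l hl => if_pos (Finset.mem_Icc.1 hl).2
  rw [Finset.sum_congr rfl this]; simp

theorem sum_upto_sq_le (n : ℕ) (S : Finset ℕ) (hS : ∀ l ∈ S, 1 ≤ l) :
    ∑ l ∈ S, upto n l ^ 2 ≤ n := by
  classical
  calc ∑ l ∈ S, upto n l ^ 2 ≤ ∑ l ∈ S, if l ∈ Finset.Icc 1 n then (1 : ℝ) else 0 := by
        refine Finset.sum_le_sum fun l hl => ?_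
        have := hS l hl
        simp only [Finset.mem_Icc]
        unfold upto
        split_ifs <;> first | omega | norm_num
    _ = ((S ∩ Finset.Icc 1 n).card : ℝ) := by
        rw [Finset.sum_ite_mem]; simp
    _ ≤ n := by
        have := Finset.card_le_card (Finset.inter_subset_right (s₁ := S) (s₂ := Finset.Icc 1 n))
        rw [Nat.card_Icc] at this
        exact_mod_cast (by omega)

theorem sum_n_eq (h0 : (run p x τ).τ = τ) (hτs : τ ≤ s) (hs : (run p x s).τ = τ) :
    ∑ k, (run p x s).n k = s - τ := by
  induction s, hτs using Nat.le_induction with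
  | base => rw [(fresh_of_tau_eq h0).1]; simp
  | succ s hτs ih =>
    have h1 := (tau_eq_of_between hτs (Nat.le_succ s) (hs.trans h0.symm)).trans h0
    rw [Finset.sum_congr rfl fun k _ => n_succ (not_alarm_of_tau_eq (hs.trans h1.symm)) k,
      Finset.sum_add_distrib, ih h1]
    simp
    omega

theorem sum_samples_eq (hs : (run p x s).τ = τ) (hsT : s ≤ T) {k : Fin K} {μ : ℝ}
    (hμ : ∀ i, τ ≤ i → i < s → m k (i + 1) = μ) :
    ∑ l ∈ Finset.Icc 1 ((run p x s).n k), (run p x s).Z k l =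
      sampleNoise p x m T τ k ((run p x s).n k) + (run p x s).n k * μ := by
  set n := (run p x s).n k with hn
  have h1 := sum_weight_mul (p := p) (x := x) (upto n) k s
  have h2 := sum_weight (p := p) (x := x) (upto n) k s
  rw [hs, ← hn] at h1 h2
  rw [sum_upto] at h2
  have h3 : ∑ l ∈ Finset.Icc 1 n, upto n l * (run p x s).Z k l =
      ∑ l ∈ Finset.Icc 1 n, (run p x s).Z k l :=
    Finset.sum_congr rfl fun l hl => by rw [upto, if_pos (Finset.mem_Icc.1 hl).2, one_mul]
  rw [← h3, ← h1, Finset.sum_congr rfl fun i _ => weight_mul_reward (m := m) _ _ _ i,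
    Finset.sum_add_distrib]
  congr 1
  · refine Finset.sum_subset (Finset.range_mono hsT) fun i _ hi => ?_
    rw [weight_eq_zero_of_le hs hn.le (fun l hl => show upto n l = 0 from if_neg (by omega))
      (by simpa using hi), zero_mul]
  · rw [← h2, Finset.sum_mul]
    refine Finset.sum_congr rfl fun i hi => ?_
    by_cases hc : (run p x i).τ = τ
    · rw [hμ i (hc ▸ tau_le p x i) (Finset.mem_range.1 hi)]
    · have : weight p x τ k (upto n) i = 0 := if_neg fun h => hc h.1
      rw [this, zero_mul, zero_mul]

theorem ucb_le_of_not_explores (hK : 1 ≤ K) (hsel : ∀ S : Finset (Fin K), S.Nonempty → p.sel S ∈ S)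
    (h : ¬ Explores p x s) (j : Fin K) :
    ucb (run p x s) (s + 1) j ≤ ucb (run p x s) (s + 1) (arm p x s) := by
  classical
  have hne : (ucbMaximizers (run p x s) (s + 1)).Nonempty := by
    have : Nonempty (Fin K) := ⟨⟨0, hK⟩⟩
    obtain ⟨k, hk⟩ := Finite.exists_max (ucb (run p x s) (s + 1))
    exact ⟨k, by simp only [ucbMaximizers, Finset.mem_filter]; exact ⟨Finset.mem_univ _, hk⟩⟩
  have harm : arm p x s = p.sel (ucbMaximizers (run p x s) (s + 1)) := dif_neg h
  have := hsel _ hne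
  rw [← harm] at this
  simp only [ucbMaximizers, Finset.mem_filter] at this
  exact this.2 j

/-- The factor 3 comes from `√(n+1) + √n ≤ 3√n`. The bound makes the confidence widths telescope as
samples accumulate. -/
theorem inv_sqrt_le_sub (n : ℕ) (hn : 1 ≤ n) :
    1 / Real.sqrt n ≤ 3 * (Real.sqrt ((n + 1 : ℕ) : ℝ) - Real.sqrt n) := by
  have hn' : (1 : ℝ) ≤ n := by exact_mod_cast hn
  have h0 : 0 < Real.sqrt n := Real.sqrt_pos.2 (by linarith)
  have h1 : Real.sqrt ((n + 1 : ℕ) : ℝ) ≤ 2 * Real.sqrt n := by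
    refine Real.sqrt_le_iff.2 ⟨by positivity, ?_⟩
    rw [mul_pow, Real.sq_sqrt (by linarith)]
    push_cast; linarith
  have h2 := Real.sq_sqrt (by positivity : (0 : ℝ) ≤ ((n + 1 : ℕ) : ℝ))
  have h3 := Real.sq_sqrt (by positivity : (0 : ℝ) ≤ (n : ℝ))
  have h4 : Real.sqrt n ≤ Real.sqrt ((n + 1 : ℕ) : ℝ) := Real.sqrt_le_sqrt (by push_cast; linarith)
  rw [div_le_iff₀ h0]
  push_cast at h1 h2 h4 ⊢
  nlinarith

/-- The regret of a round without exploration in which the best arm is not underestimated. -/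
theorem gap_le_of_ucb (hK : 1 ≤ K) (hsel : ∀ S : Finset (Fin K), S.Nonempty → p.sel S ∈ S)
    (h0 : (run p x τ).τ = τ) (hτs : τ ≤ s) (hs : (run p x s).τ = τ) (hsT : s < T)
    {c : ℝ} (hc : 0 ≤ c) (hq : QuietSamples p x m T c) (hE : ¬ Explores p x s) {k : Fin K}
    {μ : Fin K → ℝ} (hμ : ∀ k i, τ ≤ i → i ≤ s → m k (i + 1) = μ k)
    (hU : ¬ Underestimates p x m T τ k (s + 1 - τ)) (hn : 1 ≤ (run p x s).n (arm p x s)) :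
    μ k - μ (arm p x s) ≤ (Real.sqrt (2 * c) + Real.sqrt (2 * Real.log T)) /
      Real.sqrt ((run p x s).n (arm p x s)) := by
  have hucb := ucb_le_of_not_explores (x := x) (s := s) hK hsel hE k
  have hsum := sum_n_eq h0 hτs hs
  have hnle : ∀ j, (run p x s).n j ≤ s - τ := fun j =>
    hsum ▸ Finset.single_le_sum (fun _ _ => Nat.zero_le _) (Finset.mem_univ j)
  set a := arm p x s with ha
  have hna : (run p x s).n a ≠ 0 := by omega
  have hZ : ∀ j, ∑ l ∈ Finset.Icc 1 ((run p x s).n j), (run p x s).Z j l =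
      sampleNoise p x m T τ j ((run p x s).n j) + (run p x s).n j * μ j := fun j =>
    sum_samples_eq hs hsT.le fun i h1 h2 => hμ j i h1 h2.le
  have hr : (((s + 1 : ℕ) : ℝ) - (run p x s).τ) = ((s + 1 - τ : ℕ) : ℝ) := by
    rw [hs, Nat.cast_sub (by omega)]
  rcases Nat.eq_zero_or_pos ((run p x s).n k) with hk0 | hk0
  -- If `k` had no samples, its infinite index would beat the finite index of the arm played.
  · rw [ucb, if_pos hk0, ucb, if_neg hna] at hucb
    exact absurd (top_le_iff.1 hucb) (EReal.coe_ne_top _)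
  · rw [ucb, if_neg hk0.ne', ucb, if_neg hna, EReal.coe_le_coe_iff, hZ, hZ, hr] at hucb
    have hr1 : (1 : ℝ) ≤ ((s + 1 - τ : ℕ) : ℝ) := by exact_mod_cast (by omega : 1 ≤ s + 1 - τ)
    have hL0 : 0 ≤ Real.log ((s + 1 - τ : ℕ) : ℝ) := Real.log_nonneg hr1
    have hLT : Real.log ((s + 1 - τ : ℕ) : ℝ) ≤ Real.log T :=
      Real.log_le_log (by linarith) (by exact_mod_cast (by omega : s + 1 - τ ≤ T))
    have hk : (0 : ℝ) < (run p x s).n k := by exact_mod_cast hk0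
    have ha0 : (0 : ℝ) < (run p x s).n a := by exact_mod_cast hn
    -- the index of `k` is at least its mean
    have hlow : μ k ≤ 1 / ((run p x s).n k : ℝ) *
        (sampleNoise p x m T τ k ((run p x s).n k) + (run p x s).n k * μ k) +
        Real.sqrt (2 * Real.log ((s + 1 - τ : ℕ) : ℝ) / (run p x s).n k) := by
      have h1 : ¬ sampleNoise p x m T τ k ((run p x s).n k) ≤
          -Real.sqrt (2 * (run p x s).n k * Real.log ((s + 1 - τ : ℕ) : ℝ)) := fun h =>
        hU ⟨_, Finset.mem_Icc.2 ⟨hk0, by have := hnle k; omega⟩, h⟩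
      have h2 : Real.sqrt (2 * (run p x s).n k * Real.log ((s + 1 - τ : ℕ) : ℝ)) =
          (run p x s).n k * Real.sqrt (2 * Real.log ((s + 1 - τ : ℕ) : ℝ) / (run p x s).n k) := by
        rw [← Real.sqrt_sq hk.le, ← Real.sqrt_mul (sq_nonneg _), Real.sqrt_sq hk.le]
        congr 1
        field_simp
      rw [h2] at h1
      set q := Real.sqrt (2 * Real.log ((s + 1 - τ : ℕ) : ℝ) / (run p x s).n k)
      have h3 : 1 / ((run p x s).n k : ℝ) *
          (sampleNoise p x m T τ k ((run p x s).n k) + (run p x s).n k * μ k) =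
          sampleNoise p x m T τ k ((run p x s).n k) / (run p x s).n k + μ k := by
        field_simp
      have h4 : -q ≤ sampleNoise p x m T τ k ((run p x s).n k) / (run p x s).n k := by
        rw [le_div_iff₀ hk]
        push Not at h1
        linarith
      rw [h3]; linarith
    have hup : 1 / ((run p x s).n a : ℝ) *
        (sampleNoise p x m T τ a ((run p x s).n a) + (run p x s).n a * μ a) ≤
        Real.sqrt (2 * c) / Real.sqrt ((run p x s).n a) + μ a := by
      have h1 := (abs_le.1 (hq τ (by omega) a _ ((hnle a).trans (by omega)))).2
      have h2 : Real.sqrt (2 * (run p x s).n a * c) / (run p x s).n a =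
          Real.sqrt (2 * c) / Real.sqrt ((run p x s).n a) := by
        rw [show 2 * ((run p x s).n a : ℝ) * c = 2 * c * (run p x s).n a by ring,
          Real.sqrt_mul (by positivity), mul_div_assoc, Real.sqrt_div_self, div_eq_mul_inv]
      have h3 : 1 / ((run p x s).n a : ℝ) *
          (sampleNoise p x m T τ a ((run p x s).n a) + (run p x s).n a * μ a) =
          sampleNoise p x m T τ a ((run p x s).n a) / (run p x s).n a + μ a := by
        field_simp
      rw [h3, ← h2]
      gcongr
    have hbon : Real.sqrt (2 * Real.log ((s + 1 - τ : ℕ) : ℝ) / (run p x s).n a) ≤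
        Real.sqrt (2 * Real.log T) / Real.sqrt ((run p x s).n a) := by
      rw [← Real.sqrt_div' _ ha0.le]
      gcongr
    rw [add_div]
    linarith

/-- Regret of the rounds `τ + 1, …, e` if there is neither an alarm nor a change in them. -/
theorem sum_gap_le (hK : 1 ≤ K) (hsel : ∀ S : Finset (Fin K), S.Nonempty → p.sel S ∈ S)
    (hα : 0 < p.α) (hT : 2 ≤ T)
    (h0 : (run p x τ).τ = τ) {e : ℕ} (hτe : τ ≤ e) (he : (run p x e).τ = τ) (heT : e ≤ T)
    {c : ℝ} (hc : 0 ≤ c) (hq : QuietSamples p x m T c)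
    {best : ℕ → Fin K} {μ : Fin K → ℝ} (hμ : ∀ k i, τ ≤ i → i < e → m k (i + 1) = μ k)
    (hμ01 : ∀ k j, μ k - μ j ≤ 1) (r₀ : ℕ) :
    ∑ s ∈ Finset.Ico τ e, (m (best (s + 1)) (s + 1) - m (arm p x s) (s + 1)) ≤
      2 * p.α * Real.sqrt ((e - τ : ℕ) : ℝ) + Real.sqrt (K * (e - τ : ℕ)) + r₀ +
        3 * (Real.sqrt (2 * c) + Real.sqrt (2 * Real.log T)) * Real.sqrt (K * (e - τ : ℕ)) +
        ∑ r ∈ Finset.Ioc r₀ T, Set.indicator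
          {r | Underestimates p x m T τ (best (τ + r)) r} (fun _ => (1 : ℝ)) r := by
  classical
  set b := Real.sqrt (2 * c) + Real.sqrt (2 * Real.log T) with hb
  have hb1 : 1 ≤ b := by
    have h1 : Real.log 2 ≤ Real.log T := Real.log_le_log (by norm_num) (by exact_mod_cast hT)
    have h2 := Real.log_two_gt_d9
    have h3 : (1 : ℝ) ≤ Real.sqrt (2 * Real.log T) := Real.le_sqrt_of_sq_le (by linarith)
    have := Real.sqrt_nonneg (2 * c)
    linarith
  set I : ℕ → ℝ := Set.indicator {r | Underestimates p x m T τ (best (τ + r)) r} (fun _ => (1 : ℝ))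
    with hI
  have hI0 : ∀ r, 0 ≤ I r := fun r => Set.indicator_nonneg (fun _ _ => zero_le_one) r
  -- one round
  have hround : ∀ s, τ ≤ s → s < e → m (best (s + 1)) (s + 1) - m (arm p x s) (s + 1) ≤
      (if Explores p x s then (1 : ℝ) else 0) + (if s + 1 - τ ≤ r₀ then 1 else I (s + 1 - τ)) +
        3 * b * (Real.sqrt ((run p x s).n (arm p x s) + 1 : ℕ) -
          Real.sqrt ((run p x s).n (arm p x s))) := by
    intro s hs hse
    have hτs := (tau_eq_of_between hs hse.le (he.trans h0.symm)).trans h0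
    rw [hμ _ s hs hse, hμ _ s hs hse]
    have h1 := hμ01 (best (s + 1)) (arm p x s)
    have hinc : 0 ≤ 3 * b * (Real.sqrt ((run p x s).n (arm p x s) + 1 : ℕ) -
          Real.sqrt ((run p x s).n (arm p x s))) := by
      have : Real.sqrt ((run p x s).n (arm p x s)) ≤
          Real.sqrt ((run p x s).n (arm p x s) + 1 : ℕ) := by
        apply Real.sqrt_le_sqrt; push_cast; linarith
      have : 0 ≤ b := by linarith
      have : 0 ≤ 3 * b := by linarith
      apply mul_nonneg this
      linarith
    have hsec : 0 ≤ (if s + 1 - τ ≤ r₀ then 1 else I (s + 1 - τ)) := by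
      split_ifs
      · exact zero_le_one
      · exact hI0 _
    by_cases hE : Explores p x s
    · rw [if_pos hE]; linarith
    rw [if_neg hE]
    by_cases hr : s + 1 - τ ≤ r₀
    · rw [if_pos hr]; linarith
    rw [if_neg hr]
    by_cases hU : Underestimates p x m T τ (best (s + 1)) (s + 1 - τ)
    · have : I (s + 1 - τ) = 1 := by
        refine Set.indicator_of_mem (s := {r | Underestimates p x m T τ (best (τ + r)) r}) ?_ _
        change Underestimates p x m T τ (best (τ + (s + 1 - τ))) (s + 1 - τ)
        rwa [show τ + (s + 1 - τ) = s + 1 by omega]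
      rw [this]; linarith
    have hI' := hI0 (s + 1 - τ)
    -- For the first sample of an arm the increment `√1 - √0` is 1, and `b ≥ 1` lets it pay for a
    -- gap of at most 1.
    rcases Nat.eq_zero_or_pos ((run p x s).n (arm p x s)) with hn | hn
    · rw [hn] at *
      simp
      linarith
    · have h2 := gap_le_of_ucb hK hsel h0 hs hτs (by omega : s < T) hc hq hE
        (fun k i h1 h2 => hμ k i h1 (by omega)) hU hn
      have h3 := inv_sqrt_le_sub _ hn
      rw [← hb, div_eq_mul_one_div] at h2
      have h4 := mul_le_mul_of_nonneg_left h3 (by linarith : 0 ≤ b)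
      linarith
  -- telescoping
  have htel : ∀ e', τ ≤ e' → e' ≤ e → ∑ s ∈ Finset.Ico τ e',
      3 * b * (Real.sqrt ((run p x s).n (arm p x s) + 1 : ℕ) -
          Real.sqrt ((run p x s).n (arm p x s))) = 3 * b * ∑ k, Real.sqrt ((run p x e').n k) := by
    intro e' h1
    induction e', h1 using Nat.le_induction with
    | base => intro _; rw [(fresh_of_tau_eq h0).1]; simp
    | succ e' h1 ih =>
      intro h2
      rw [Finset.sum_Ico_succ_top h1, ih (by omega), ← mul_add]
      congr 1
      have hτ1 := (tau_eq_of_between h1 (by omega) (he.trans h0.symm)).trans h0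
      have hτ2 := (tau_eq_of_between (by omega) h2 (he.trans h0.symm)).trans h0
      have hna := not_alarm_of_tau_eq (hτ2.trans hτ1.symm)
      have h3 : ∀ k, Real.sqrt ((run p x (e' + 1)).n k) = Real.sqrt ((run p x e').n k) +
          if arm p x e' = k then (Real.sqrt ((run p x e').n (arm p x e') + 1 : ℕ) -
          Real.sqrt ((run p x e').n (arm p x e'))) else 0 := by
        intro k
        rw [n_succ hna]
        split_ifs with h
        · rw [h]; ring
        · simp
      rw [Finset.sum_congr rfl fun k _ => h3 k, Finset.sum_add_distrib]
      simp
  have hsqrt : ∑ k, Real.sqrt ((run p x e).n k) ≤ Real.sqrt (K * (e - τ : ℕ)) := by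
    refine Real.le_sqrt_of_sq_le ?_
    have h1 := sq_sum_le_card_mul_sum_sq (s := (Finset.univ : Finset (Fin K)))
      (f := fun k => Real.sqrt ((run p x e).n k))
    refine h1.trans (le_of_eq ?_)
    rw [Finset.sum_congr rfl fun k _ => Real.sq_sqrt (Nat.cast_nonneg _), ← sum_n_eq h0 hτe he]
    simp
  -- exploration
  have hexp : ∑ s ∈ Finset.Ico τ e, (if Explores p x s then (1 : ℝ) else 0) ≤
      2 * p.α * Real.sqrt ((e - τ : ℕ) : ℝ) + Real.sqrt (K * (e - τ : ℕ)) := by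
    -- The additive `K` of the exploration bound is absorbed in `√(K (e - τ))`: short stretches are
    -- bounded by their length, and on long ones `K` is at most this root.
    rcases le_total (e - τ) K with h | h
    · have h1 : ∑ s ∈ Finset.Ico τ e, (if Explores p x s then (1 : ℝ) else 0) ≤ (e - τ : ℕ) := by
        calc _ ≤ ∑ s ∈ Finset.Ico τ e, (1 : ℝ) := Finset.sum_le_sum fun s _ => by
              split_ifs <;> norm_num
          _ = _ := by simp
      have h2 : ((e - τ : ℕ) : ℝ) ≤ Real.sqrt (K * (e - τ : ℕ)) := by
        refine Real.le_sqrt_of_sq_le ?_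
        rw [sq]
        gcongr
      have : 0 ≤ 2 * p.α * Real.sqrt ((e - τ : ℕ) : ℝ) := by positivity
      linarith
    · have h2 : (K : ℝ) ≤ Real.sqrt (K * (e - τ : ℕ)) := by
        refine Real.le_sqrt_of_sq_le ?_
        rw [sq]
        gcongr
      have := sum_explores_le hK hα h0 hτe he
      linarith
  -- early rounds and underestimation
  have hsec : ∑ s ∈ Finset.Ico τ e, (if s + 1 - τ ≤ r₀ then 1 else I (s + 1 - τ)) ≤
      r₀ + ∑ r ∈ Finset.Ioc r₀ T, I r := by
    have h1 : ∑ s ∈ Finset.Ico τ e, (if s + 1 - τ ≤ r₀ then 1 else I (s + 1 - τ)) =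
        ∑ r ∈ Finset.Ioc 0 (e - τ), (if r ≤ r₀ then 1 else I r) := by
      refine Finset.sum_bij (fun s _ => s + 1 - τ) (fun s hs => ?_) (fun a ha b hb h => ?_)
        (fun r hr => ⟨τ + r - 1, ?_, ?_⟩) (fun _ _ => rfl) <;>
        simp only [Finset.mem_Ico, Finset.mem_Ioc] at * <;> omega
    rw [h1]
    have h2 : Finset.Ioc 0 (e - τ) ⊆ Finset.Ioc 0 r₀ ∪ Finset.Ioc r₀ T := by
      intro r hr
      simp only [Finset.mem_union, Finset.mem_Ioc] at *
      omega
    have hdisj : Disjoint (Finset.Ioc 0 r₀) (Finset.Ioc r₀ T) := by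
      rw [Finset.disjoint_left]
      intro r h1 h2
      simp only [Finset.mem_Ioc] at *
      omega
    refine (Finset.sum_le_sum_of_subset_of_nonneg h2 fun r _ _ => ?_).trans ?_
    · split_ifs
      · exact zero_le_one
      · exact hI0 _
    rw [Finset.sum_union hdisj]
    refine add_le_add (le_of_eq ?_) (le_of_eq ?_)
    · rw [Finset.sum_congr rfl fun r hr => if_pos (Finset.mem_Ioc.1 hr).2]; simp
    · refine Finset.sum_congr rfl fun r hr => if_neg ?_
      have := (Finset.mem_Ioc.1 hr).1
      omega
  have hsum : ∑ s ∈ Finset.Ico τ e, (m (best (s + 1)) (s + 1) - m (arm p x s) (s + 1)) ≤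
      ∑ s ∈ Finset.Ico τ e, ((if Explores p x s then (1 : ℝ) else 0) +
        (if s + 1 - τ ≤ r₀ then 1 else I (s + 1 - τ)) +
        3 * b * (Real.sqrt ((run p x s).n (arm p x s) + 1 : ℕ) -
          Real.sqrt ((run p x s).n (arm p x s)))) :=
    Finset.sum_le_sum fun s hs => hround s (Finset.mem_Ico.1 hs).1 (Finset.mem_Ico.1 hs).2
  rw [Finset.sum_add_distrib, Finset.sum_add_distrib, htel e hτe le_rfl] at hsum
  have := mul_le_mul_of_nonneg_left hsqrt (by linarith : 0 ≤ 3 * b)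
  linarith

end Segment

/-! ## Change points -/

section ChangePoints

variable {K : ℕ} (B : Bandit K) (T : ℕ)

theorem changePoint_zero : B.changePoint T 0 = 0 := if_pos rfl

theorem changePoint_succ_of_lt {i : ℕ} (h : i < (B.changeTimes T).card) :
    B.changePoint T (i + 1) = (B.changeTimes T).orderEmbOfFin rfl ⟨i, h⟩ := by
  simp only [Bandit.changePoint]
  rw [if_neg (by omega), dif_pos (by simpa using h)]
  rfl

theorem changePoint_numSegments : B.changePoint T (B.numSegments T) = T := by
  have h : B.numSegments T = 1 + (B.changeTimes T).card := rfl
  unfold Bandit.changePoint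
  rw [if_neg (by omega), dif_neg (by omega)]

theorem changePoint_mem {i : ℕ} (h : i + 1 < B.numSegments T) :
    B.changePoint T (i + 1) ∈ B.changeTimes T := by
  have h' : i < (B.changeTimes T).card := by unfold Bandit.numSegments at h; omega
  rw [changePoint_succ_of_lt B T h']
  exact Finset.orderEmbOfFin_mem _ _ _

theorem mem_changeTimes {t : ℕ} :
    t ∈ B.changeTimes T ↔ (1 ≤ t ∧ t ≤ T - 1) ∧ ∃ k, B.f k t ≠ B.f k (t + 1) := by
  simp [Bandit.changeTimes]

theorem changePoint_lt_succ (hT : 1 ≤ T) {i : ℕ} (h : i < B.numSegments T) :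
    B.changePoint T i < B.changePoint T (i + 1) := by
  have hpos : 0 < B.changePoint T 1 := by
    by_cases h1 : 0 + 1 < B.numSegments T
    · exact ((mem_changeTimes B T).1 (changePoint_mem B T h1)).1.1
    · have : 1 = B.numSegments T := by unfold Bandit.numSegments at *; omega
      rw [this, changePoint_numSegments]; exact hT
  rcases i with _ | i
  · rw [changePoint_zero]; exact hpos
  · by_cases h1 : i + 1 + 1 < B.numSegments T
    · have h1' : i + 1 < (B.changeTimes T).card := by unfold Bandit.numSegments at h1; omega
      rw [changePoint_succ_of_lt B T h1', changePoint_succ_of_lt B T (by omega : i < _)]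
      exact (OrderEmbedding.lt_iff_lt _).2 (by simp)
    · have : i + 1 + 1 = B.numSegments T := by omega
      rw [this, changePoint_numSegments]
      have := ((mem_changeTimes B T).1 (changePoint_mem B T h)).1
      omega

theorem changePoint_mono (hT : 1 ≤ T) {i j : ℕ} (hij : i ≤ j) (hj : j ≤ B.numSegments T) :
    B.changePoint T i ≤ B.changePoint T j := by
  induction j, hij using Nat.le_induction with
  | base => exact le_rfl
  | succ j _ ih => exact (ih (by omega)).trans (changePoint_lt_succ B T hT (by omega)).le

theorem not_mem_changeTimes (hT : 1 ≤ T) {i t : ℕ} (hi : i < B.numSegments T)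
    (h1 : B.changePoint T i < t) (h2 : t < B.changePoint T (i + 1)) : t ∉ B.changeTimes T := by
  intro ht
  have : t ∈ Set.range ((B.changeTimes T).orderEmbOfFin rfl) := by
    rw [Finset.range_orderEmbOfFin]; exact ht
  obtain ⟨⟨j, hj⟩, hjt⟩ := this
  have hj' : j + 1 < B.numSegments T := by unfold Bandit.numSegments; omega
  rw [← changePoint_succ_of_lt B T hj] at hjt
  rcases le_or_gt (j + 1) i with h | h
  · have := changePoint_mono B T hT h hi.le
    omega
  · have := changePoint_mono B T hT (show i + 1 ≤ j + 1 from h) hj'.le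
    omega

theorem changePoint_le (hT : 1 ≤ T) {i : ℕ} (hi : i ≤ B.numSegments T) :
    B.changePoint T i ≤ T :=
  (changePoint_mono B T hT hi le_rfl).trans_eq (changePoint_numSegments B T)

theorem law_eq_of_segment (hT : 1 ≤ T) {i s : ℕ} (hi : i < B.numSegments T) (k : Fin K)
    (h1 : B.changePoint T i ≤ s) (h2 : s < B.changePoint T (i + 1)) :
    B.f k (s + 1) = B.f k (B.changePoint T i + 1) := by
  induction s, h1 using Nat.le_induction with
  | base => rfl
  | succ s h1 ih =>
    rw [← ih (by omega)]
    have h3 := not_mem_changeTimes B T hT hi (by omega : B.changePoint T i < s + 1) h2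
    rw [mem_changeTimes] at h3
    have h4 := changePoint_le B T hT (i := i + 1) hi
    by_contra h
    exact h3 ⟨by omega, k, Ne.symm h⟩

theorem mean_eq_of_segment (hT : 1 ≤ T) {i s : ℕ} (hi : i < B.numSegments T) (k : Fin K)
    (h1 : B.changePoint T i ≤ s) (h2 : s < B.changePoint T (i + 1)) :
    B.mean k (s + 1) = B.mean k (B.changePoint T i + 1) := by
  unfold Bandit.mean
  rw [law_eq_of_segment B T hT hi k h1 h2]

theorem segLength_succ (i : ℕ) :
    B.segLength T (i + 1) = B.changePoint T (i + 1) - B.changePoint T i := rfl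

theorem sum_segLength (hT : 1 ≤ T) :
    ∑ i ∈ Finset.range (B.numSegments T), B.segLength T (i + 1) = T := by
  have : ∀ j ≤ B.numSegments T, ∑ i ∈ Finset.range j, B.segLength T (i + 1) =
      B.changePoint T j := by
    intro j
    induction j with
    | zero => intro _; rw [changePoint_zero]; rfl
    | succ j ih =>
      intro hj
      rw [Finset.sum_range_succ, ih (by omega), segLength_succ]
      have := changePoint_lt_succ B T hT (i := j) (by omega)
      omega
  rw [this _ le_rfl, changePoint_numSegments]

end ChangePoints

/-! ## Every change is detected -/

section Detection

variable {K : ℕ} {p : Params K} {x : ℕ → Fin K → ℝ}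

theorem tau_tau (p : Params K) (x : ℕ → Fin K → ℝ) (s : ℕ) :
    (run p x (run p x s).τ).τ = (run p x s).τ := by
  induction s with
  | zero => rfl
  | succ s ih =>
    by_cases h : AlarmAt p x s
    · rw [(run_succ_of_alarm h).1, (run_succ_of_alarm h).1]
    · rw [run_succ_of_not_alarm h]; exact ih

/-- The number of rounds within which a change after a segment of length `s` is detected. -/
def delay (p : Params K) (s : ℕ) : ℕ := p.w / 2 * blockLength K p.α (2 * s)

/-- The bound on the detection delay for the change at the start of the `i`-th segment (counted
from `0`). -/
def Bandit.delayAt (B : Bandit K) (p : Params K) (T : ℕ) : ℕ → ℕ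
  | 0 => 0
  | i + 1 => delay p (B.segLength T (i + 1))

/-- The numerical conditions under which every change is detected. -/
structure DetectionRegime (B : Bandit K) (p : Params K) (T : ℕ) (δ y : ℝ) : Prop where
  two_dvd : p.w = 2 * (p.w / 2)
  pos : 0 < p.w / 2
  le_threshold : y ≤ p.b
  lt_gap : p.b + y < (p.w / 2 : ℕ) * δ
  delay_le : ∀ i, i + 1 < B.numSegments T →
    4 * delay p (B.segLength T (i + 1)) ≤ B.segLength T (i + 1)
  delay_le_next : ∀ i, i + 1 < B.numSegments T →
    2 * delay p (B.segLength T (i + 1)) ≤ B.segLength T (i + 2)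
  uReset_le : ∀ i, i + 1 < B.numSegments T → 4 * p.uReset ≤ B.segLength T (i + 1)
  firstStart_le : ∀ i, i + 1 < B.numSegments T → 4 * firstStart K p.α ≤ B.segLength T (i + 1)
  sq_le : ∀ i, i + 1 < B.numSegments T → 4 * (p.α ^ 2 + K) ≤ B.segLength T (i + 1)

variable {B : Bandit K} {T : ℕ} {δ y : ℝ}

/-- After an alarm inside a segment all retained samples come from that segment, so there is no
further alarm until it ends. -/
theorem no_alarm_in_segment (hT : 1 ≤ T) (hq : QuietWindows p x B.mean T y)
    (hw : p.w = 2 * (p.w / 2)) (hpos : 0 < p.w / 2) (hyb : y ≤ p.b) {i : ℕ}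
    (hi : i < B.numSegments T) {r e : ℕ} (hr : (run p x r).τ = r)
    (hir : B.changePoint T i ≤ r) (hre : r ≤ e) (he : e ≤ B.changePoint T (i + 1)) :
    (run p x e).τ = r := by
  induction e, hre using Nat.le_induction with
  | base => exact hr
  | succ e hre ih =>
    have ih' := ih (by omega)
    have hle := changePoint_le B T hT (i := i + 1) hi
    have hna : ¬ AlarmAt p x e := by
      refine hq.not_alarm (by omega) hw hpos hyb fun s h1 h2 => ?_
      rw [ih'] at h1
      rw [mean_eq_of_segment B T hT hi _ (hir.trans h1) (by omega),
        mean_eq_of_segment B T hT hi _ (hir.trans hre) (by omega)]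
    rw [run_succ_of_not_alarm hna]
    exact ih'

/-- The induction invariant is that the last alarm before the end of a segment occurred shortly
after its start. Then every arm collects half a window before the next change and, failing an alarm,
half a window after it, which forces detection within the delay. -/
theorem DetectionRegime.exists_alarm (hr : DetectionRegime B p T δ y) (hT : 1 ≤ T) (hK : 1 ≤ K)
    (hα : 0 < p.α) (hgap : B.GapAtLeast T δ) (hq : QuietWindows p x B.mean T y) (i : ℕ)
    (hi : i < B.numSegments T) :
    ∃ r, B.changePoint T i ≤ r ∧ r ≤ B.changePoint T i + B.delayAt p T i ∧
      r < B.changePoint T (i + 1) ∧ (run p x r).τ = r ∧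
      (run p x (B.changePoint T (i + 1))).τ = r := by
  induction i with
  | zero =>
    have h0 := changePoint_zero B T
    refine ⟨0, h0.le, Nat.zero_le _, h0 ▸ changePoint_lt_succ B T hT hi, rfl, ?_⟩
    exact no_alarm_in_segment hT hq hr.two_dvd hr.pos hr.le_threshold hi rfl h0.le
      (Nat.zero_le _) le_rfl
  | succ i ih =>
    obtain ⟨r, hr1, hr2, hr3, hr4, hr5⟩ := ih (by omega)
    set ν := B.changePoint T (i + 1) with hν
    set σ := B.segLength T (i + 1) with hσ
    have hσ' : σ = ν - B.changePoint T i := segLength_succ B T i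
    have hmono := changePoint_lt_succ B T hT (i := i) (by omega)
    have hmono' := changePoint_lt_succ B T hT (i := i + 1) hi
    have hend : B.changePoint T (i + 1 + 1) ≤ T := changePoint_le B T hT (by omega)
    have hnext := hr.delay_le_next i hi
    rw [segLength_succ B T (i + 1)] at hnext
    have hD := hr.delay_le i hi
    rw [← hσ] at hD hnext
    rw [← hν] at hmono hmono' hnext
    have hprev : 2 * B.delayAt p T i ≤ σ := by
      cases i with
      | zero => exact Nat.zero_le _
      | succ i => exact hr.delay_le_next i (by omega)
    have hdef : delay p σ = p.w / 2 * blockLength K p.α (2 * σ) := rfl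
    have hu : 4 * (run p x r).u ≤ σ := by
      rcases (fresh_of_tau_eq hr4).2 with h | h
      · rw [h]; exact hr.uReset_le i hi
      · rw [h]; exact hr.firstStart_le i hi
    have hsq : ∀ z : ℕ, σ ≤ 4 * z → p.α ^ 2 + K ≤ (z : ℝ) := by
      intro z hz
      have h1 := hr.sq_le i hi
      have h2 : (σ : ℝ) ≤ 4 * z := by exact_mod_cast hz
      rw [← hσ] at h1
      linarith
    -- half a window of samples of every arm before the change
    have hbefore : ∀ k, p.w / 2 ≤ (run p x ν).n k := by
      intro k
      -- The blocks fill the last `delay p σ ≤ σ/4` rounds of the segment. The alarm `r` came within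
      -- `σ/2` of its start, so at least `σ/4` rounds separate `r` from the first block; this is
      -- where the factors 4 and 2 in `DetectionRegime` are used. The bound `2σ` on the elapsed time
      -- also covers the blocks after `ν`.
      have he : (ν - delay p σ) + p.w / 2 * blockLength K p.α (2 * σ) = ν := by omega
      have := n_add_le_of_block (p := p) (x := x) (τ := r) (s := ν - delay p σ) hK hα hr4
        (by omega) (R := 2 * σ) (by omega) (hsq _ (by omega)) k (p.w / 2)
        (by rw [he]; exact_mod_cast (by omega : ν - r ≤ 2 * σ)) (by rw [he]; exact hr5)
      rw [he] at this
      omega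
    obtain ⟨k, hk⟩ := hgap ν (changePoint_mem B T hi)
    have halarm := hq.exists_alarm (ν := ν) (e := ν + delay p σ) (by omega) (by omega)
      hr.two_dvd hr.pos (k := k) (m₁ := B.mean k ν) (m₂ := B.mean k (ν + 1))
      (fun s h1 h2 => by
        rw [hr5] at h1
        obtain ⟨q, hq⟩ : ∃ q, ν = q + 1 := ⟨ν - 1, by omega⟩
        rw [mean_eq_of_segment B T hT (i := i) (by omega) k (by omega) (by omega), hq,
          mean_eq_of_segment B T hT (i := i) (s := q) (by omega) k (by omega) (by omega)])
      (fun s h1 h2 => mean_eq_of_segment B T hT hi k h1 (by omega)) (hbefore k)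
      (fun he => by
        rw [hdef] at he ⊢
        exact n_add_le_of_block (p := p) (x := x) (τ := r) (s := ν) hK hα hr4
          (by omega) (R := 2 * σ) (by omega) (hsq _ (by omega)) k (p.w / 2)
          (by rw [← hdef]; exact_mod_cast (by omega : ν + delay p σ - r ≤ 2 * σ))
          (he.trans hr5))
      (hr.lt_gap.trans_le (by gcongr))
    set e := ν + delay p σ with he
    have hge := tau_mono p x (by omega : ν ≤ e)
    simp only at hge
    have hlast := tau_tau p x e
    have hle := tau_le p x e
    set r' := (run p x e).τ with hr'
    -- The value of `τ` has changed since `ν`. An alarm time before `ν` would, by monotonicity of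
    -- `τ`, already be at most the old value.
    have hr'ν : ν ≤ r' := by
      by_contra h
      have := tau_mono p x (by omega : r' ≤ ν)
      simp only at this
      omega
    refine ⟨r', hr'ν, hle, ?_, hlast, ?_⟩
    · omega
    · exact no_alarm_in_segment hT hq hr.two_dvd hr.pos hr.le_threshold hi hlast hr'ν
        (by omega) le_rfl

/-- Regret on a reward table with small noise. -/
theorem DetectionRegime.sum_gap_le (hr : DetectionRegime B p T δ y) (hT : 2 ≤ T) (hK : 1 ≤ K)
    (hα : 0 < p.α) (hsel : ∀ S : Finset (Fin K), S.Nonempty → p.sel S ∈ S)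
    (hgap : B.GapAtLeast T δ) (hq : QuietWindows p x B.mean T y)
    {c : ℝ} (hc : 0 ≤ c) (hqs : QuietSamples p x B.mean T c)
    (hμ01 : ∀ k j t t', B.mean k t - B.mean j t' ≤ 1) (best : ℕ → Fin K) (r₀ : ℕ) :
    ∑ s ∈ Finset.range T, (B.mean (best (s + 1)) (s + 1) - B.mean (arm p x s) (s + 1)) ≤
      ∑ i ∈ Finset.range (B.numSegments T), ((B.delayAt p T i : ℝ) +
        (2 * p.α * Real.sqrt (B.segLength T (i + 1)) + Real.sqrt (K * B.segLength T (i + 1)) + r₀ +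
        3 * (Real.sqrt (2 * c) + Real.sqrt (2 * Real.log T)) *
          Real.sqrt (K * B.segLength T (i + 1)))) +
      ∑ τ ∈ Finset.range T, ∑ r ∈ Finset.Ioc r₀ T, Set.indicator
          {r | Underestimates p x B.mean T τ (best (τ + r)) r} (fun _ => (1 : ℝ)) r := by
  classical
  have hT1 : 1 ≤ T := by omega
  choose! rs h1 h2 h3 h4 h5 using hr.exists_alarm (x := x) hT1 hK hα hgap hq
  set g : ℕ → ℝ := fun s => B.mean (best (s + 1)) (s + 1) - B.mean (arm p x s) (s + 1) with hg
  set J : ℕ → ℝ := fun τ => ∑ r ∈ Finset.Ioc r₀ T, Set.indicator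
          {r | Underestimates p x B.mean T τ (best (τ + r)) r} (fun _ => (1 : ℝ)) r with hJ
  have hJ0 : ∀ τ, 0 ≤ J τ := fun τ => Finset.sum_nonneg fun r _ =>
    Set.indicator_nonneg (fun _ _ => zero_le_one) r
  have hsplit : ∀ j ≤ B.numSegments T, ∑ s ∈ Finset.range (B.changePoint T j), g s =
      ∑ i ∈ Finset.range j, ∑ s ∈ Finset.Ico (B.changePoint T i) (B.changePoint T (i + 1)), g s := by
    intro j
    induction j with
    | zero => intro _; rw [changePoint_zero]; simp
    | succ j ih =>
      intro hj
      rw [Finset.sum_range_succ, ← ih (by omega), Finset.range_eq_Ico, Finset.range_eq_Ico,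
        Finset.sum_Ico_consecutive _ (Nat.zero_le _)
          (changePoint_lt_succ B T hT1 (by omega)).le]
  have hseg : ∀ i ∈ Finset.range (B.numSegments T),
      ∑ s ∈ Finset.Ico (B.changePoint T i) (B.changePoint T (i + 1)), g s ≤
      ((B.delayAt p T i : ℝ) +
        (2 * p.α * Real.sqrt (B.segLength T (i + 1)) + Real.sqrt (K * B.segLength T (i + 1)) + r₀ +
        3 * (Real.sqrt (2 * c) + Real.sqrt (2 * Real.log T)) *
          Real.sqrt (K * B.segLength T (i + 1)))) + J (rs i) := by
    intro i hi
    have hi' := Finset.mem_range.1 hi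
    have hle := changePoint_le B T hT1 (i := i + 1) hi'
    rw [← Finset.sum_Ico_consecutive _ (h1 i hi') (h3 i hi').le]
    have e1 : ∑ s ∈ Finset.Ico (B.changePoint T i) (rs i), g s ≤ B.delayAt p T i := by
      calc _ ≤ ∑ s ∈ Finset.Ico (B.changePoint T i) (rs i), (1 : ℝ) :=
            Finset.sum_le_sum fun s _ => hμ01 _ _ _ _
        _ = ((rs i - B.changePoint T i : ℕ) : ℝ) := by simp
        _ ≤ _ := by
          have := h2 i hi'
          exact_mod_cast (by omega : rs i - B.changePoint T i ≤ B.delayAt p T i)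
    have e2 := DimExp.sum_gap_le (m := B.mean) hK hsel hα hT (h4 i hi') (h3 i hi').le (h5 i hi') hle
      hc hqs (best := best) (fun k s ha hb => mean_eq_of_segment B T hT1 hi' k ((h1 i hi').trans ha) hb)
      (fun k j => hμ01 k j _ _) r₀
    have e3 : ((B.changePoint T (i + 1) - rs i : ℕ) : ℝ) ≤ B.segLength T (i + 1) := by
      have := h1 i hi'
      rw [segLength_succ]
      exact_mod_cast (by omega)
    have e4 : Real.sqrt ((B.changePoint T (i + 1) - rs i : ℕ) : ℝ) ≤
        Real.sqrt (B.segLength T (i + 1)) := Real.sqrt_le_sqrt e3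
    have e5 : Real.sqrt (K * (B.changePoint T (i + 1) - rs i : ℕ)) ≤
        Real.sqrt (K * B.segLength T (i + 1)) := by
      apply Real.sqrt_le_sqrt
      gcongr
    have e6 : 2 * p.α * Real.sqrt ((B.changePoint T (i + 1) - rs i : ℕ) : ℝ) ≤
        2 * p.α * Real.sqrt (B.segLength T (i + 1)) := by gcongr
    have e7 := mul_le_mul_of_nonneg_left e5
      (by positivity : 0 ≤ 3 * (Real.sqrt (2 * c) + Real.sqrt (2 * Real.log T)))
    linarith
  have htot := hsplit _ le_rfl
  rw [changePoint_numSegments] at htot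
  rw [htot]
  refine (Finset.sum_le_sum hseg).trans ?_
  rw [Finset.sum_add_distrib]
  gcongr
  -- The alarm times depend on the table. Being distinct, they may be replaced by all `τ < T`, which
  -- leaves only underestimation events at fixed `τ`.
  have hinj : Set.InjOn rs (Finset.range (B.numSegments T)) := by
    have key : ∀ i j, i < j → j < B.numSegments T → rs i < rs j := by
      intro i j hij hj
      exact (h3 i (by omega)).trans_le
        ((changePoint_mono B T hT1 (show i + 1 ≤ j from hij) hj.le).trans (h1 j hj))
    intro i hi j hj hij
    have hi' := Finset.mem_range.1 hi
    have hj' := Finset.mem_range.1 hj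
    rcases lt_trichotomy i j with h | h | h
    · have := key i j h hj'; omega
    · exact h
    · have := key j i h hi'; omega
  rw [← Finset.sum_image (f := J) hinj]
  refine Finset.sum_le_sum_of_subset_of_nonneg ?_ fun τ _ _ => hJ0 τ
  intro τ hτ
  obtain ⟨i, hi, rfl⟩ := Finset.mem_image.1 hτ
  have hi' := Finset.mem_range.1 hi
  exact Finset.mem_range.2 ((h3 i hi').trans_le (changePoint_le B T hT1 hi'))

end Detection

/-! ## Measurability and predictability of a run -/

section Measurability

variable {K : ℕ}

/-- The state with counters `d = (τ, u, n)` and samples `z`. -/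
abbrev stateOf (d : ℕ × ℕ × (Fin K → ℕ)) (z : Fin K → ℕ → ℝ) : State K := ⟨d.1, d.2.1, d.2.2, z⟩

/-- Counters and samples of a state. -/
abbrev State.components (s : State K) : (ℕ × ℕ × (Fin K → ℕ)) × (Fin K → ℕ → ℝ) :=
  ((s.τ, s.u, s.n), s.Z)

theorem measurable_ucb (d : ℕ × ℕ × (Fin K → ℕ)) (t : ℕ) (k : Fin K) :
    Measurable fun z : Fin K → ℕ → ℝ => ucb (stateOf d z) t k := by
  unfold ucb
  simp only
  split_ifs
  · exact measurable_const
  · apply Measurable.coe_real_ereal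
    apply Measurable.add_const
    apply Measurable.const_mul
    exact Finset.measurable_sum _ fun l _ => (measurable_pi_apply l).comp (measurable_pi_apply k)

/-- The set of maximizers takes finitely many values, each determined by comparisons of indices.
Hence an arbitrary tie-breaking rule is harmless. -/
theorem measurable_action_of_counters (p : Params K) (d : ℕ × ℕ × (Fin K → ℕ)) (t : ℕ) :
    Measurable fun z : Fin K → ℕ → ℝ => action p (stateOf d z) t := by
  classical
  unfold action
  simp only
  split_ifs
  · exact measurable_const' fun _ _ => rfl
  · refine measurable_to_countable' fun a => ?_
    have hmem : ∀ k, MeasurableSet {z : Fin K → ℕ → ℝ | k ∈ ucbMaximizers (stateOf d z) t} := by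
      intro k
      have : {z : Fin K → ℕ → ℝ | k ∈ ucbMaximizers (stateOf d z) t} =
          ⋂ j, {z | ucb (stateOf d z) t j ≤ ucb (stateOf d z) t k} := by
        ext z
        simp [ucbMaximizers]
      rw [this]
      exact MeasurableSet.iInter fun j => measurableSet_le (measurable_ucb d t j)
        (measurable_ucb d t k)
    have hS : ∀ S, MeasurableSet {z : Fin K → ℕ → ℝ | ucbMaximizers (stateOf d z) t = S} := by
      intro S
      have : {z : Fin K → ℕ → ℝ | ucbMaximizers (stateOf d z) t = S} =
          ⋂ k, {z | k ∈ ucbMaximizers (stateOf d z) t ↔ k ∈ S} := by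
        ext z
        simp [Finset.ext_iff]
      rw [this]
      refine MeasurableSet.iInter fun k => ?_
      by_cases hk : k ∈ S
      · simpa only [hk, iff_true] using hmem k
      · simp only [hk, iff_false]
        exact (hmem k).compl
    have : (fun z : Fin K → ℕ → ℝ => p.sel (ucbMaximizers (stateOf d z) t)) ⁻¹' {a} =
        ⋃ S : {S : Finset (Fin K) // p.sel S = a},
          {z | ucbMaximizers (stateOf d z) t = S} := by
      ext z
      simp
    rw [this]
    exact MeasurableSet.iUnion fun S => hS S

theorem measurable_action (p : Params K) (t : ℕ) :
    Measurable fun q : (ℕ × ℕ × (Fin K → ℕ)) × (Fin K → ℕ → ℝ) =>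
      action p (stateOf q.1 q.2) t :=
  measurable_from_prod_countable_right fun d => measurable_action_of_counters p d t

/-- The counters and the arm played range over countable types. With both fixed, the new state is an
explicit measurable function of samples and rewards. -/
theorem measurable_step (p : Params K) (t : ℕ) :
    Measurable fun q : (ℕ × ℕ × (Fin K → ℕ)) × ((Fin K → ℕ → ℝ) × (Fin K → ℝ)) =>
      (step p (stateOf q.1 q.2.1) t q.2.2).components := by
  classical
  refine measurable_from_prod_countable_right fun d => ?_
  simp only
  -- the step as a function of the arm played
  let Z' : Fin K → (Fin K → ℕ → ℝ) × (Fin K → ℝ) → Fin K → ℕ → ℝ := fun a q =>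
    Function.update q.1 a (Function.update (q.1 a)
      (Function.update d.2.2 a (d.2.2 a + 1) a) (q.2 a))
  let G : Fin K × ((Fin K → ℕ → ℝ) × (Fin K → ℝ)) →
      (ℕ × ℕ × (Fin K → ℕ)) × (Fin K → ℕ → ℝ) := fun r =>
    if p.w ≤ Function.update d.2.2 r.1 (d.2.2 r.1 + 1) r.1 ∧
        CD p.w p.b (fun l => Z' r.1 r.2 r.1
          (Function.update d.2.2 r.1 (d.2.2 r.1 + 1) r.1 - p.w + l)) then
      ((t, p.uReset, fun _ => 0), Z' r.1 r.2)
    else ((d.1, if t - d.1 = d.2.1 + K then nextStart K p.α d.2.1 else d.2.1,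
      Function.update d.2.2 r.1 (d.2.2 r.1 + 1)), Z' r.1 r.2)
  have hG : Measurable G := by
    refine measurable_from_prod_countable_right fun a => ?_
    have hZ : ∀ k l, Measurable fun q => Z' a q k l := by
      intro k l
      by_cases hk : k = a
      · subst hk
        simp only [Z', Function.update_self]
        by_cases hl : l = d.2.2 k + 1
        · subst hl
          simp only [Function.update_self]
          exact (measurable_pi_apply k).comp measurable_snd
        · simp only [Function.update_of_ne hl]
          exact (measurable_pi_apply l).comp ((measurable_pi_apply k).comp measurable_fst)
      · simp only [Z', Function.update_of_ne hk]
        exact (measurable_pi_apply l).comp ((measurable_pi_apply k).comp measurable_fst)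
    have hZ' : Measurable (Z' a) := measurable_pi_iff.2 fun k => measurable_pi_iff.2 fun l => hZ k l
    simp only [G]
    refine Measurable.ite ?_ (measurable_const.prodMk hZ') (measurable_const.prodMk hZ')
    refine (MeasurableSet.const _).inter ?_
    have hD := (Finset.measurable_sum (Finset.Icc (p.w / 2 + 1) p.w) fun l _ =>
      hZ a (Function.update d.2.2 a (d.2.2 a + 1) a - p.w + l)).sub
      (Finset.measurable_sum (Finset.Icc 1 (p.w / 2)) fun l _ =>
      hZ a (Function.update d.2.2 a (d.2.2 a + 1) a - p.w + l))
    exact measurableSet_lt measurable_const (continuous_abs.measurable.comp hD)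
  have hpair : Measurable fun q : (Fin K → ℕ → ℝ) × (Fin K → ℝ) =>
      (action p (stateOf d q.1) t, q) :=
    ((measurable_action_of_counters p d t).comp measurable_fst).prodMk measurable_id
  have hcomp := hG.comp hpair
  convert hcomp using 1
  ext1 q
  simp only [Function.comp, G, step, Z']
  split_ifs <;> rfl

theorem measurable_run (p : Params K) (t : ℕ) :
    Measurable fun x : ℕ → Fin K → ℝ => (run p x t).components := by
  induction t with
  | zero => exact (measurable_const :
      Measurable fun _ : ℕ → Fin K → ℝ => (initState p).components)
  | succ t ih =>
    exact (measurable_step p (t + 1)).comp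
      (ih.fst.prodMk (ih.snd.prodMk (measurable_pi_apply (t + 1))))

theorem measurable_arm (p : Params K) (s : ℕ) :
    Measurable fun x : ℕ → Fin K → ℝ => arm p x s :=
  (measurable_action p (s + 1)).comp (measurable_run p s)

theorem measurable_of_counters {β : Type*} [MeasurableSpace β] (p : Params K) (s t : ℕ)
    (F : (ℕ × ℕ × (Fin K → ℕ)) × Fin K → (ℕ × ℕ × (Fin K → ℕ)) × Fin K → β) :
    Measurable fun x : ℕ → Fin K → ℝ =>
      F ((run p x s).components.1, arm p x s) ((run p x t).components.1, arm p x t) :=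
  (Measurable.of_discrete (f := fun q : ((ℕ × ℕ × (Fin K → ℕ)) × Fin K) ×
      ((ℕ × ℕ × (Fin K → ℕ)) × Fin K) => F q.1 q.2)).comp
    (((measurable_run p s).fst.prodMk (measurable_arm p s)).prodMk
      ((measurable_run p t).fst.prodMk (measurable_arm p t)))

theorem measurable_weight (p : Params K) (τ : ℕ) (k : Fin K) (h : ℕ → ℝ) (s : ℕ) :
    Measurable fun x => weight p x τ k h s := by
  classical
  exact measurable_of_counters p s s fun q _ =>
    if q.1.1 = τ ∧ q.2 = k then h (q.1.2.2 k + 1) else 0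

theorem measurable_windowWeight (p : Params K) (t₀ s : ℕ) :
    Measurable fun x => windowWeight p x t₀ s := by
  classical
  exact measurable_of_counters p t₀ s fun q r =>
    if t₀ ≤ s then (if r.1.1 = q.1.1 ∧ r.2 = q.2 then
      halves (p.w / 2) (q.1.2.2 q.2) (r.1.2.2 q.2 + 1) else 0) else 0

theorem measurable_noise (p : Params K) (m : Fin K → ℕ → ℝ) (s : ℕ) :
    Measurable fun x => noise p x m s := by
  have : Measurable fun q : Fin K × (Fin K → ℝ) => q.2 q.1 - m q.1 (s + 1) :=
    measurable_from_prod_countable_right fun a => by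
      simpa only using (measurable_pi_apply a).sub_const _
  exact this.comp ((measurable_arm p s).prodMk (measurable_pi_apply (s + 1)))

/-- The reward table `x` with the rewards after round `s` replaced by `0`. -/
def trunc (s : ℕ) (x : ℕ → Fin K → ℝ) : ℕ → Fin K → ℝ := fun t => if t ≤ s then x t else 0

theorem trunc_apply {s t : ℕ} (h : t ≤ s) (x : ℕ → Fin K → ℝ) : trunc s x t = x t := if_pos h

theorem run_trunc (p : Params K) (x : ℕ → Fin K → ℝ) {s t : ℕ} (h : t ≤ s) :
    run p (trunc s x) t = run p x t := by
  induction t with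
  | zero => rfl
  | succ t ih => rw [run, run, ih (by omega), trunc_apply h]

theorem arm_trunc (p : Params K) (x : ℕ → Fin K → ℝ) {s t : ℕ} (h : t ≤ s) :
    arm p (trunc s x) t = arm p x t := by rw [arm, run_trunc p x h]

theorem weight_trunc (p : Params K) (x : ℕ → Fin K → ℝ) (τ : ℕ) (k : Fin K) (h : ℕ → ℝ) {s t : ℕ}
    (hts : t ≤ s) : weight p (trunc s x) τ k h t = weight p x τ k h t := by
  unfold weight; rw [run_trunc p x hts, arm_trunc p x hts]

theorem windowWeight_trunc (p : Params K) (x : ℕ → Fin K → ℝ) (t₀ : ℕ) {s t : ℕ}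
    (hts : t ≤ s) : windowWeight p (trunc s x) t₀ t = windowWeight p x t₀ t := by
  unfold windowWeight
  split_ifs with h
  · rw [run_trunc p x (h.trans hts), arm_trunc p x (h.trans hts), weight_trunc p x _ _ _ hts]
  · rfl

theorem noise_trunc (p : Params K) (x : ℕ → Fin K → ℝ) (m : Fin K → ℕ → ℝ) {s t : ℕ}
    (h : t + 1 ≤ s) : noise p (trunc s x) m t = noise p x m t := by
  unfold noise
  rw [arm_trunc p x (by omega), trunc_apply h]

end Measurability

/-! ## Concentration of sums with predictable weights -/

section Concentration

variable {K : ℕ} {B : Bandit K} {Ω : Type v} [MeasurableSpace Ω] {P : Measure Ω}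
  {X : ℕ → Ω → Fin K → ℝ}

/-- The reward table of the outcome `ω`. -/
abbrev table (X : ℕ → Ω → Fin K → ℝ) (ω : Ω) : ℕ → Fin K → ℝ := fun t => X t ω

theorem measurable_table (hX : B.IsRewardSeq P X) : Measurable (table X) :=
  measurable_pi_iff.2 hX.measurable

theorem measurable_trunc (s : ℕ) : Measurable (trunc (K := K) s) := by
  refine measurable_pi_iff.2 fun t => ?_
  unfold trunc
  split_ifs
  · exact measurable_pi_apply t
  · exact measurable_const

theorem measurable_reward (hX : B.IsRewardSeq P X) (k : Fin K) (t : ℕ) :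
    Measurable fun ω => X t ω k :=
  (measurable_pi_apply k).comp (hX.measurable t)

theorem integral_reward (hX : B.IsRewardSeq P X) (k : Fin K) (t : ℕ) :
    ∫ ω, X t ω k ∂P = B.mean k t := by
  rw [Bandit.mean, ← hX.law k t]
  exact (integral_map (measurable_reward hX k t).aemeasurable
    measurable_id.aestronglyMeasurable).symm

theorem reward_mem_Icc (hX : B.IsRewardSeq P X) (k : Fin K) (t : ℕ) :
    ∀ᵐ ω ∂P, X t ω k ∈ Set.Icc (0 : ℝ) 1 := by
  have := B.prob k t
  have h1 : ∀ᵐ x ∂(B.f k t), x ∈ Set.Icc (0 : ℝ) 1 :=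
    (mem_ae_iff_prob_eq_one measurableSet_Icc).2 (B.supp k t)
  rw [← hX.law k t] at h1
  exact ae_of_ae_map (measurable_reward hX k t).aemeasurable h1

/-- The truncated table is a function of the rewards up to round `s`, a finite family disjoint from
round `s + 1`. -/
theorem indepFun_trunc (hX : B.IsRewardSeq P X) (s : ℕ) :
    IndepFun (fun ω => trunc s (table X ω)) (X (s + 1)) P := by
  classical
  have h := hX.indep.indepFun_finset (Finset.range (s + 1)) {s + 1} (by simp) hX.measurable
  have h1 : Measurable fun (v : Finset.range (s + 1) → Fin K → ℝ) (t : ℕ) =>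
      if h : t ∈ Finset.range (s + 1) then v ⟨t, h⟩ else 0 := by
    refine measurable_pi_iff.2 fun t => ?_
    split_ifs
    · exact measurable_pi_apply _
    · exact measurable_const
  have h2 : Measurable fun (v : ({s + 1} : Finset ℕ) → Fin K → ℝ) =>
      v ⟨s + 1, Finset.mem_singleton_self _⟩ := measurable_pi_apply _
  have h3 := h.comp h1 h2
  have h4 : (fun ω => trunc s (table X ω)) =
      (fun (v : Finset.range (s + 1) → Fin K → ℝ) (t : ℕ) =>
        if h : t ∈ Finset.range (s + 1) then v ⟨t, h⟩ else 0) ∘ fun ω i => X i ω := by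
    funext ω t
    simp only [trunc, Function.comp, Finset.mem_range, Nat.lt_succ_iff]
    split_ifs <;> rfl
  rw [h4]
  exact h3

variable [IsProbabilityMeasure P]

/-- Hoeffding's lemma for a reward in `[0,1]`, normalized so that the factors of successive rounds
multiply. -/
theorem lintegral_exp_le_one (hX : B.IsRewardSeq P X) (k : Fin K) (t : ℕ) (l : ℝ) :
    ∫⁻ ω, ENNReal.ofReal (Real.exp (l * (X t ω k - B.mean k t) - l ^ 2 / 8)) ∂P ≤ 1 := by
  have hs := hasSubgaussianMGF_of_mem_Icc (measurable_reward hX k t).aemeasurable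
    (reward_mem_Icc hX k t)
  rw [integral_reward hX k t] at hs
  have h1 := hs.mgf_le l
  have h2 := hs.integrable_exp_mul l
  have h3 : ∀ ω, Real.exp (l * (X t ω k - B.mean k t) - l ^ 2 / 8) =
      Real.exp (-(l ^ 2 / 8)) * Real.exp (l * (X t ω k - B.mean k t)) := fun ω => by
    rw [← Real.exp_add]; ring_nf
  simp_rw [h3]
  rw [← ofReal_integral_eq_lintegral_ofReal (h2.const_mul _)
    (Filter.Eventually.of_forall fun ω => by positivity), integral_const_mul]
  rw [ENNReal.ofReal_le_one]
  have h4 : Real.exp (-(l ^ 2 / 8)) * mgf (fun ω => X t ω k - B.mean k t) P l ≤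
      Real.exp (-(l ^ 2 / 8)) * Real.exp (l ^ 2 / 8) := by
    gcongr
    refine h1.trans (le_of_eq ?_)
    congr 1
    simp
    ring
  rw [← Real.exp_add] at h4
  simpa [mgf] using h4

/-- Weights `c s x` of the rounds `s + 1` that depend on the rewards up to round `s` only. -/
structure IsPredictable (c : ℕ → (ℕ → Fin K → ℝ) → ℝ) : Prop where
  measurable : ∀ s, Measurable (c s)
  eq_trunc : ∀ {s t}, t ≤ s → ∀ x, c t (trunc s x) = c t x

theorem isPredictable_weight (p : Params K) (τ : ℕ) (k : Fin K) (h : ℕ → ℝ) :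
    IsPredictable fun s x => weight p x τ k h s :=
  ⟨measurable_weight p τ k h, fun hts x => weight_trunc p x τ k h hts⟩

theorem isPredictable_windowWeight (p : Params K) (t₀ : ℕ) :
    IsPredictable fun s x => windowWeight p x t₀ s :=
  ⟨measurable_windowWeight p t₀, fun hts x => windowWeight_trunc p x t₀ hts⟩

theorem IsPredictable.const_mul {c : ℕ → (ℕ → Fin K → ℝ) → ℝ} (hc : IsPredictable c) (l : ℝ) :
    IsPredictable fun s x => l * c s x :=
  ⟨fun s => (hc.measurable s).const_mul l, fun hts x => by simp only [hc.eq_trunc hts]⟩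

/-- The supermartingale property, by induction on the number of rounds and without conditional
expectations. Only one arm per round enters, so dependence between arms in the same round does not
matter. -/
theorem IsPredictable.lintegral_exp_sum_le (hX : B.IsRewardSeq P X) (p : Params K)
    {c : ℕ → (ℕ → Fin K → ℝ) → ℝ} (hc : IsPredictable c) (n : ℕ) :
    ∫⁻ ω, ENNReal.ofReal (Real.exp (∑ s ∈ Finset.range n,
      (c s (table X ω) * noise p (table X ω) B.mean s - c s (table X ω) ^ 2 / 8))) ∂P ≤ 1 := by
  induction n with
  | zero => simp
  | succ n ih =>
    refine le_trans ?_ ih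
    set S : (ℕ → Fin K → ℝ) → ℝ := fun x => ∑ s ∈ Finset.range n,
      (c s x * noise p x B.mean s - c s x ^ 2 / 8) with hS
    have hSm : Measurable S := Finset.measurable_sum _ fun s _ =>
      ((hc.measurable s).mul (measurable_noise p B.mean s)).sub
        (((hc.measurable s).pow_const 2).div_const 8)
    have hSt : ∀ x, S (trunc n x) = S x := fun x => by
      refine Finset.sum_congr rfl fun s hs => ?_
      have := Finset.mem_range.1 hs
      rw [hc.eq_trunc (by omega), noise_trunc p x _ (by omega)]
    let F : (ℕ → Fin K → ℝ) × (Fin K → ℝ) → ENNReal := fun q =>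
      ENNReal.ofReal (Real.exp (S q.1)) * ENNReal.ofReal (Real.exp
        (c n q.1 * (q.2 (arm p q.1 n) - B.mean (arm p q.1 n) (n + 1)) - c n q.1 ^ 2 / 8))
    have hval : Measurable fun q : (ℕ → Fin K → ℝ) × (Fin K → ℝ) =>
        q.2 (arm p q.1 n) - B.mean (arm p q.1 n) (n + 1) := by
      have : Measurable fun q : Fin K × (Fin K → ℝ) => q.2 q.1 - B.mean q.1 (n + 1) :=
        measurable_from_prod_countable_right fun a => by
          simpa only using (measurable_pi_apply a).sub_const _
      exact this.comp (((measurable_arm p n).comp measurable_fst).prodMk measurable_snd)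
    have hcm := (hc.measurable n).comp
      (measurable_fst : Measurable (Prod.fst : (ℕ → Fin K → ℝ) × (Fin K → ℝ) → _))
    have hF : Measurable F := by
      have hF₁ : Measurable fun q : (ℕ → Fin K → ℝ) × (Fin K → ℝ) => S q.1 :=
        hSm.comp measurable_fst
      have hF₂ : Measurable fun q : (ℕ → Fin K → ℝ) × (Fin K → ℝ) =>
          c n q.1 * (q.2 (arm p q.1 n) - B.mean (arm p q.1 n) (n + 1)) - c n q.1 ^ 2 / 8 :=
        (hcm.mul hval).sub ((hcm.pow_const 2).div_const 8)
      exact hF₁.exp.ennreal_ofReal.mul hF₂.exp.ennreal_ofReal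
    have htr : Measurable fun ω => trunc n (table X ω) :=
      (measurable_trunc n).comp (measurable_table hX)
    have h1 : ∀ ω, ENNReal.ofReal (Real.exp (∑ s ∈ Finset.range (n + 1),
        (c s (table X ω) * noise p (table X ω) B.mean s - c s (table X ω) ^ 2 / 8))) =
        F (trunc n (table X ω), X (n + 1) ω) := by
      intro ω
      simp only [F]
      rw [hSt, hc.eq_trunc le_rfl, arm_trunc p _ le_rfl, Finset.sum_range_succ,
        Real.exp_add, ENNReal.ofReal_mul (Real.exp_nonneg _)]
      rfl
    simp_rw [h1]
    -- The past and the new rewards have a product law. In the inner integral the past is frozen, so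
    -- arm and weight are constants and Hoeffding's lemma applies.
    have h2 := (indepFun_iff_map_prod_eq_prod_map_map htr.aemeasurable
      (hX.measurable (n + 1)).aemeasurable).1 (indepFun_trunc hX n)
    rw [← lintegral_map hF (htr.prodMk (hX.measurable (n + 1))), h2]
    have : IsProbabilityMeasure (P.map (X (n + 1))) :=
      Measure.isProbabilityMeasure_map (hX.measurable (n + 1)).aemeasurable
    rw [lintegral_prod _ hF.aemeasurable]
    calc ∫⁻ h, ∫⁻ v, F (h, v) ∂(P.map (X (n + 1))) ∂(P.map fun ω => trunc n (table X ω))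
        ≤ ∫⁻ h, ENNReal.ofReal (Real.exp (S h)) ∂(P.map fun ω => trunc n (table X ω)) := by
          refine lintegral_mono fun h => ?_
          have hm : Measurable fun v : Fin K → ℝ => ENNReal.ofReal (Real.exp
              (c n h * (v (arm p h n) - B.mean (arm p h n) (n + 1)) - c n h ^ 2 / 8)) := by
            refine (Real.measurable_exp.comp (Measurable.sub_const (Measurable.const_mul ?_ _) _)).ennreal_ofReal
            exact (measurable_pi_apply _).sub_const _
          simp only [F]
          rw [lintegral_const_mul _ hm, lintegral_map hm (hX.measurable (n + 1))]
          exact mul_le_of_le_one_right' (lintegral_exp_le_one hX _ _ _)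
      _ = ∫⁻ ω, ENNReal.ofReal (Real.exp (S (table X ω))) ∂P := by
          have hm : Measurable fun h => ENNReal.ofReal (Real.exp (S h)) :=
            (Real.measurable_exp.comp hSm).ennreal_ofReal
          rw [lintegral_map hm htr]
          simp_rw [hSt]

/-- Hoeffding's inequality for predictable weights. -/
theorem IsPredictable.measure_ge_le (hX : B.IsRewardSeq P X) (p : Params K)
    {c : ℕ → (ℕ → Fin K → ℝ) → ℝ} (hc : IsPredictable c) (n : ℕ) {V y : ℝ} (hV : 0 < V)
    (hcV : ∀ x, ∑ s ∈ Finset.range n, c s x ^ 2 ≤ V) (hy : 0 ≤ y) :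
    P.real {ω | y ≤ ∑ s ∈ Finset.range n, c s (table X ω) * noise p (table X ω) B.mean s} ≤
      Real.exp (-(2 * y ^ 2 / V)) := by
  -- The minimizer of the Chernoff exponent `l²V/8 - ly`; the minimum is `-2y²/V`.
  set l := 4 * y / V with hl
  have hl0 : 0 ≤ l := by positivity
  have h1 := (hc.const_mul l).lintegral_exp_sum_le hX p n
  set f : Ω → ENNReal := fun ω => ENNReal.ofReal (Real.exp (∑ s ∈ Finset.range n,
      (l * c s (table X ω) * noise p (table X ω) B.mean s - (l * c s (table X ω)) ^ 2 / 8))) with hf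
  have hfm : Measurable f := by
    have : Measurable fun x => ∑ s ∈ Finset.range n,
        (l * c s x * noise p x B.mean s - (l * c s x) ^ 2 / 8) :=
      Finset.measurable_sum _ fun s _ => (((hc.measurable s).const_mul l).mul
        (measurable_noise p B.mean s)).sub ((((hc.measurable s).const_mul l).pow_const 2).div_const 8)
    exact (Real.measurable_exp.comp (this.comp (measurable_table hX))).ennreal_ofReal
  have h2 := mul_meas_ge_le_lintegral₀ (μ := P) hfm.aemeasurable
    (ENNReal.ofReal (Real.exp (2 * y ^ 2 / V)))
  have hsub : {ω | y ≤ ∑ s ∈ Finset.range n, c s (table X ω) * noise p (table X ω) B.mean s} ⊆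
      {ω | ENNReal.ofReal (Real.exp (2 * y ^ 2 / V)) ≤ f ω} := by
    intro ω hω
    have hω' : y ≤ ∑ s ∈ Finset.range n, c s (table X ω) * noise p (table X ω) B.mean s := hω
    refine ENNReal.ofReal_le_ofReal (Real.exp_le_exp.2 ?_)
    have h3 : ∑ s ∈ Finset.range n,
        (l * c s (table X ω) * noise p (table X ω) B.mean s - (l * c s (table X ω)) ^ 2 / 8) =
        l * ∑ s ∈ Finset.range n, c s (table X ω) * noise p (table X ω) B.mean s -
          l ^ 2 / 8 * ∑ s ∈ Finset.range n, c s (table X ω) ^ 2 := by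
      rw [Finset.mul_sum, Finset.mul_sum, ← Finset.sum_sub_distrib]
      exact Finset.sum_congr rfl fun s _ => by ring
    rw [h3]
    have h4 := mul_le_mul_of_nonneg_left hω' hl0
    have h5 := mul_le_mul_of_nonneg_left (hcV (table X ω)) (by positivity : 0 ≤ l ^ 2 / 8)
    have h6 : l * y - l ^ 2 / 8 * V = 2 * y ^ 2 / V := by rw [hl]; field_simp; ring
    linarith
  have h7 : ENNReal.ofReal (Real.exp (2 * y ^ 2 / V)) *
      P {ω | y ≤ ∑ s ∈ Finset.range n, c s (table X ω) * noise p (table X ω) B.mean s} ≤ 1 :=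
    ((mul_le_mul_right (measure_mono hsub) _).trans h2).trans h1
  have h8 := ENNReal.toReal_mono ENNReal.one_ne_top h7
  rw [ENNReal.toReal_mul, ENNReal.toReal_ofReal (Real.exp_nonneg _), ENNReal.toReal_one] at h8
  rw [Real.exp_neg, ← one_div, le_div_iff₀ (Real.exp_pos _), mul_comm]
  exact h8

theorem IsPredictable.measure_le_neg_le (hX : B.IsRewardSeq P X) (p : Params K)
    {c : ℕ → (ℕ → Fin K → ℝ) → ℝ} (hc : IsPredictable c) (n : ℕ) {V y : ℝ} (hV : 0 < V)
    (hcV : ∀ x, ∑ s ∈ Finset.range n, c s x ^ 2 ≤ V) (hy : 0 ≤ y) :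
    P.real {ω | ∑ s ∈ Finset.range n, c s (table X ω) * noise p (table X ω) B.mean s ≤ -y} ≤
      Real.exp (-(2 * y ^ 2 / V)) := by
  have h := (hc.const_mul (-1)).measure_ge_le hX p n hV (fun x => by simpa using hcV x) hy
  convert h using 3
  ext ω
  simp only [neg_mul, one_mul, Finset.sum_neg_distrib]
  exact ⟨fun h => by linarith, fun h => by linarith⟩

theorem IsPredictable.measure_abs_le (hX : B.IsRewardSeq P X) (p : Params K)
    {c : ℕ → (ℕ → Fin K → ℝ) → ℝ} (hc : IsPredictable c) (n : ℕ) {V y : ℝ} (hV : 0 < V)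
    (hcV : ∀ x, ∑ s ∈ Finset.range n, c s x ^ 2 ≤ V) (hy : 0 ≤ y) :
    P.real {ω | ¬ |∑ s ∈ Finset.range n, c s (table X ω) * noise p (table X ω) B.mean s| ≤ y} ≤
      2 * Real.exp (-(2 * y ^ 2 / V)) := by
  have h1 := hc.measure_ge_le hX p n hV hcV hy
  have h2 := hc.measure_le_neg_le hX p n hV hcV hy
  refine (measureReal_mono (s₂ := {ω | y ≤ ∑ s ∈ Finset.range n,
    c s (table X ω) * noise p (table X ω) B.mean s} ∪ {ω | ∑ s ∈ Finset.range n,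
    c s (table X ω) * noise p (table X ω) B.mean s ≤ -y}) ?_).trans
    ((measureReal_union_le _ _).trans (by linarith))
  intro ω hω
  have hω' : ¬ |∑ s ∈ Finset.range n, c s (table X ω) * noise p (table X ω) B.mean s| ≤ y := hω
  rw [not_le, lt_abs] at hω'
  rcases hω' with h | h
  · exact Or.inl h.le
  · exact Or.inr (show _ ≤ -y by linarith)

end Concentration

/-! ## The expected regret -/

section ExpectedRegret

variable {K : ℕ} {B : Bandit K} {Ω : Type v} [MeasurableSpace Ω] {P : Measure Ω} {X : ℕ → Ω → Fin K → ℝ} {p : Params K} {T : ℕ}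

theorem measurable_mean_arm (hX : B.IsRewardSeq P X) (p : Params K) (s t : ℕ) :
    Measurable fun ω => B.mean (arm p (table X ω) s) t :=
  (Measurable.of_discrete (f := fun k => B.mean k t)).comp
    ((measurable_arm p s).comp (measurable_table hX))

theorem measurable_sampleNoise (hX : B.IsRewardSeq P X) (p : Params K) (T τ : ℕ) (k : Fin K)
    (n : ℕ) : Measurable fun ω => sampleNoise p (table X ω) B.mean T τ k n := by
  have : Measurable fun x : ℕ → Fin K → ℝ => sampleNoise p x B.mean T τ k n :=
    Finset.measurable_sum _ fun s _ => (measurable_weight p τ k _ s).mul (measurable_noise p _ s)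
  exact this.comp (measurable_table hX)

theorem measurableSet_quietWindows (hX : B.IsRewardSeq P X) (p : Params K) (T : ℕ) (y : ℝ) :
    MeasurableSet {ω | QuietWindows p (table X ω) B.mean T y} := by
  have : {ω | QuietWindows p (table X ω) B.mean T y} = ⋂ t₀, ⋂ (_ : t₀ < T),
      {ω | |∑ s ∈ Finset.range T, windowWeight p (table X ω) t₀ s *
        noise p (table X ω) B.mean s| ≤ y} := by
    ext ω; simp [QuietWindows]
  rw [this]
  refine MeasurableSet.iInter fun t₀ => MeasurableSet.iInter fun _ => ?_
  have hm : Measurable fun x : ℕ → Fin K → ℝ =>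
      ∑ s ∈ Finset.range T, windowWeight p x t₀ s * noise p x B.mean s :=
    Finset.measurable_sum _ fun s _ =>
      (measurable_windowWeight p t₀ s).mul (measurable_noise p _ s)
  exact measurableSet_le (continuous_abs.measurable.comp (hm.comp (measurable_table hX)))
    measurable_const

theorem measurableSet_quietSamples (hX : B.IsRewardSeq P X) (p : Params K) (T : ℕ) (c : ℝ) :
    MeasurableSet {ω | QuietSamples p (table X ω) B.mean T c} := by
  have : {ω | QuietSamples p (table X ω) B.mean T c} = ⋂ τ, ⋂ (_ : τ < T), ⋂ k, ⋂ n, ⋂ (_ : n ≤ T),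
      {ω | |sampleNoise p (table X ω) B.mean T τ k n| ≤ Real.sqrt (2 * n * c)} := by
    ext ω; simp [QuietSamples]
  rw [this]
  exact MeasurableSet.iInter fun τ => MeasurableSet.iInter fun _ => MeasurableSet.iInter fun k =>
    MeasurableSet.iInter fun n => MeasurableSet.iInter fun _ => measurableSet_le
      (continuous_abs.measurable.comp (measurable_sampleNoise hX p T τ k n)) measurable_const

theorem measurableSet_underestimates (hX : B.IsRewardSeq P X) (p : Params K) (T τ : ℕ)
    (k : Fin K) (r : ℕ) :
    MeasurableSet {ω | Underestimates p (table X ω) B.mean T τ k r} := by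
  have : {ω | Underestimates p (table X ω) B.mean T τ k r} = ⋃ n ∈ Finset.Icc 1 r,
      {ω | sampleNoise p (table X ω) B.mean T τ k n ≤ -Real.sqrt (2 * n * Real.log r)} := by
    ext ω; simp [Underestimates]
  rw [this]
  exact Finset.measurableSet_biUnion _ fun n _ =>
    measurableSet_le (measurable_sampleNoise hX p T τ k n) measurable_const

variable [IsProbabilityMeasure P]

theorem mean_mem_Icc (B : Bandit K) (k : Fin K) (t : ℕ) : B.mean k t ∈ Set.Icc (0 : ℝ) 1 := by
  have := B.prob k t
  have h1 : ∀ᵐ x ∂(B.f k t), x ∈ Set.Icc (0 : ℝ) 1 :=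
    (mem_ae_iff_prob_eq_one measurableSet_Icc).2 (B.supp k t)
  have hint : Integrable (fun x : ℝ => x) (B.f k t) := by
    refine Integrable.of_bound measurable_id.aestronglyMeasurable 1 ?_
    filter_upwards [h1] with x hx
    rw [Real.norm_eq_abs, abs_of_nonneg hx.1]
    exact hx.2
  constructor
  · refine integral_nonneg_of_ae ?_
    filter_upwards [h1] with x hx using hx.1
  · calc B.mean k t ≤ ∫ _, (1 : ℝ) ∂(B.f k t) := by
          refine integral_mono_ae hint (integrable_const _) ?_
          filter_upwards [h1] with x hx using hx.2
      _ = 1 := by simp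

theorem mean_sub_mean_le (B : Bandit K) (k j : Fin K) (t t' : ℕ) :
    B.mean k t - B.mean j t' ≤ 1 := by
  have h1 := (mean_mem_Icc B k t).2
  have h2 := (mean_mem_Icc B j t').1
  linarith

theorem integrable_reward_arm (hX : B.IsRewardSeq P X) (p : Params K) (s : ℕ) :
    Integrable (fun ω => X (s + 1) ω (arm p (table X ω) s)) P := by
  have hm : Measurable fun q : Fin K × (Fin K → ℝ) => q.2 q.1 :=
    measurable_from_prod_countable_right fun a => measurable_pi_apply a
  refine Integrable.of_bound (hm.comp (((measurable_arm p s).comp (measurable_table hX)).prodMk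
    (hX.measurable (s + 1)))).aestronglyMeasurable 1 ?_
  have : ∀ᵐ ω ∂P, ∀ k, X (s + 1) ω k ∈ Set.Icc (0 : ℝ) 1 :=
    ae_all_iff.2 fun k => reward_mem_Icc hX k (s + 1)
  filter_upwards [this] with ω hω
  rw [Real.norm_eq_abs, abs_of_nonneg (hω _).1]
  exact (hω _).2

theorem integrable_mean_arm (hX : B.IsRewardSeq P X) (p : Params K) (s t : ℕ) :
    Integrable (fun ω => B.mean (arm p (table X ω) s) t) P := by
  refine Integrable.of_bound (measurable_mean_arm hX p s t).aestronglyMeasurable 1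
    (Filter.Eventually.of_forall fun ω => ?_)
  rw [Real.norm_eq_abs, abs_of_nonneg (mean_mem_Icc B _ _).1]
  exact (mean_mem_Icc B _ _).2

/-- The arm is a function of the rewards up to round `s`, hence independent of those of round `s +
1`; the identity follows by summing over the possible arms. -/
theorem integral_reward_arm (hX : B.IsRewardSeq P X) (p : Params K) (s : ℕ) :
    ∫ ω, X (s + 1) ω (arm p (table X ω) s) ∂P =
      ∫ ω, B.mean (arm p (table X ω) s) (s + 1) ∂P := by
  classical
  let ind : Fin K → Ω → ℝ := fun k ω => if arm p (table X ω) s = k then 1 else 0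
  have hind : ∀ k, Measurable (ind k) := fun k =>
    (Measurable.of_discrete (f := fun a : Fin K => if a = k then (1 : ℝ) else 0)).comp
      ((measurable_arm p s).comp (measurable_table hX))
  have h1 : ∀ ω, X (s + 1) ω (arm p (table X ω) s) = ∑ k, (ind k * fun ω => X (s + 1) ω k) ω := by
    intro ω; simp [ind]
  have h2 : ∀ ω, B.mean (arm p (table X ω) s) (s + 1) = ∑ k, ind k ω * B.mean k (s + 1) := by
    intro ω; simp [ind]
  have hindI : ∀ k, Integrable (ind k) P := fun k => by
    refine Integrable.of_bound (hind k).aestronglyMeasurable 1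
      (Filter.Eventually.of_forall fun ω => ?_)
    simp only [ind]
    split_ifs <;> simp
  have hXI : ∀ k, Integrable (ind k * fun ω => X (s + 1) ω k) P := fun k => by
    refine Integrable.of_bound ((hind k).mul
      (measurable_reward hX k (s + 1))).aestronglyMeasurable 1 ?_
    filter_upwards [reward_mem_Icc hX k (s + 1)] with ω hω
    simp only [ind, Pi.mul_apply]
    split_ifs
    · rw [one_mul, Real.norm_eq_abs, abs_of_nonneg hω.1]; exact hω.2
    · simp
  simp_rw [h1, h2]
  rw [integral_finsetSum _ fun k _ => hXI k,
    integral_finsetSum _ fun k _ => (hindI k).mul_const _]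
  refine Finset.sum_congr rfl fun k _ => ?_
  have hφ : Measurable fun x : ℕ → Fin K → ℝ => if arm p x s = k then (1 : ℝ) else 0 :=
    (Measurable.of_discrete (f := fun a : Fin K => if a = k then (1 : ℝ) else 0)).comp
      (measurable_arm p s)
  have hind' : IndepFun (ind k) (fun ω => X (s + 1) ω k) P := by
    have h3 := (indepFun_trunc hX s).comp hφ (measurable_pi_apply k)
    have h4 : ind k = (fun x : ℕ → Fin K → ℝ => if arm p x s = k then (1 : ℝ) else 0) ∘
        fun ω => trunc s (table X ω) := by
      funext ω
      simp only [ind, Function.comp]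
      rw [arm_trunc p _ le_rfl]
    rw [h4]
    exact h3
  rw [hind'.integral_mul_eq_mul_integral (hind k).aestronglyMeasurable
    (measurable_reward hX k (s + 1)).aestronglyMeasurable, integral_reward hX, integral_mul_const]

/-- The regret as the expected sum of the gaps of the arms played. -/
theorem regret_eq (hX : B.IsRewardSeq P X) (p : Params K) (T : ℕ) {best : ℕ → Fin K}
    (hbest : ∀ k t, B.mean k t ≤ B.mean (best t) t) :
    regret B p P X T = ∫ ω, ∑ s ∈ Finset.range T,
      (B.mean (best (s + 1)) (s + 1) - B.mean (arm p (table X ω) s) (s + 1)) ∂P := by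
  have hsum : ∀ F : ℕ → ℝ, ∑ t ∈ Finset.Icc 1 T, F t = ∑ s ∈ Finset.range T, F (s + 1) := by
    intro F
    rw [Finset.range_eq_Ico, Finset.sum_Ico_add' F 0 T 1]
    refine Finset.sum_congr ?_ fun _ _ => rfl
    ext; simp only [Finset.mem_Icc, Finset.mem_Ico]; omega
  have hsup : ∀ t, ⨆ k, B.mean k t = B.mean (best t) t := fun t => by
    have : Nonempty (Fin K) := ⟨best t⟩
    exact le_antisymm (ciSup_le fun k => hbest k t)
      (le_ciSup (f := fun k => B.mean k t) (Set.finite_range _).bddAbove (best t))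
  unfold regret
  simp_rw [hsum, hsup]
  have harm : ∀ ω s, armPlayed p (fun r => X r ω) (s + 1) = arm p (table X ω) s := fun _ _ => rfl
  simp_rw [harm]
  have hgap : ∫ ω, ∑ s ∈ Finset.range T,
      (B.mean (best (s + 1)) (s + 1) - B.mean (arm p (table X ω) s) (s + 1)) ∂P =
      ∑ s ∈ Finset.range T, ∫ ω,
      (B.mean (best (s + 1)) (s + 1) - B.mean (arm p (table X ω) s) (s + 1)) ∂P :=
    integral_finsetSum _ fun s _ => (integrable_const _).sub (integrable_mean_arm hX p s _)
  rw [integral_finsetSum _ fun s _ => integrable_reward_arm hX p s, hgap,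
    ← Finset.sum_sub_distrib]
  refine Finset.sum_congr rfl fun s _ => ?_
  rw [integral_reward_arm hX, integral_sub (integrable_const _) (integrable_mean_arm hX p s _)]
  simp

theorem exists_best (hK : 1 ≤ K) (B : Bandit K) :
    ∃ best : ℕ → Fin K, ∀ k t, B.mean k t ≤ B.mean (best t) t := by
  have : Nonempty (Fin K) := ⟨⟨0, hK⟩⟩
  choose best hbest using fun t => Finite.exists_max fun k => B.mean k t
  exact ⟨best, fun k t => hbest t k⟩

theorem regret_le_horizon (hK : 1 ≤ K) (hX : B.IsRewardSeq P X) (p : Params K) (T : ℕ) :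
    regret B p P X T ≤ T := by
  obtain ⟨best, hbest⟩ := exists_best hK B
  rw [regret_eq hX p T hbest]
  calc _ ≤ ∫ _, (T : ℝ) ∂P := by
        refine integral_mono (integrable_finsetSum _ fun s _ =>
          (integrable_const _).sub (integrable_mean_arm hX p s _)) (integrable_const _) fun ω => ?_
        calc _ ≤ ∑ s ∈ Finset.range T, (1 : ℝ) :=
              Finset.sum_le_sum fun s _ => mean_sub_mean_le B _ _ _ _
          _ = T := by simp
    _ = T := by simp

/-- A single window fails with probability at most `2 / (2T²)`, and there are `T` starting rounds.
-/
theorem measure_not_quietWindows_le (hX : B.IsRewardSeq P X) (hw : p.w = 2 * (p.w / 2))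
    (hpos : 0 < p.w / 2) (hT : 1 ≤ T) {y : ℝ} (hy : 0 ≤ y)
    (hyw : Real.log (2 * T ^ 2) ≤ 2 * y ^ 2 / p.w) :
    P.real {ω | ¬ QuietWindows p (table X ω) B.mean T y} ≤ 1 / T := by
  have hT' : (0 : ℝ) < T := by exact_mod_cast hT
  have hw0 : (0 : ℝ) < p.w := by exact_mod_cast (by omega : 0 < p.w)
  have h1 : ∀ t₀, P.real {ω | ¬ |∑ s ∈ Finset.range T, windowWeight p (table X ω) t₀ s *
        noise p (table X ω) B.mean s| ≤ y} ≤ 1 / T ^ 2 := by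
    intro t₀
    have := (isPredictable_windowWeight p t₀).measure_abs_le hX p T hw0 (fun x => ?_) hy
    · refine this.trans ?_
      have h2 : Real.exp (-(2 * y ^ 2 / p.w)) ≤ Real.exp (-Real.log (2 * T ^ 2)) :=
        Real.exp_le_exp.2 (by linarith)
      rw [Real.exp_neg (Real.log _), Real.exp_log (by positivity)] at h2
      calc _ ≤ (2 : ℝ) * (2 * (T : ℝ) ^ 2)⁻¹ := by gcongr
        _ = 1 / (T : ℝ) ^ 2 := by field_simp
    · calc ∑ s ∈ Finset.range T, windowWeight p x t₀ s ^ 2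
          ≤ ∑ s ∈ Finset.range T, weight p x (run p x t₀).τ (arm p x t₀)
            (halves (p.w / 2) ((run p x t₀).n (arm p x t₀))) s ^ 2 := by
            refine Finset.sum_le_sum fun s _ => ?_
            unfold windowWeight
            split_ifs
            · exact le_rfl
            · simpa using sq_nonneg _
        _ ≤ (2 * (p.w / 2) : ℕ) := sum_weight_sq_le _ _ _ _ _ fun S _ => sum_halves_sq_le _ _ S
        _ = p.w := by rw [← hw]
  have hsub : {ω | ¬ QuietWindows p (table X ω) B.mean T y} ⊆ ⋃ t₀ ∈ Finset.range T,
      {ω | ¬ |∑ s ∈ Finset.range T, windowWeight p (table X ω) t₀ s *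
        noise p (table X ω) B.mean s| ≤ y} := by
    intro ω hω
    simpa [QuietWindows] using hω
  calc _ ≤ ∑ t₀ ∈ Finset.range T, P.real {ω | ¬ |∑ s ∈ Finset.range T,
        windowWeight p (table X ω) t₀ s * noise p (table X ω) B.mean s| ≤ y} :=
        (measureReal_mono hsub (measure_ne_top _ _)).trans (measureReal_biUnion_finset_le _ _)
    _ ≤ ∑ t₀ ∈ Finset.range T, 1 / (T : ℝ) ^ 2 := Finset.sum_le_sum fun t₀ _ => h1 t₀
    _ = 1 / T := by
      rw [Finset.sum_const, Finset.card_range, nsmul_eq_mul]; field_simp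

theorem sum_weight_upto_sq_le (x : ℕ → Fin K → ℝ) (τ : ℕ) (k : Fin K) (n : ℕ) :
    ∑ s ∈ Finset.range T, weight p x τ k (upto n) s ^ 2 ≤ n :=
  sum_weight_sq_le _ _ _ _ _ fun S hS => sum_upto_sq_le n S hS

theorem two_mul_sq_sqrt_div {n : ℕ} (hn : 1 ≤ n) {c : ℝ} (hc : 0 ≤ c) :
    2 * Real.sqrt (2 * n * c) ^ 2 / n = 4 * c := by
  have : (0 : ℝ) < n := by exact_mod_cast hn
  rw [Real.sq_sqrt (by positivity)]
  field_simp
  ring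

theorem exp_neg_four_mul_log {z : ℝ} (hz : 0 < z) : Real.exp (-(4 * Real.log z)) = (z ^ 4)⁻¹ := by
  rw [Real.exp_neg, show 4 * Real.log z = Real.log (z ^ 4) by rw [Real.log_pow]; norm_num,
    Real.exp_log (by positivity)]

theorem measure_not_quietSamples_le (hX : B.IsRewardSeq P X) (hK : 1 ≤ K) (hT : 2 ≤ T) :
    P.real {ω | ¬ QuietSamples p (table X ω) B.mean T (Real.log (K * T))} ≤ 1 / T := by
  classical
  have hK' : (1 : ℝ) ≤ K := by exact_mod_cast hK
  have hT' : (2 : ℝ) ≤ T := by exact_mod_cast hT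
  have hKT : (1 : ℝ) ≤ K * T := by nlinarith
  have hc : 0 ≤ Real.log (K * T) := Real.log_nonneg hKT
  have h1 : ∀ q ∈ Finset.range T ×ˢ (Finset.univ : Finset (Fin K)) ×ˢ Finset.Icc 1 T,
      P.real {ω | ¬ |sampleNoise p (table X ω) B.mean T q.1 q.2.1 q.2.2| ≤
        Real.sqrt (2 * q.2.2 * Real.log (K * T))} ≤ 2 * ((K * T : ℝ) ^ 4)⁻¹ := by
    rintro ⟨τ, k, n⟩ hq
    simp only [Finset.mem_product, Finset.mem_Icc] at hq
    have hn : 1 ≤ n := hq.2.2.1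
    have := (isPredictable_weight p τ k (upto n)).measure_abs_le hX p T
      (V := n) (by exact_mod_cast hn) (fun x => sum_weight_upto_sq_le x τ k n)
      (Real.sqrt_nonneg (2 * n * Real.log (K * T)))
    rw [two_mul_sq_sqrt_div hn hc, exp_neg_four_mul_log (by linarith)] at this
    exact this
  have hsub : {ω | ¬ QuietSamples p (table X ω) B.mean T (Real.log (K * T))} ⊆
      ⋃ q ∈ Finset.range T ×ˢ (Finset.univ : Finset (Fin K)) ×ˢ Finset.Icc 1 T,
      {ω | ¬ |sampleNoise p (table X ω) B.mean T q.1 q.2.1 q.2.2| ≤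
        Real.sqrt (2 * q.2.2 * Real.log (K * T))} := by
    intro ω hω
    have hω' : ¬ QuietSamples p (table X ω) B.mean T (Real.log (K * T)) := hω
    unfold QuietSamples at hω'
    push Not at hω'
    obtain ⟨τ, hτ, k, n, hn, h⟩ := hω'
    -- The case `n = 0` is excluded from the union bound, where Hoeffding needs a positive variance
    -- proxy; its noise is zero anyway.
    have hn1 : 1 ≤ n := by
      by_contra h0
      have h0' : n = 0 := by omega
      subst h0'
      have : sampleNoise p (table X ω) B.mean T τ k 0 = 0 := by
        refine Finset.sum_eq_zero fun s _ => ?_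
        have : weight p (table X ω) τ k (upto 0) s = 0 := by
          unfold weight upto; simp
        rw [this, zero_mul]
      rw [this, abs_zero] at h
      exact absurd h (not_lt.2 (Real.sqrt_nonneg _))
    refine Set.mem_iUnion₂.2 ⟨(τ, k, n), ?_, not_le.2 h⟩
    simp only [Finset.mem_product, Finset.mem_Icc, Finset.mem_range, Finset.mem_univ, true_and]
    exact ⟨hτ, hn1, hn⟩
  calc _ ≤ ∑ q ∈ Finset.range T ×ˢ (Finset.univ : Finset (Fin K)) ×ˢ Finset.Icc 1 T,
        P.real {ω | ¬ |sampleNoise p (table X ω) B.mean T q.1 q.2.1 q.2.2| ≤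
        Real.sqrt (2 * q.2.2 * Real.log (K * T))} :=
        (measureReal_mono hsub (measure_ne_top _ _)).trans (measureReal_biUnion_finset_le _ _)
    _ ≤ _ := Finset.sum_le_sum h1
    _ = T * (K * T) * (2 * ((K * T : ℝ) ^ 4)⁻¹) := by
      rw [Finset.sum_const, nsmul_eq_mul]
      simp
    _ ≤ 1 / T := by
      have hpos : (0 : ℝ) < K * T := by linarith
      rw [show (T : ℝ) * (K * T) * (2 * ((K * T : ℝ) ^ 4)⁻¹) = 2 * T / (K * T) ^ 3 by
        field_simp]
      rw [div_le_div_iff₀ (by positivity) (by linarith)]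
      have h3 : (T : ℝ) ≤ K * T := by nlinarith
      calc 2 * (T : ℝ) * T ≤ T * T * T := by nlinarith
        _ = (T : ℝ) ^ 3 := by ring
        _ ≤ 1 * (K * T : ℝ) ^ 3 := by rw [one_mul]; gcongr

/-- Each sample size fails with probability at most `r⁻⁴`, and at most `r` sizes are possible. The
resulting `r⁻³` is summable over the rounds after an alarm. -/
theorem measure_underestimates_le (hX : B.IsRewardSeq P X) (τ : ℕ) (k : Fin K) {r : ℕ}
    (hr : 2 ≤ r) :
    P.real {ω | Underestimates p (table X ω) B.mean T τ k r} ≤ r * ((r : ℝ) ^ 4)⁻¹ := by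
  have hr' : (2 : ℝ) ≤ r := by exact_mod_cast hr
  have hc : 0 ≤ Real.log r := Real.log_nonneg (by linarith)
  have h1 : ∀ n ∈ Finset.Icc 1 r, P.real {ω | sampleNoise p (table X ω) B.mean T τ k n ≤
      -Real.sqrt (2 * n * Real.log r)} ≤ ((r : ℝ) ^ 4)⁻¹ := by
    intro n hn
    have hn : 1 ≤ n := (Finset.mem_Icc.1 hn).1
    have := (isPredictable_weight p τ k (upto n)).measure_le_neg_le hX p T
      (V := n) (by exact_mod_cast hn) (fun x => sum_weight_upto_sq_le x τ k n)
      (Real.sqrt_nonneg (2 * n * Real.log r))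
    rw [two_mul_sq_sqrt_div hn hc, exp_neg_four_mul_log (by linarith)] at this
    exact this
  have hsub : {ω | Underestimates p (table X ω) B.mean T τ k r} ⊆ ⋃ n ∈ Finset.Icc 1 r,
      {ω | sampleNoise p (table X ω) B.mean T τ k n ≤ -Real.sqrt (2 * n * Real.log r)} := by
    rintro ω ⟨n, hn, h⟩
    exact Set.mem_iUnion₂.2 ⟨n, hn, h⟩
  calc _ ≤ ∑ n ∈ Finset.Icc 1 r, P.real {ω | sampleNoise p (table X ω) B.mean T τ k n ≤
      -Real.sqrt (2 * n * Real.log r)} :=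
        (measureReal_mono hsub (measure_ne_top _ _)).trans (measureReal_biUnion_finset_le _ _)
    _ ≤ _ := Finset.sum_le_sum h1
    _ = _ := by rw [Finset.sum_const, nsmul_eq_mul]; simp

theorem sum_inv_cube_le {r₀ : ℕ} (hr : 1 ≤ r₀) (T : ℕ) :
    ∑ r ∈ Finset.Ioc r₀ T, (r : ℝ) * ((r : ℝ) ^ 4)⁻¹ ≤ 1 / (r₀ : ℝ) ^ 2 := by
  have hr' : (0 : ℝ) < r₀ := by exact_mod_cast hr
  rcases le_total r₀ T with h | h
  · calc ∑ r ∈ Finset.Ioc r₀ T, (r : ℝ) * ((r : ℝ) ^ 4)⁻¹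
        ≤ ∑ r ∈ Finset.Ioc r₀ T, (r₀ : ℝ)⁻¹ * ((r : ℝ) ^ 2)⁻¹ := by
          refine Finset.sum_le_sum fun r hr1 => ?_
          have h1 : (r₀ : ℝ) ≤ r := by exact_mod_cast (Finset.mem_Ioc.1 hr1).1.le
          have h2 : (0 : ℝ) < r := by linarith
          rw [show (r : ℝ) * ((r : ℝ) ^ 4)⁻¹ = (r : ℝ)⁻¹ * ((r : ℝ) ^ 2)⁻¹ by field_simp]
          gcongr
      _ = (r₀ : ℝ)⁻¹ * ∑ r ∈ Finset.Ioc r₀ T, ((r : ℝ) ^ 2)⁻¹ := by rw [Finset.mul_sum]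
      _ ≤ (r₀ : ℝ)⁻¹ * (r₀ : ℝ)⁻¹ := by
          have h1 := sum_Ioc_inv_sq_le_sub (α := ℝ) (k := r₀) (n := T) (by omega) h
          have h2 : (0 : ℝ) ≤ (T : ℝ)⁻¹ := by positivity
          gcongr
          linarith
      _ = _ := by field_simp
  · rw [Finset.Ioc_eq_empty (by omega)]
    simp

/-- The regret of all segments on a reward table with small noise. -/
def regretBudget (B : Bandit K) (p : Params K) (T : ℕ) (c : ℝ) (r₀ : ℕ) : ℝ :=
  ∑ i ∈ Finset.range (B.numSegments T), ((B.delayAt p T i : ℝ) +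
    (2 * p.α * Real.sqrt (B.segLength T (i + 1)) + Real.sqrt (K * B.segLength T (i + 1)) + r₀ +
    3 * (Real.sqrt (2 * c) + Real.sqrt (2 * Real.log T)) *
      Real.sqrt (K * B.segLength T (i + 1))))

/-- The two noise events have probability at most `1/T` and cost at most `T`, hence the summand 2.
Underestimation costs at most `1/r₀²` for each of the `T` candidate alarm times. -/
theorem DetectionRegime.regret_le {δ y : ℝ} (hr : DetectionRegime B p T δ y)
    (hX : B.IsRewardSeq P X) (hT : 2 ≤ T) (hK : 1 ≤ K) (hα : 0 < p.α)
    (hsel : ∀ S : Finset (Fin K), S.Nonempty → p.sel S ∈ S) (hgap : B.GapAtLeast T δ)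
    (hy : 0 ≤ y) (hyw : Real.log (2 * T ^ 2) ≤ 2 * y ^ 2 / p.w) {r₀ : ℕ} (hr₀ : 1 ≤ r₀) :
    regret B p P X T ≤ regretBudget B p T (Real.log (K * T)) r₀ + 2 + T / (r₀ : ℝ) ^ 2 := by
  classical
  have hK' : (1 : ℝ) ≤ K := by exact_mod_cast hK
  have hT' : (2 : ℝ) ≤ T := by exact_mod_cast hT
  have hc : 0 ≤ Real.log (K * T) := Real.log_nonneg (by nlinarith)
  obtain ⟨best, hbest⟩ := exists_best hK B
  rw [regret_eq hX p T hbest]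
  set D := regretBudget B p T (Real.log (K * T)) r₀ with hD
  have hD0 : 0 ≤ D := Finset.sum_nonneg fun i _ => by positivity
  set E₁ := {ω | ¬ QuietWindows p (table X ω) B.mean T y} with hE₁
  set E₂ := {ω | ¬ QuietSamples p (table X ω) B.mean T (Real.log (K * T))} with hE₂
  set U : ℕ → ℕ → Set Ω := fun τ r =>
    {ω | Underestimates p (table X ω) B.mean T τ (best (τ + r)) r} with hU
  have hE₁m : MeasurableSet E₁ := (measurableSet_quietWindows hX p T y).compl
  have hE₂m : MeasurableSet E₂ := (measurableSet_quietSamples hX p T _).compl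
  have hUm : ∀ τ r, MeasurableSet (U τ r) := fun τ r => measurableSet_underestimates hX p T τ _ r
  have hind : ∀ {E : Set Ω}, MeasurableSet E → ∀ a : ℝ, Integrable (E.indicator fun _ => a) P :=
    fun hE a => (integrable_const a).indicator hE
  have hUi : Integrable (fun ω => ∑ τ ∈ Finset.range T, ∑ r ∈ Finset.Ioc r₀ T,
      (U τ r).indicator (fun _ => (1 : ℝ)) ω) P :=
    integrable_finsetSum _ fun τ _ => integrable_finsetSum _ fun r _ => hind (hUm τ r) 1
  have hpt : ∀ ω, ∑ s ∈ Finset.range T,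
      (B.mean (best (s + 1)) (s + 1) - B.mean (arm p (table X ω) s) (s + 1)) ≤
      D + E₁.indicator (fun _ => (T : ℝ)) ω + E₂.indicator (fun _ => (T : ℝ)) ω +
        ∑ τ ∈ Finset.range T, ∑ r ∈ Finset.Ioc r₀ T, (U τ r).indicator (fun _ => (1 : ℝ)) ω := by
    intro ω
    have hS0 : 0 ≤ ∑ τ ∈ Finset.range T, ∑ r ∈ Finset.Ioc r₀ T,
        (U τ r).indicator (fun _ => (1 : ℝ)) ω :=
      Finset.sum_nonneg fun τ _ => Finset.sum_nonneg fun r _ =>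
        Set.indicator_nonneg (fun _ _ => zero_le_one) ω
    have hI₁ : 0 ≤ E₁.indicator (fun _ => (T : ℝ)) ω :=
      Set.indicator_nonneg (fun _ _ => Nat.cast_nonneg _) ω
    have hI₂ : 0 ≤ E₂.indicator (fun _ => (T : ℝ)) ω :=
      Set.indicator_nonneg (fun _ _ => Nat.cast_nonneg _) ω
    have htriv : ∑ s ∈ Finset.range T,
        (B.mean (best (s + 1)) (s + 1) - B.mean (arm p (table X ω) s) (s + 1)) ≤ T := by
      calc _ ≤ ∑ s ∈ Finset.range T, (1 : ℝ) :=
            Finset.sum_le_sum fun s _ => mean_sub_mean_le B _ _ _ _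
        _ = T := by simp
    by_cases h₁ : QuietWindows p (table X ω) B.mean T y
    · by_cases h₂ : QuietSamples p (table X ω) B.mean T (Real.log (K * T))
      · have := hr.sum_gap_le hT hK hα hsel hgap h₁ hc h₂
          (fun k j t t' => mean_sub_mean_le B k j t t') best r₀
        have hconv : ∀ τ r, Set.indicator
            {r | Underestimates p (table X ω) B.mean T τ (best (τ + r)) r} (fun _ => (1 : ℝ)) r =
            (U τ r).indicator (fun _ => (1 : ℝ)) ω := by
          intro τ r
          simp only [Set.indicator_apply, hU]
          rfl
        simp_rw [hconv] at this
        refine this.trans ?_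
        change D + _ ≤ _
        linarith
      · have : E₂.indicator (fun _ => (T : ℝ)) ω = T := Set.indicator_of_mem h₂ _
        linarith
    · have : E₁.indicator (fun _ => (T : ℝ)) ω = T := Set.indicator_of_mem h₁ _
      linarith
  have hint := integral_mono (μ := P) (integrable_finsetSum _ fun s _ =>
    (integrable_const _).sub (integrable_mean_arm hX p s _))
    ((((integrable_const D).add (hind hE₁m T)).add (hind hE₂m T)).add hUi) hpt
  refine hint.trans ?_
  rw [integral_add' (((integrable_const D).add (hind hE₁m T)).add (hind hE₂m T)) hUi,
    integral_add' ((integrable_const D).add (hind hE₁m T)) (hind hE₂m T),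
    integral_add' (integrable_const D) (hind hE₁m T),
    integral_indicator_const _ hE₁m, integral_indicator_const _ hE₂m,
    integral_finsetSum _ fun τ _ => integrable_finsetSum _ fun r _ => hind (hUm τ r) 1]
  have h₁ := measure_not_quietWindows_le hX hr.two_dvd hr.pos (by omega : 1 ≤ T) hy hyw
  have h₂ := measure_not_quietSamples_le (p := p) hX hK hT
  have hTpos : (0 : ℝ) < T := by linarith
  rw [← hE₁, le_div_iff₀ hTpos] at h₁
  rw [← hE₂, le_div_iff₀ hTpos] at h₂
  have h₃ : ∀ τ ∈ Finset.range T, ∫ ω, ∑ r ∈ Finset.Ioc r₀ T,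
      (U τ r).indicator (fun _ => (1 : ℝ)) ω ∂P ≤ 1 / (r₀ : ℝ) ^ 2 := by
    intro τ _
    rw [integral_finsetSum _ fun r _ => hind (hUm τ r) 1]
    refine le_trans (Finset.sum_le_sum fun r hr' => ?_) (sum_inv_cube_le hr₀ T)
    rw [integral_indicator_const _ (hUm τ r), smul_eq_mul, mul_one]
    have := (Finset.mem_Ioc.1 hr').1
    exact measure_underestimates_le hX τ _ (by omega)
  have h₄ := Finset.sum_le_sum h₃
  rw [Finset.sum_const, Finset.card_range, nsmul_eq_mul, mul_one_div] at h₄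
  simp only [smul_eq_mul, integral_const, probReal_univ, one_mul]
  linarith

end ExpectedRegret

/-! ## The tuning -/

section Tuning

variable {K T : ℕ} {p : Params K} {δ c₁ c₂ : ℝ}

/-- The scale `√(K log (KT))` of the exploration parameter. -/
def rate (K T : ℕ) : ℝ := Real.sqrt (K * Real.log (K * T))

theorem half_le_log {z : ℝ} (hz : 2 ≤ z) : 1 / 2 ≤ Real.log z := by
  have h1 : Real.log 2 ≤ Real.log z := Real.log_le_log (by norm_num) hz
  have h2 := Real.log_two_gt_d9
  linarith

theorem two_le_mul (hK : 1 ≤ K) (hT : 2 ≤ T) : (2 : ℝ) ≤ K * T := by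
  exact_mod_cast (by nlinarith : 2 ≤ K * T)

theorem half_le_log_mul (hK : 1 ≤ K) (hT : 2 ≤ T) : 1 / 2 ≤ Real.log (K * T) :=
  half_le_log (two_le_mul hK hT)

theorem rate_sq (hK : 1 ≤ K) (hT : 2 ≤ T) : rate K T ^ 2 = K * Real.log (K * T) := by
  have := half_le_log_mul hK hT
  exact Real.sq_sqrt (by positivity)

theorem le_two_mul_rate_sq (hK : 1 ≤ K) (hT : 2 ≤ T) : (K : ℝ) ≤ 2 * rate K T ^ 2 := by
  have h1 := half_le_log_mul hK hT
  have h2 : (1 : ℝ) ≤ K := by exact_mod_cast hK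
  rw [rate_sq hK hT]
  nlinarith

theorem log_le_rate_sq (hK : 1 ≤ K) (hT : 2 ≤ T) : Real.log (K * T) ≤ rate K T ^ 2 := by
  have h1 := half_le_log_mul hK hT
  have h2 : (1 : ℝ) ≤ K := by exact_mod_cast hK
  rw [rate_sq hK hT]
  nlinarith

theorem half_le_rate (hK : 1 ≤ K) (hT : 2 ≤ T) : 1 / 2 ≤ rate K T := by
  refine Real.le_sqrt_of_sq_le ?_
  have h1 := half_le_log_mul hK hT
  have h2 : (1 : ℝ) ≤ K := by exact_mod_cast hK
  nlinarith

/-- The constant in `w ≤ windowConst δ * log (KT)`. -/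
def windowConst (δ : ℝ) : ℝ := 40 / δ ^ 2 + 4

/-- The constant in the bound `delayConst δ c₁ * √(K log (KT)) * √s` on the detection delay. -/
def delayConst (δ c₁ : ℝ) : ℝ := windowConst δ / 2 * (6 / c₁ + 2 / c₁ ^ 2 + 4)

/-- The constant in the bound `startConst c₁ c₂ * (K log (KT))` on the length of the initial
phase. -/
def startConst (c₁ c₂ : ℝ) : ℝ := c₂ ^ 2 + 1 / (4 * c₁ ^ 2) + 2

/-- The segment-length constant that guarantees detection. -/
def segConst (δ c₁ c₂ : ℝ) : ℝ :=
  1 + 16 * delayConst δ c₁ ^ 2 + 2 * delayConst δ c₁ + 4 * startConst c₁ c₂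

theorem windowSize_eq (K T : ℕ) (δ : ℝ) : windowSize K T δ = 2 * (windowSize K T δ / 2) := by
  unfold windowSize; omega

theorem le_windowSize (K T : ℕ) (δ : ℝ) :
    4 / δ ^ 2 * (Real.sqrt (Real.log (2 * K * T ^ 2)) + Real.sqrt (Real.log (2 * T))) ^ 2 ≤
      windowSize K T δ := by
  unfold windowSize
  have := Nat.le_ceil ((4 / δ ^ 2 *
    (Real.sqrt (Real.log (2 * K * T ^ 2)) + Real.sqrt (Real.log (2 * T))) ^ 2) / 2)
  push_cast
  linarith

theorem log_two_mul_pos (hT : 2 ≤ T) : 0 < Real.log (2 * T) :=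
  Real.log_pos (by have : (2 : ℝ) ≤ T := by exact_mod_cast hT
                   linarith)

theorem windowSize_half_pos (hδ : 0 < δ) (hT : 2 ≤ T) : 0 < windowSize K T δ / 2 := by
  unfold windowSize
  rw [Nat.mul_div_cancel_left _ (by norm_num)]
  refine Nat.ceil_pos.2 ?_
  have := Real.sqrt_pos.2 (log_two_mul_pos hT)
  positivity

/-- The two logarithms are at most 3 and 2 times `log(KT)`, so the squared sum of roots is at most
`10 log(KT)`. Rounding adds at most `2 ≤ 4 log(KT)`. -/
theorem windowSize_le (hδ : 0 < δ) (hK : 1 ≤ K) (hT : 2 ≤ T) :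
    (windowSize K T δ : ℝ) ≤ windowConst δ * Real.log (K * T) := by
  have hK' : (1 : ℝ) ≤ K := by exact_mod_cast hK
  have hT' : (2 : ℝ) ≤ T := by exact_mod_cast hT
  have hKT := two_le_mul hK hT
  have hl := half_le_log_mul hK hT
  set A := Real.log (2 * K * T ^ 2) with hA
  set D := Real.log (2 * T) with hD
  have hD0 : 0 ≤ D := (log_two_mul_pos hT).le
  have hA0 : 0 ≤ A := Real.log_nonneg (by nlinarith)
  have hA3 : A ≤ 3 * Real.log (K * T) := by
    rw [show 3 * Real.log (K * T) = Real.log ((K * T : ℝ) ^ 3) by rw [Real.log_pow]; norm_num]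
    refine Real.log_le_log (by positivity) ?_
    have h1 : (K : ℝ) ≤ K ^ 3 := le_self_pow₀ hK' (by norm_num)
    calc 2 * (K : ℝ) * (T : ℝ) ^ 2 ≤ T * K * (T : ℝ) ^ 2 := by gcongr
      _ = (K : ℝ) * (T : ℝ) ^ 3 := by ring
      _ ≤ (K : ℝ) ^ 3 * (T : ℝ) ^ 3 := by gcongr
      _ = _ := by ring
  have hD2 : D ≤ 2 * Real.log (K * T) := by
    rw [show 2 * Real.log (K * T) = Real.log ((K * T : ℝ) ^ 2) by rw [Real.log_pow]; norm_num]
    refine Real.log_le_log (by positivity) ?_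
    have h1 : (1 : ℝ) ≤ K ^ 2 := one_le_pow₀ hK'
    calc 2 * (T : ℝ) ≤ T * T := by gcongr
      _ = 1 * (T : ℝ) ^ 2 := by ring
      _ ≤ (K : ℝ) ^ 2 * (T : ℝ) ^ 2 := by gcongr
      _ = _ := by ring
  have hsq : (Real.sqrt A + Real.sqrt D) ^ 2 ≤ 10 * Real.log (K * T) := by
    have h1 := Real.sq_sqrt hA0
    have h2 := Real.sq_sqrt hD0
    nlinarith [sq_nonneg (Real.sqrt A - Real.sqrt D)]
  have hx0 : 0 ≤ (4 / δ ^ 2 * (Real.sqrt A + Real.sqrt D) ^ 2) / 2 := by positivity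
  have hceil := (Nat.ceil_lt_add_one hx0).le
  have hx : 4 / δ ^ 2 * (Real.sqrt A + Real.sqrt D) ^ 2 ≤ 4 / δ ^ 2 * (10 * Real.log (K * T)) := by
    gcongr
  unfold windowSize windowConst
  rw [Nat.cast_mul]
  push_cast
  have : 4 / δ ^ 2 * (10 * Real.log (K * T)) = 40 / δ ^ 2 * Real.log (K * T) := by ring
  linarith

theorem windowConst_pos (δ : ℝ) : 0 < windowConst δ := by unfold windowConst; positivity

theorem delayConst_pos (hc₁ : 0 < c₁) : 0 < delayConst δ c₁ := by
  have := windowConst_pos δ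
  unfold delayConst; positivity

/-- The noise level at which the detector works. -/
def noiseLevel (T w : ℕ) : ℝ := Real.sqrt (w * (Real.log (2 * T ^ 2) / 2))

/-- For `threshold` this rests on `2T² ≤ (KT²)²`, valid since `T ≥ 2`; for `threshold'` on `2T² ≤
2KT²`. -/
theorem Params.Tuned.noiseLevel_le (ht : p.Tuned T δ c₁ c₂) (hK : 1 ≤ K) (hT : 2 ≤ T) :
    noiseLevel T p.w ≤ p.b := by
  have hK' : (1 : ℝ) ≤ K := by exact_mod_cast hK
  have hT' : (2 : ℝ) ≤ T := by exact_mod_cast hT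
  rcases ht.b_eq with h | h
  · rw [h, noiseLevel, threshold]
    apply Real.sqrt_le_sqrt
    gcongr
    have h1 : Real.log (2 * (T : ℝ) ^ 2) ≤ Real.log ((2 * K * T ^ 2 / 2 : ℝ) ^ 2) := by
      refine Real.log_le_log (by positivity) ?_
      have h2 : (4 : ℝ) ≤ T ^ 2 := by nlinarith
      have h3 : (1 : ℝ) ≤ K ^ 2 := one_le_pow₀ hK'
      calc 2 * (T : ℝ) ^ 2 ≤ 1 * ((T : ℝ) ^ 2 * (T : ℝ) ^ 2) := by nlinarith
        _ ≤ (K : ℝ) ^ 2 * ((T : ℝ) ^ 2 * (T : ℝ) ^ 2) := by gcongr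
        _ = _ := by ring
    rw [Real.log_pow] at h1
    push_cast at h1
    linarith
  · rw [h, noiseLevel, threshold', mul_div_assoc]
    apply Real.sqrt_le_sqrt
    gcongr
    nlinarith

/-- The window size is made for this: `√w` is at least `(2/δ)(√log(2KT²) + √log(2T))`, and `b` and
the noise level are bounded by `√w` times the respective root. -/
theorem Params.Tuned.add_noiseLevel_lt (ht : p.Tuned T δ c₁ c₂) (hδ : 0 < δ) (hK : 1 ≤ K)
    (hT : 2 ≤ T) : p.b + noiseLevel T p.w < (p.w / 2 : ℕ) * δ := by
  have hK' : (1 : ℝ) ≤ K := by exact_mod_cast hK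
  have hT' : (2 : ℝ) ≤ T := by exact_mod_cast hT
  have hw := le_windowSize K T δ
  have hw2 := windowSize_eq K T δ
  have hpos := windowSize_half_pos (K := K) hδ hT
  rw [← ht.w_eq] at hw hw2 hpos
  set A := Real.log (2 * K * T ^ 2) with hA
  set D := Real.log (2 * T) with hD
  have hD0 : 0 < D := log_two_mul_pos hT
  have hA0 : 0 < A := Real.log_pos (by nlinarith)
  have hwpos : (0 : ℝ) < p.w := by exact_mod_cast (by omega : 0 < p.w)
  have hb : p.b < Real.sqrt (p.w * A) := by
    rcases ht.b_eq with h | h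
    · rw [h, threshold]
      refine Real.sqrt_lt_sqrt (mul_nonneg hwpos.le (Real.log_nonneg (by nlinarith))) ?_
      refine mul_lt_mul_of_pos_left (Real.log_lt_log (by positivity) ?_) hwpos
      exact half_lt_self (by positivity)
    · rw [h, threshold']
      refine Real.sqrt_lt_sqrt (by positivity) ?_
      exact half_lt_self (by positivity)
  have hy : noiseLevel T p.w ≤ Real.sqrt (p.w * D) := by
    rw [noiseLevel]
    apply Real.sqrt_le_sqrt
    gcongr
    have h1 : Real.log (2 * (T : ℝ) ^ 2) ≤ Real.log ((2 * T : ℝ) ^ 2) :=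
      Real.log_le_log (by positivity) (by nlinarith)
    rw [Real.log_pow] at h1
    push_cast at h1
    linarith
  have hsum : Real.sqrt (p.w * A) + Real.sqrt (p.w * D) ≤ p.w * δ / 2 := by
    rw [Real.sqrt_mul hwpos.le, Real.sqrt_mul hwpos.le]
    have h1 : 2 / δ * (Real.sqrt A + Real.sqrt D) ≤ Real.sqrt p.w := by
      refine Real.le_sqrt_of_sq_le (le_trans (le_of_eq ?_) hw)
      ring
    have h2 := mul_le_mul_of_nonneg_left h1 (Real.sqrt_nonneg p.w)
    rw [Real.mul_self_sqrt hwpos.le] at h2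
    have h3 := mul_le_mul_of_nonneg_right h2 (by linarith : 0 ≤ δ / 2)
    have h4 : Real.sqrt p.w * (2 / δ * (Real.sqrt A + Real.sqrt D)) * (δ / 2) =
        Real.sqrt p.w * Real.sqrt A + Real.sqrt p.w * Real.sqrt D := by
      field_simp
    rw [h4] at h3
    linarith
  have hhalf : ((p.w / 2 : ℕ) : ℝ) * δ = p.w * δ / 2 := by
    have : (p.w : ℝ) = 2 * (p.w / 2 : ℕ) := by exact_mod_cast hw2
    rw [this]; ring
  rw [hhalf]
  linarith

theorem log_le_noiseLevel {w : ℕ} (hw : 0 < w) (hT : 2 ≤ T) :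
    Real.log (2 * T ^ 2) ≤ 2 * noiseLevel T w ^ 2 / w := by
  have hT' : (2 : ℝ) ≤ T := by exact_mod_cast hT
  have hw' : (0 : ℝ) < w := by exact_mod_cast hw
  have := Real.log_nonneg (by nlinarith : (1 : ℝ) ≤ 2 * T ^ 2)
  rw [noiseLevel, Real.sq_sqrt (by positivity)]
  refine le_of_eq ?_
  field_simp

theorem Params.Tuned.alpha_pos (ht : p.Tuned T δ c₁ c₂) (hc₁ : 0 < c₁) (hK : 1 ≤ K) (hT : 2 ≤ T) :
    0 < p.α := by
  have h1 := half_le_rate hK hT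
  have h2 : c₁ * rate K T ≤ p.α := ht.α_lower
  have : 0 < c₁ * rate K T := by positivity
  linarith

theorem Params.Tuned.div_alpha_mul_log_le (ht : p.Tuned T δ c₁ c₂) (hc₁ : 0 < c₁) (hK : 1 ≤ K)
    (hT : 2 ≤ T) : K / p.α * Real.log (K * T) ≤ rate K T / c₁ := by
  have h1 := half_le_rate hK hT
  have h2 : c₁ * rate K T ≤ p.α := ht.α_lower
  have h3 := half_le_log_mul hK hT
  have h4 := rate_sq hK hT
  have h5 := ht.alpha_pos hc₁ hK hT
  rw [div_mul_eq_mul_div, ← h4, div_le_div_iff₀ h5 hc₁]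
  nlinarith

theorem Params.Tuned.div_alpha_sq_mul_log_le (ht : p.Tuned T δ c₁ c₂) (hc₁ : 0 < c₁) (hK : 1 ≤ K)
    (hT : 2 ≤ T) : (K / p.α) ^ 2 * Real.log (K * T) ≤ 2 / c₁ ^ 2 * rate K T ^ 2 := by
  have h1 := ht.div_alpha_mul_log_le hc₁ hK hT
  have h3 := half_le_log_mul hK hT
  have h5 := ht.alpha_pos hc₁ hK hT
  have ha : 0 ≤ K / p.α := by positivity
  have h2 : K / p.α ≤ 2 * (rate K T / c₁) := by nlinarith
  calc (K / p.α) ^ 2 * Real.log (K * T) = K / p.α * (K / p.α * Real.log (K * T)) := by ring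
    _ ≤ 2 * (rate K T / c₁) * (rate K T / c₁) := by
        have := half_le_rate hK hT
        gcongr
    _ = _ := by ring

/-- The leading term is `w (K/α) √s`, where `(K/α) log(KT)` is at most `rate K T / c₁`. All
lower-order terms are of order `rate²`, and `rate ≤ √s` turns one factor into `√s`. -/
theorem Params.Tuned.delay_le (ht : p.Tuned T δ c₁ c₂) (hδ : 0 < δ) (hc₁ : 0 < c₁) (hK : 1 ≤ K)
    (hT : 2 ≤ T) {s : ℕ} (hs : rate K T ^ 2 ≤ s) :
    (delay p s : ℝ) ≤ delayConst δ c₁ * rate K T * Real.sqrt s := by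
  have hα := ht.alpha_pos hc₁ hK hT
  have hℓ := half_le_rate hK hT
  have hl := half_le_log_mul hK hT
  have hw := windowSize_le hδ hK hT
  have hw2 := windowSize_eq K T δ
  rw [← ht.w_eq] at hw hw2
  set a := (K : ℝ) / p.α with ha
  set ℓ := rate K T with hℓdef
  set l := Real.log (K * T) with hldef
  have ha0 : 0 ≤ a := by positivity
  have hblock : (blockLength K p.α (2 * s) : ℝ) ≤ 4 * a * Real.sqrt s + a ^ 2 + a + 3 + K := by
    unfold blockLength
    have h1 : (0 : ℝ) ≤ 2 * a * Real.sqrt (2 * s) + a ^ 2 + a + 2 + K := by positivity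
    have h2 := (Nat.ceil_lt_add_one h1).le
    have h3 : Real.sqrt (2 * s) ≤ 2 * Real.sqrt s := by
      refine Real.sqrt_le_iff.2 ⟨by positivity, ?_⟩
      rw [mul_pow, Real.sq_sqrt (Nat.cast_nonneg _)]
      have : (0 : ℝ) ≤ s := Nat.cast_nonneg _
      linarith
    have h4 := mul_le_mul_of_nonneg_left h3 (by positivity : 0 ≤ 2 * a)
    linarith
  have hhalf : ((p.w / 2 : ℕ) : ℝ) = p.w / 2 := by
    have : (p.w : ℝ) = 2 * (p.w / 2 : ℕ) := by exact_mod_cast hw2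
    rw [this]; ring
  have hc := windowConst_pos δ
  have hb0 : 0 ≤ 4 * a * Real.sqrt s + a ^ 2 + a + 3 + K := by positivity
  have h1 : (delay p s : ℝ) ≤ windowConst δ * l / 2 * (4 * a * Real.sqrt s + a ^ 2 + a + 3 + K) := by
    unfold delay
    rw [Nat.cast_mul, hhalf]
    gcongr
  have h2 := ht.div_alpha_mul_log_le hc₁ hK hT
  have h3 := ht.div_alpha_sq_mul_log_le hc₁ hK hT
  have h4 := log_le_rate_sq hK hT
  have h5 := rate_sq hK hT
  rw [← ha, ← hldef, ← hℓdef] at h2 h3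
  rw [← hldef, ← hℓdef] at h4 h5
  have hsq : ℓ ≤ Real.sqrt s := Real.le_sqrt_of_sq_le hs
  have h6 : l * (4 * a * Real.sqrt s + a ^ 2 + a + 3 + K) ≤
      (6 / c₁ + 2 / c₁ ^ 2 + 4) * (ℓ * Real.sqrt s) := by
    have e1 : a * l * Real.sqrt s ≤ ℓ / c₁ * Real.sqrt s := by gcongr
    have e2 : ℓ ^ 2 ≤ ℓ * Real.sqrt s := by rw [sq]; gcongr
    have e3 : ℓ / c₁ ≤ 2 / c₁ * ℓ ^ 2 := by
      rw [div_mul_eq_mul_div]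
      gcongr
      nlinarith
    have e4 : 2 / c₁ ^ 2 * ℓ ^ 2 ≤ 2 / c₁ ^ 2 * (ℓ * Real.sqrt s) := by gcongr
    have e5 : 2 / c₁ * ℓ ^ 2 ≤ 2 / c₁ * (ℓ * Real.sqrt s) := by gcongr
    calc l * (4 * a * Real.sqrt s + a ^ 2 + a + 3 + K)
        = 4 * (a * l * Real.sqrt s) + a ^ 2 * l + a * l + 3 * l + K * l := by ring
      _ ≤ 4 * (ℓ / c₁ * Real.sqrt s) + 2 / c₁ ^ 2 * (ℓ * Real.sqrt s) +
          2 / c₁ * (ℓ * Real.sqrt s) + 3 * (ℓ * Real.sqrt s) + ℓ * Real.sqrt s := by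
          linarith
      _ = _ := by ring
  calc (delay p s : ℝ) ≤ windowConst δ / 2 * (l * (4 * a * Real.sqrt s + a ^ 2 + a + 3 + K)) := by
        linarith
    _ ≤ windowConst δ / 2 * ((6 / c₁ + 2 / c₁ ^ 2 + 4) * (ℓ * Real.sqrt s)) := by gcongr
    _ = _ := by unfold delayConst; ring

theorem Params.Tuned.alpha_sq_le (ht : p.Tuned T δ c₁ c₂) (hc₁ : 0 < c₁) (hK : 1 ≤ K)
    (hT : 2 ≤ T) : p.α ^ 2 ≤ c₂ ^ 2 * rate K T ^ 2 := by
  rw [← mul_pow]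
  have := ht.alpha_pos hc₁ hK hT
  exact pow_le_pow_left₀ this.le ht.α_upper 2

theorem Params.Tuned.firstStart_le (ht : p.Tuned T δ c₁ c₂) (hc₁ : 0 < c₁) (hK : 1 ≤ K)
    (hT : 2 ≤ T) : (firstStart K p.α : ℝ) ≤ startConst c₁ c₂ * rate K T ^ 2 := by
  have hα := ht.alpha_pos hc₁ hK hT
  have h1 := (Nat.ceil_lt_add_one (sq_nonneg (p.α - K / (4 * p.α)))).le
  have h2 : (p.α - K / (4 * p.α)) ^ 2 = p.α ^ 2 - K / 2 + (K / p.α) ^ 2 / 16 := by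
    field_simp; ring
  have h3 := ht.div_alpha_sq_mul_log_le hc₁ hK hT
  have h4 := half_le_log_mul hK hT
  have h5 := ht.alpha_sq_le hc₁ hK hT
  have h6 := le_two_mul_rate_sq hK hT
  have hK' : (1 : ℝ) ≤ K := by exact_mod_cast hK
  have h7 : (K / p.α) ^ 2 ≤ 2 * (2 / c₁ ^ 2 * rate K T ^ 2) := by nlinarith [sq_nonneg (K / p.α)]
  unfold firstStart startConst
  calc _ ≤ _ := h1
    _ ≤ c₂ ^ 2 * rate K T ^ 2 + 2 * (2 / c₁ ^ 2 * rate K T ^ 2) / 16 + 2 * rate K T ^ 2 := by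
      linarith
    _ = _ := by field_simp; ring

theorem two_le_startConst (c₁ c₂ : ℝ) : 2 ≤ startConst c₁ c₂ := by
  unfold startConst
  have : 0 ≤ c₂ ^ 2 + 1 / (4 * c₁ ^ 2) := by positivity
  linarith

theorem one_le_segConst (hc₁ : 0 < c₁) : 1 ≤ segConst δ c₁ c₂ := by
  have h1 := delayConst_pos (δ := δ) hc₁
  have h2 := two_le_startConst c₁ c₂
  unfold segConst
  nlinarith

/-- Segment lengths at the scale `√(K log (KT))`. -/
structure LongAtRate (B : Bandit K) (T : ℕ) (κ : ℝ) : Prop where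
  first : 2 ≤ B.numSegments T → κ * rate K T ^ 2 ≤ B.segLength T 1
  next : ∀ i, 2 ≤ i → i ≤ B.numSegments T →
    κ * rate K T * Real.sqrt (B.segLength T (i - 1)) ≤ B.segLength T i

/-- The lower bound on the first segment propagates: a segment of length at least `rate²` forces the
next to be at least `κ rate · rate`. -/
theorem LongAtRate.le_segLength {B : Bandit K} {κ : ℝ} (hl : LongAtRate B T κ) (hκ : 1 ≤ κ)
    (hK : 1 ≤ K) (hT : 2 ≤ T) {i : ℕ} (hi : i + 1 < B.numSegments T) :
    κ * rate K T ^ 2 ≤ B.segLength T (i + 1) := by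
  induction i with
  | zero => exact hl.first (by omega)
  | succ i ih =>
    have h1 := ih (by omega)
    have h2 := hl.next (i + 2) (by omega) (by omega)
    have h3 := half_le_rate hK hT
    have h4 : rate K T ≤ Real.sqrt (B.segLength T (i + 1)) := by
      refine Real.le_sqrt_of_sq_le (le_trans ?_ h1)
      nlinarith [sq_nonneg (rate K T)]
    have h5 : i + 2 - 1 = i + 1 := by omega
    rw [h5] at h2
    calc κ * rate K T ^ 2 = κ * rate K T * rate K T := by ring
      _ ≤ κ * rate K T * Real.sqrt (B.segLength T (i + 1)) := by gcongr
      _ ≤ _ := h2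

/-- The summands of `segConst` serve one purpose each: `16 delayConst²` keeps the delay below a
quarter of the old segment, `2 delayConst` below half of the new one, and `4 startConst` covers the
initial phase after an alarm. -/
theorem Params.Tuned.detectionRegime (ht : p.Tuned T δ c₁ c₂) (hδ : 0 < δ) (hc₁ : 0 < c₁)
    (hK : 1 ≤ K) (hT : 2 ≤ T) {B : Bandit K} (hl : LongAtRate B T (segConst δ c₁ c₂)) :
    DetectionRegime B p T δ (noiseLevel T p.w) := by
  have hκ := one_le_segConst (δ := δ) (c₂ := c₂) hc₁
  have hℓ := half_le_rate hK hT
  have hd := delayConst_pos (δ := δ) hc₁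
  have hs := two_le_startConst c₁ c₂
  have hseg : ∀ i, i + 1 < B.numSegments T →
      segConst δ c₁ c₂ * rate K T ^ 2 ≤ B.segLength T (i + 1) := fun i hi =>
    hl.le_segLength hκ hK hT hi
  have hℓs : ∀ i, i + 1 < B.numSegments T → rate K T ^ 2 ≤ B.segLength T (i + 1) := fun i hi =>
    le_trans (by nlinarith [sq_nonneg (rate K T)]) (hseg i hi)
  have hstart : ∀ i, i + 1 < B.numSegments T →
      4 * (startConst c₁ c₂ * rate K T ^ 2) ≤ B.segLength T (i + 1) := fun i hi => by
    refine le_trans ?_ (hseg i hi)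
    rw [← mul_assoc]
    gcongr
    unfold segConst
    nlinarith
  have hfirst : ∀ i, i + 1 < B.numSegments T → 4 * firstStart K p.α ≤ B.segLength T (i + 1) := by
    intro i hi
    have h1 := ht.firstStart_le hc₁ hK hT
    have h2 := hstart i hi
    have : (4 * firstStart K p.α : ℝ) ≤ B.segLength T (i + 1) := by linarith
    exact_mod_cast this
  refine ⟨?_, ?_, ht.noiseLevel_le hK hT, ht.add_noiseLevel_lt hδ hK hT, ?_, ?_, ?_, hfirst, ?_⟩
  · rw [ht.w_eq]; exact windowSize_eq K T δ
  · rw [ht.w_eq]; exact windowSize_half_pos hδ hT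
  · intro i hi
    have h1 := ht.delay_le hδ hc₁ hK hT (hℓs i hi)
    have h2 : 4 * delayConst δ c₁ * rate K T ≤ Real.sqrt (B.segLength T (i + 1)) := by
      refine Real.le_sqrt_of_sq_le (le_trans ?_ (hseg i hi))
      rw [mul_pow]
      gcongr
      unfold segConst
      nlinarith
    have h3 := Real.mul_self_sqrt (Nat.cast_nonneg (α := ℝ) (B.segLength T (i + 1)))
    have h4 := mul_le_mul_of_nonneg_right h2 (Real.sqrt_nonneg (B.segLength T (i + 1)))
    have : (4 * delay p (B.segLength T (i + 1)) : ℝ) ≤ B.segLength T (i + 1) := by linarith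
    exact_mod_cast this
  · intro i hi
    have h1 := ht.delay_le hδ hc₁ hK hT (hℓs i hi)
    have h2 := hl.next (i + 2) (by omega) (by omega)
    have h5 : i + 2 - 1 = i + 1 := by omega
    rw [h5] at h2
    have h6 : 2 * delayConst δ c₁ * (rate K T * Real.sqrt (B.segLength T (i + 1))) ≤
        segConst δ c₁ c₂ * (rate K T * Real.sqrt (B.segLength T (i + 1))) := by
      gcongr
      unfold segConst
      nlinarith
    have : (2 * delay p (B.segLength T (i + 1)) : ℝ) ≤ B.segLength T (i + 2) := by linarith
    exact_mod_cast this
  · intro i hi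
    rcases ht.uReset_eq with h | h
    · rw [h]
      have h1 := hstart i hi
      have h2 : 1 ≤ 2 * rate K T ^ 2 :=
        le_trans (by exact_mod_cast hK) (le_two_mul_rate_sq hK hT)
      have h3 : 2 * rate K T ^ 2 ≤ startConst c₁ c₂ * rate K T ^ 2 := by gcongr
      have : (4 * 1 : ℝ) ≤ B.segLength T (i + 1) := by linarith
      exact_mod_cast this
    · rw [h]; exact hfirst i hi
  · intro i hi
    refine le_trans ?_ (hstart i hi)
    have h1 := ht.alpha_sq_le hc₁ hK hT
    have h2 := le_two_mul_rate_sq hK hT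
    have h3 : 0 ≤ 1 / (4 * c₁ ^ 2) * rate K T ^ 2 := by positivity
    unfold startConst
    nlinarith

end Tuning

/-! ## The regret bound -/

section Main

variable {K T : ℕ} {p : Params K} {δ c₁ c₂ : ℝ}

theorem numSegments_le (B : Bandit K) (hT : 1 ≤ T) : B.numSegments T ≤ T := by
  have : (B.changeTimes T).card ≤ (Finset.Icc 1 (T - 1)).card :=
    Finset.card_le_card fun t ht => Finset.mem_Icc.2 ((mem_changeTimes B T).1 ht).1
  rw [Nat.card_Icc] at this
  unfold Bandit.numSegments
  omega

theorem one_le_numSegments (B : Bandit K) (T : ℕ) : 1 ≤ B.numSegments T := by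
  unfold Bandit.numSegments; omega

theorem sum_sqrt_segLength_le (B : Bandit K) (hT : 1 ≤ T) :
    ∑ i ∈ Finset.range (B.numSegments T), Real.sqrt (B.segLength T (i + 1)) ≤
      Real.sqrt (B.numSegments T * T) := by
  refine Real.le_sqrt_of_sq_le ?_
  have h1 := sq_sum_le_card_mul_sum_sq (s := Finset.range (B.numSegments T))
    (f := fun i => Real.sqrt (B.segLength T (i + 1)))
  refine h1.trans (le_of_eq ?_)
  rw [Finset.sum_congr rfl fun i _ => Real.sq_sqrt (Nat.cast_nonneg _), Finset.card_range,
    ← Nat.cast_sum, sum_segLength B T hT]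

/-- The constant of the regret bound in terms of `√(K log (KT))`. -/
def regretConst (δ c₁ c₂ : ℝ) : ℝ := delayConst δ c₁ + 2 * c₂ + 21

theorem regretBudget_le (ht : p.Tuned T δ c₁ c₂) (hδ : 0 < δ) (hc₁ : 0 < c₁) (hK : 1 ≤ K)
    (hT : 2 ≤ T) {B : Bandit K} (hl : LongAtRate B T (segConst δ c₁ c₂)) (r₀ : ℕ) :
    regretBudget B p T (Real.log (K * T)) r₀ ≤
      (delayConst δ c₁ + 2 * c₂ + 11) * rate K T * Real.sqrt (B.numSegments T * T) +
        B.numSegments T * r₀ := by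
  have hκ := one_le_segConst (δ := δ) (c₂ := c₂) hc₁
  have hℓ := half_le_rate hK hT
  have hd := delayConst_pos (δ := δ) hc₁
  have hα := ht.alpha_pos hc₁ hK hT
  have hK' : (1 : ℝ) ≤ K := by exact_mod_cast hK
  have hT' : (2 : ℝ) ≤ T := by exact_mod_cast hT
  have hlog := half_le_log_mul hK hT
  have hℓsq := rate_sq hK hT
  have hαup : p.α ≤ c₂ * rate K T := ht.α_upper
  have hc₂ : 0 ≤ c₂ := by
    by_contra h
    have : c₂ * rate K T < 0 := mul_neg_of_neg_of_pos (by linarith) (by linarith)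
    linarith
  have hdelay : ∑ i ∈ Finset.range (B.numSegments T), (B.delayAt p T i : ℝ) ≤
      ∑ i ∈ Finset.range (B.numSegments T),
        delayConst δ c₁ * rate K T * Real.sqrt (B.segLength T (i + 1)) := by
    obtain ⟨n, hn⟩ : ∃ n, B.numSegments T = n + 1 :=
      ⟨B.numSegments T - 1, by have := one_le_numSegments B T; omega⟩
    -- The delay in a segment is governed by the length of the previous one, so the index is
    -- shifted; the first segment has no delay and the last length is not needed.
    rw [hn, Finset.sum_range_succ', Finset.sum_range_succ]
    have h0 : ((B.delayAt p T 0 : ℕ) : ℝ) = 0 := Nat.cast_zero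
    rw [h0]
    refine add_le_add (Finset.sum_le_sum fun i hi => ?_) (by positivity)
    have hi' : i + 1 < B.numSegments T := by have := Finset.mem_range.1 hi; omega
    refine ht.delay_le hδ hc₁ hK hT (le_trans ?_ (hl.le_segLength hκ hK hT hi'))
    nlinarith [sq_nonneg (rate K T)]
  have hsqK : Real.sqrt K ≤ 2 * rate K T := by
    refine Real.sqrt_le_iff.2 ⟨by positivity, ?_⟩
    nlinarith
  have hb : (Real.sqrt (2 * Real.log (K * T)) + Real.sqrt (2 * Real.log T)) * Real.sqrt K ≤
      3 * rate K T := by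
    have h1 : Real.sqrt (2 * Real.log T) ≤ Real.sqrt (2 * Real.log (K * T)) := by
      apply Real.sqrt_le_sqrt
      gcongr
      nlinarith
    have h2 : Real.sqrt (2 * Real.log (K * T)) * Real.sqrt K ≤ 3 / 2 * rate K T := by
      rw [← Real.sqrt_mul (by positivity)]
      refine Real.sqrt_le_iff.2 ⟨by positivity, ?_⟩
      rw [mul_pow, hℓsq]
      have : 0 ≤ K * Real.log (K * T) := by positivity
      linarith
    have h3 := mul_le_mul_of_nonneg_right h1 (Real.sqrt_nonneg K)
    rw [add_mul]
    linarith
  unfold regretBudget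
  rw [Finset.sum_add_distrib]
  have hrest : ∀ i ∈ Finset.range (B.numSegments T),
      (2 * p.α * Real.sqrt (B.segLength T (i + 1)) + Real.sqrt (K * B.segLength T (i + 1)) + r₀ +
      3 * (Real.sqrt (2 * Real.log (K * T)) + Real.sqrt (2 * Real.log T)) *
        Real.sqrt (K * B.segLength T (i + 1))) ≤
      (2 * c₂ + 11) * rate K T * Real.sqrt (B.segLength T (i + 1)) + r₀ := by
    intro i _
    set q := Real.sqrt (B.segLength T (i + 1)) with hq
    have hq0 : 0 ≤ q := Real.sqrt_nonneg _
    rw [Real.sqrt_mul (Nat.cast_nonneg _), ← hq]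
    have h1 := mul_le_mul_of_nonneg_right hαup hq0
    have h2 := mul_le_mul_of_nonneg_right hsqK hq0
    have h3 := mul_le_mul_of_nonneg_right hb hq0
    linarith
  have hr := (Finset.sum_le_sum hrest).trans_eq
    (show _ = (2 * c₂ + 11) * rate K T * ∑ i ∈ Finset.range (B.numSegments T),
        Real.sqrt (B.segLength T (i + 1)) + B.numSegments T * r₀ by
      rw [Finset.sum_add_distrib, ← Finset.mul_sum, Finset.sum_const, Finset.card_range,
        nsmul_eq_mul])
  rw [← Finset.mul_sum] at hdelay
  have hsum := sum_sqrt_segLength_le B (T := T) (by omega)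
  have h1 := mul_le_mul_of_nonneg_left hsum
    (by positivity : 0 ≤ (delayConst δ c₁ + 2 * c₂ + 11) * rate K T)
  linarith

theorem regret_le_rate (ht : p.Tuned T δ c₁ c₂) (hδ : 0 < δ) (hc₁ : 0 < c₁) (hK : 1 ≤ K)
    (hT : 2 ≤ T) {B : Bandit K} (hgap : B.GapAtLeast T δ)
    (hl : LongAtRate B T (segConst δ c₁ c₂)) {Ω : Type v} [MeasurableSpace Ω] {P : Measure Ω}
    [IsProbabilityMeasure P] {X : ℕ → Ω → Fin K → ℝ} (hX : B.IsRewardSeq P X) :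
    regret B p P X T ≤ regretConst δ c₁ c₂ * rate K T * Real.sqrt (B.numSegments T * T) := by
  have hT' : (2 : ℝ) ≤ T := by exact_mod_cast hT
  have hℓ := half_le_rate hK hT
  have hw : 0 < p.w := by
    have := windowSize_half_pos (K := K) hδ hT
    rw [ht.w_eq]; omega
  set M := (B.numSegments T : ℝ) with hM
  have hM1 : 1 ≤ M := Nat.one_le_cast.2 (one_le_numSegments B T)
  have hMT : M ≤ T := Nat.cast_le.2 (numSegments_le B (by omega : 1 ≤ T))
  have hM0 : 0 < M := by linarith
  have hT0 : (0 : ℝ) < T := by linarith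
  -- With this choice the conceded rounds cost `M r₀ ≤ √(MT) + M`, and the underestimation term
  -- `T/r₀²` is at most `M`; moreover `M ≤ √(MT)`.
  set r₀ := ⌈Real.sqrt (T / M)⌉₊ with hr₀
  have hpos : 0 < Real.sqrt (T / M) := Real.sqrt_pos.2 (by positivity)
  have hr₀1 : 1 ≤ r₀ := Nat.ceil_pos.2 hpos
  have h := (ht.detectionRegime hδ hc₁ hK hT hl).regret_le hX hT hK (ht.alpha_pos hc₁ hK hT)
    ht.sel_mem hgap (Real.sqrt_nonneg _) (log_le_noiseLevel hw hT) hr₀1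
  have hbud := regretBudget_le ht hδ hc₁ hK hT hl r₀
  rw [← hM] at hbud
  set S := Real.sqrt (M * T) with hS
  have hSM : M ≤ S := Real.le_sqrt_of_sq_le (by nlinarith)
  have hr1 : M * r₀ ≤ 2 * S := by
    have h1 := (Nat.ceil_lt_add_one hpos.le).le
    have h2 : M * Real.sqrt (T / M) = S := by
      rw [hS, ← Real.sqrt_sq hM0.le, ← Real.sqrt_mul (sq_nonneg _), Real.sqrt_sq hM0.le]
      congr 1
      field_simp
    have h3 := mul_le_mul_of_nonneg_left h1 hM0.le
    rw [mul_add, h2, mul_one] at h3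
    linarith
  have hr2 : T / (r₀ : ℝ) ^ 2 ≤ S := by
    have h1 : Real.sqrt (T / M) ≤ r₀ := Nat.le_ceil _
    have h2 : T / M ≤ (r₀ : ℝ) ^ 2 := by
      rw [← Real.sq_sqrt (by positivity : 0 ≤ T / M)]
      gcongr
    have h3 : (0 : ℝ) < r₀ := by exact_mod_cast hr₀1
    refine le_trans ?_ hSM
    rw [div_le_iff₀ (by positivity)]
    rw [div_le_iff₀ hM0] at h2
    linarith
  -- Five copies of `S`: two for `M r₀`, two for the additive 2, one for `T/r₀²`. They are converted
  -- by `rate ≥ 1/2`.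
  have h5 : 5 * S ≤ 10 * rate K T * S := by
    have : 0 ≤ S := Real.sqrt_nonneg _
    nlinarith
  unfold regretConst
  linarith

/-- For `K ≤ T` the logarithm of `KT` is at most `2 log T`. For `K ≥ T` the claimed root is at least
`T/2`, so the trivial bound `T` is enough. -/
theorem regret_le_of_longAtRate (ht : p.Tuned T δ c₁ c₂) (hδ : 0 < δ) (hc₁ : 0 < c₁)
    (hc₂ : c₁ ≤ c₂) (hK : 1 ≤ K) (hT : 2 ≤ T) {B : Bandit K} (hgap : B.GapAtLeast T δ)
    (hl : LongAtRate B T (segConst δ c₁ c₂)) {Ω : Type v} [MeasurableSpace Ω] {P : Measure Ω}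
    [IsProbabilityMeasure P] {X : ℕ → Ω → Fin K → ℝ} (hX : B.IsRewardSeq P X) :
    regret B p P X T ≤
      2 * regretConst δ c₁ c₂ * Real.sqrt (K * B.numSegments T * T * Real.log T) := by
  have hT' : (2 : ℝ) ≤ T := by exact_mod_cast hT
  have hK' : (1 : ℝ) ≤ K := by exact_mod_cast hK
  have hM1 : (1 : ℝ) ≤ B.numSegments T := by exact_mod_cast one_le_numSegments B T
  have hlogT := half_le_log hT'
  have hC : 1 ≤ regretConst δ c₁ c₂ := by
    have := delayConst_pos (δ := δ) hc₁
    unfold regretConst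
    linarith
  rcases le_total K T with hKT | hKT
  · have hKT' : (K : ℝ) ≤ T := by exact_mod_cast hKT
    have h1 := regret_le_rate ht hδ hc₁ hK hT hgap hl hX
    refine h1.trans ?_
    rw [mul_assoc, mul_comm 2, mul_assoc]
    refine mul_le_mul_of_nonneg_left ?_ (by linarith)
    rw [rate, ← Real.sqrt_mul (by have := half_le_log_mul hK hT; positivity)]
    refine Real.sqrt_le_iff.2 ⟨by positivity, ?_⟩
    rw [mul_pow, Real.sq_sqrt (by positivity)]
    have h2 : Real.log (K * T) ≤ 2 * Real.log T := by
      rw [Real.log_mul (by positivity) (by positivity)]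
      have := Real.log_le_log (by positivity) hKT'
      linarith
    have h3 : 0 ≤ (K : ℝ) * B.numSegments T * T := by positivity
    nlinarith [mul_le_mul_of_nonneg_left h2 h3, mul_nonneg h3 (by linarith : 0 ≤ Real.log T)]
  · have hKT' : (T : ℝ) ≤ K := by exact_mod_cast hKT
    have h1 := regret_le_horizon hK hX p T
    have h2 : (T : ℝ) / 2 ≤ Real.sqrt (K * B.numSegments T * T * Real.log T) := by
      refine Real.le_sqrt_of_sq_le ?_
      calc ((T : ℝ) / 2) ^ 2 ≤ T * 1 * T * (1 / 2) := by nlinarith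
        _ ≤ _ := by gcongr
    have h3 := Real.sqrt_nonneg (K * B.numSegments T * T * Real.log T)
    nlinarith

theorem LongAtRate.of_longSegments {B : Bandit K} {κ κ' : ℝ} (hl : B.LongSegments T κ)
    (h1 : κ' * rate K T ^ 2 ≤ κ * segScale K T ^ 2)
    (h2 : κ' * rate K T ≤ κ * segScale K T) : LongAtRate B T κ' :=
  ⟨fun h => h1.trans (hl.1 h), fun i hi hi' =>
    (mul_le_mul_of_nonneg_right h2 (Real.sqrt_nonneg _)).trans (hl.2 i hi hi')⟩

theorem regretBound_segConst (hδ : 0 < δ) (hc₁ : 0 < c₁) (hc₂ : c₁ ≤ c₂) (hK : 1 ≤ K) :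
    RegretBound.{v} δ c₁ c₂ (segConst δ c₁ c₂) K (2 * regretConst δ c₁ c₂) := by
  intro T hT p ht B hgap hl Ω _ P _ X hX
  have h1 : rate K T ≤ segScale K T := by
    have := half_le_log_mul hK hT
    unfold segScale
    change _ ≤ _ + rate K T
    linarith
  have h2 := half_le_rate hK hT
  have h3 := one_le_segConst (δ := δ) (c₂ := c₂) hc₁
  exact regret_le_of_longAtRate ht hδ hc₁ hc₂ hK hT hgap
    (LongAtRate.of_longSegments hl (by gcongr) (by gcongr)) hX

/-- The conditions needed are `ρ √(K log(KT)) ≤ log(KT)` and `ρ K log(KT) ≤ log(KT)²`. They amount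
to `log(KT) ≥ ρ²K` and `log(KT) ≥ ρK`, which hold once `T ≥ exp((ρ² + ρ)K)`. -/
theorem exists_regretBound (hδ : 0 < δ) (hc₁ : 0 < c₁) (hc₂ : c₁ ≤ c₂) {κ : ℝ} (hκ : 0 < κ)
    (hK : 1 ≤ K) : ∃ C, RegretBound.{v} δ c₁ c₂ κ K C := by
  set ρ := segConst δ c₁ c₂ / κ with hρ
  have h3 := one_le_segConst (δ := δ) (c₂ := c₂) hc₁
  have hρ0 : 0 < ρ := by positivity
  have hρκ : ρ * κ = segConst δ c₁ c₂ := by rw [hρ]; field_simp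
  have hC : 0 ≤ regretConst δ c₁ c₂ := by
    have := delayConst_pos (δ := δ) hc₁
    unfold regretConst
    linarith
  refine ⟨2 * regretConst δ c₁ c₂ + Real.exp ((ρ ^ 2 + ρ) * K), ?_⟩
  intro T hT p ht B hgap hl Ω _ P _ X hX
  have hT' : (2 : ℝ) ≤ T := by exact_mod_cast hT
  have hK' : (1 : ℝ) ≤ K := by exact_mod_cast hK
  have hM1 : (1 : ℝ) ≤ B.numSegments T := by exact_mod_cast one_le_numSegments B T
  have hlogT := half_le_log hT'
  have hroot : 1 ≤ Real.sqrt (K * B.numSegments T * T * Real.log T) := by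
    refine Real.le_sqrt_of_sq_le ?_
    calc (1 : ℝ) ^ 2 = 1 * 1 * 2 * (1 / 2) := by norm_num
      _ ≤ _ := by gcongr
  -- Short horizons are absorbed by the constant: the regret is at most `T`, and the root on the
  -- right is at least 1.
  rcases le_total (T : ℝ) (Real.exp ((ρ ^ 2 + ρ) * K)) with hsmall | hlarge
  · have h1 := regret_le_horizon hK hX p T
    have h2 := Real.exp_pos ((ρ ^ 2 + ρ) * K)
    nlinarith
  · have hlog : (ρ ^ 2 + ρ) * K ≤ Real.log (K * T) := by
      have h1 := Real.log_le_log (Real.exp_pos _) hlarge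
      rw [Real.log_exp] at h1
      refine h1.trans (Real.log_le_log (by positivity) (by nlinarith))
    have hl0 := half_le_log_mul hK hT
    have hr0 := half_le_rate hK hT
    have hrsq := rate_sq hK hT
    have hscale : Real.log (K * T) ≤ segScale K T := by
      unfold segScale
      have := Real.sqrt_nonneg (K * Real.log (K * T))
      linarith
    have hρ1 : ρ * K ≤ Real.log (K * T) := by nlinarith [mul_nonneg (sq_nonneg ρ) (by linarith : (0:ℝ) ≤ K)]
    have hρ2 : ρ ^ 2 * K ≤ Real.log (K * T) := by nlinarith
    have h1 : ρ * rate K T ≤ Real.log (K * T) := by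
      refine le_of_sq_le_sq ?_ (by linarith)
      rw [mul_pow, hrsq]
      nlinarith
    have h2 : ρ * rate K T ^ 2 ≤ Real.log (K * T) ^ 2 := by
      rw [hrsq]
      nlinarith
    have hlong : LongAtRate B T (segConst δ c₁ c₂) := by
      refine LongAtRate.of_longSegments hl ?_ ?_
      · rw [← hρκ]
        have h4 : Real.log (K * T) ^ 2 ≤ segScale K T ^ 2 := by gcongr
        nlinarith
      · rw [← hρκ]
        nlinarith
    have h4 := regret_le_of_longAtRate ht hδ hc₁ hc₂ hK hT hgap hlong hX
    have h5 := Real.exp_pos ((ρ ^ 2 + ρ) * K)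
    have h6 : 0 ≤ Real.exp ((ρ ^ 2 + ρ) * K) *
      Real.sqrt (K * B.numSegments T * T * Real.log T) := by positivity
    linarith

end Main

end DimExp

end

theorem corollary1 (δ c₁ c₂ : ℝ) (hδ : 0 < δ) (hc₁ : 0 < c₁) (hc₂ : c₁ ≤ c₂) :
    (∃ κ > 0, ∃ C : ℝ, ∀ K : ℕ, 1 ≤ K → DimExp.RegretBound.{v} δ c₁ c₂ κ K C) ∧
    (∀ κ > 0, ∀ K : ℕ, 1 ≤ K → ∃ C : ℝ, DimExp.RegretBound.{v} δ c₁ c₂ κ K C) :=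
  ⟨⟨DimExp.segConst δ c₁ c₂, zero_lt_one.trans_le (DimExp.one_le_segConst hc₁),
    2 * DimExp.regretConst δ c₁ c₂, fun _ hK => DimExp.regretBound_segConst hδ hc₁ hc₂ hK⟩,
    fun _ hκ _ hK => DimExp.exists_regretBound hδ hc₁ hc₂ hκ hK⟩
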